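/- Let $M\subset\mathbb R^N$ be an embedded submanifold of dimension $d\in\{1,\dots,N\}$: around each $m\in M$ there are an open $U\subset\mathbb R^N$ and a smooth $F:U\to\mathbb R^{N-d}$ with $F'(x)$ surjective for all $x\in U$ and $U\cap M=\{x\in U: F(x)=0\}$; then $T_mM=\ker F'(m)$. Let $\Gamma(TM)$ be the space of smooth maps $V:M\to\mathbb R^N$ with $V(m)\in T_mM$ for all $m\in M$. Fix $p\in[2,3)$, $0<T<\infty$ and a control $\omega$ on $[0,T]$, i.e. a continuous superadditive function $\omega:\{0\le s\le t\le T\}\to[0,\infty)$ which is zero on the diagonal and positive off it. For $0<S\le T$ and functions $g,h$ on $\{0\le s\le t\le S\}$, write $g_{s,t}\simeq h_{s,t}$ if there are $\delta,C>0$ with $|g_{s,t}-h_{s,t}|\le C\,\omega(s,t)^{3/p}$ whenever $0\le s\le t\le S$ and $t-s\le\delta$. For a finite-dimensional Euclidean space $V$, $WG_p([0,S],V)$ is the set of pairs $\mathbf X=(x,\mathbb X)$ of continuous maps $x:[0,S]\to V$ and $\mathbb X:\{0\le s\le t\le S\}\to V\otimes V$ such that, with $x_{s,t}=x_t-x_s$,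 $$\mathbb X_{s,t}=\mathbb X_{s,u}+\mathbb X_{u,t}+x_{s,u}\otimes x_{u,t}\quad(s\le u\le t),\qquad \sup_{s<t}\frac{|x_{s,t}|}{\omega(s,t)^{1/p}}<\infty,\qquad \sup_{s<t}\frac{|\mathbb X_{s,t}|}{\omega(s,t)^{2/p}}<\infty,$$ and the symmetric part of $\mathbb X_{s,t}$ equals $\tfrac12x_{s,t}\otimes x_{s,t}$. For a smooth one form $\alpha:V\to\mathrm{Hom}(V,W)$, the rough integral $\int\alpha(d\mathbf X)$ is the unique $\mathbf I=(I,\mathbb I)\in WG_p([0,S],W)$ with $I_0=0$, $I_{s,t}\simeq\alpha(x_s)x_{s,t}+\alpha'(x_s)\mathbb X_{s,t}$ and $\mathbb I_{s,t}\simeq(\alpha(x_s)\otimes\alpha(x_s))\mathbb X_{s,t}$, where $\alpha'(x)[a\otimes b]=(\partial_a\alpha)(x)b$. Let $WG_p([0,S],M)$ be the set of $\mathbf X\in WG_p([0,S],\mathbb R^N)$ with $x_t\in M$ for all $t\in[0,S]$ and $\int\alpha(d\mathbf X)\equiv0$ for every finite-dimensional $W$ and every smooth $W$-valued one form $\alpha$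 on $\mathbb R^N$ whose restriction to $TM$ vanishes. Let $Y:\mathbb R^n\to\Gamma(TM)$, $a\mapsto Y_a$, be linear, let $\mathbf Z=(z,\mathbb Z)\in WG_p([0,T],\mathbb R^n)$ and let $x_0\in M$. We say that $\mathbf X\in WG_p([0,S],M)$ solves $$d\mathbf X_t=Y_{d\mathbf Z_t}(x_t),\qquad x(0)=x_0,\tag{1}$$ on $[0,S]$ if $x(0)=x_0$ and, on $[0,S]$, $$x_{s,t}\simeq Y_{z_{s,t}}(x_s)+(\partial_{Y_a}Y_b)(x_s)|_{a\otimes b=\mathbb Z_{s,t}},\qquad \mathbb X_{s,t}\simeq Y_a(x_s)\otimes Y_b(x_s)|_{a\otimes b=\mathbb Z_{s,t}}.$$ Here $B(a,b)|_{a\otimes b=A}$ denotes the value at the tensor $A$ of the linear map induced by the bilinear map $B$. We say that $\mathbf X$ solves (1) on $[0,\tau)$ if its restriction to $[0,S]$ solves (1) on $[0,S]$ for every $0<S<\tau$. **Theorem 4.2.** (Uniqueness) For every $S\in(0,T]$, any two solutions of (1) on $[0,S]$ coincide: their traces agree on $[0,S]$ and their second order processes agree on $\{0\le s\le t\le S\}$.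 (Existence up to explosion) Either (1) has a solution on $[0,T]$, or there are $\tau\in(0,T]$ and a solution $\mathbf X=(x,\mathbb X)$ of (1) on $[0,\tau)$ such that the closure in $M$ of $\{x(t):0\le t<\tau\}$ is not compact. -/

import Mathlib

open scoped TensorProduct Topology

noncomputable section

namespace RoughManifold

/-! ## Rough paths -/

/-- The Euclidean space `ℝⁿ`. -/
abbrev Euc (n : ℕ) : Type := EuclideanSpace ℝ (Fin n)

/-- A control on `[0,T]`: a continuous superadditive function on the simplex
`{(s,t) : 0 ≤ s ≤ t ≤ T}`, zero on the diagonal and positive off the diagonal. -/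
structure IsControl (T : ℝ) (ω : ℝ → ℝ → ℝ) : Prop where
  continuousOn : ContinuousOn (fun q : ℝ × ℝ => ω q.1 q.2)
    {q : ℝ × ℝ | 0 ≤ q.1 ∧ q.1 ≤ q.2 ∧ q.2 ≤ T}
  superadditive : ∀ s u t, 0 ≤ s → s ≤ u → u ≤ t → t ≤ T → ω s u + ω u t ≤ ω s t
  pos : ∀ s t, 0 ≤ s → s < t → t ≤ T → 0 < ω s t
  diag : ∀ t, 0 ≤ t → t ≤ T → ω t t = 0

/-- A pair `(x, 𝕏)` consisting of a path `x` and a two-parameter process `𝕏` with values in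
`V ⊗ V`. Only the values of `x` on `[0,S]` and of `𝕏` on `{0 ≤ s ≤ t ≤ S}` are ever used, where
`[0,S]` is the time interval under consideration. -/
structure RoughPair (V : Type*) [NormedAddCommGroup V] [InnerProductSpace ℝ V] where
  /-- the trace `x` -/
  trace : ℝ → V
  /-- the second order process `𝕏` -/
  second : ℝ → ℝ → V ⊗[ℝ] V

section RoughPaths

variable {V : Type*} [NormedAddCommGroup V] [InnerProductSpace ℝ V]
variable {W : Type*} [NormedAddCommGroup W] [InnerProductSpace ℝ W]

/-- The increment `x_{s,t} = x_t - x_s`. -/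
def RoughPair.incr (X : RoughPair V) (s t : ℝ) : V := X.trace t - X.trace s

/-- The pair which is identically zero. -/
def RoughPair.zero (V : Type*) [NormedAddCommGroup V] [InnerProductSpace ℝ V] : RoughPair V :=
  ⟨fun _ => 0, fun _ _ => 0⟩

/-- The two pairs coincide on the time interval `[0,S]`. -/
def RoughPair.AgreeOn (S : ℝ) (X X' : RoughPair V) : Prop :=
  (∀ t, 0 ≤ t → t ≤ S → X.trace t = X'.trace t) ∧
    ∀ s t, 0 ≤ s → s ≤ t → t ≤ S → X.second s t = X'.second s t

/-- The symmetric part of a tensor `A ∈ V ⊗ V`. -/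
def symPart (A : V ⊗[ℝ] V) : V ⊗[ℝ] V := (1 / 2 : ℝ) • (A + TensorProduct.comm ℝ V V A)

/-- `B(a,b)|_{a ⊗ b = A}` for a bilinear map `B` and a tensor `A`. -/
def evalTensor {V W : Type*} [AddCommGroup V] [Module ℝ V] [AddCommGroup W] [Module ℝ W]
    (B : V →ₗ[ℝ] V →ₗ[ℝ] W) (A : V ⊗[ℝ] V) : W := TensorProduct.lift B A

/-- `R_p([0,S],V,ω)`: `p`-rough paths on `[0,S]` controlled by `ω`. -/
structure IsRoughPath (p : ℝ) (ω : ℝ → ℝ → ℝ) (S : ℝ) (X : RoughPair V) : Prop where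
  continuousOn_trace : ContinuousOn X.trace (Set.Icc 0 S)
  continuousOn_second : ContinuousOn (fun q : ℝ × ℝ => X.second q.1 q.2)
    {q : ℝ × ℝ | 0 ≤ q.1 ∧ q.1 ≤ q.2 ∧ q.2 ≤ S}
  chen : ∀ s u t, 0 ≤ s → s ≤ u → u ≤ t → t ≤ S →
    X.second s t = X.second s u + X.second u t + X.incr s u ⊗ₜ[ℝ] X.incr u t
  bound_trace : ∃ C : ℝ, ∀ s t, 0 ≤ s → s < t → t ≤ S →
    ‖X.incr s t‖ / (ω s t) ^ (1 / p) ≤ C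
  bound_second : ∃ C : ℝ, ∀ s t, 0 ≤ s → s < t → t ≤ S →
    ‖X.second s t‖ / (ω s t) ^ (2 / p) ≤ C

/-- `WG_p([0,S],V)`: weakly geometric `p`-rough paths in the vector space `V`. -/
structure IsWeaklyGeometric (p : ℝ) (ω : ℝ → ℝ → ℝ) (S : ℝ) (X : RoughPair V) : Prop where
  isRoughPath : IsRoughPath p ω S X
  sym : ∀ s t, 0 ≤ s → s ≤ t → t ≤ S →
    symPart (X.second s t) = (1 / 2 : ℝ) • (X.incr s t ⊗ₜ[ℝ] X.incr s t)

/-- The relation `g_{s,t} ≃ h_{s,t}` on `[0,S]`: there are `δ, C > 0` with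
`|g_{s,t} - h_{s,t}| ≤ C ω(s,t)^{3/p}` whenever `0 ≤ s ≤ t ≤ S` and `|t - s| ≤ δ`. -/
def ApproxEq (p : ℝ) (ω : ℝ → ℝ → ℝ) (S : ℝ) (g h : ℝ → ℝ → W) : Prop :=
  ∃ δ > 0, ∃ C > 0, ∀ s t, 0 ≤ s → s ≤ t → t ≤ S → |s - t| ≤ δ →
    ‖g s t - h s t‖ ≤ C * (ω s t) ^ (3 / p)

/-- The bilinear map `(a, b) ↦ (∂_a α)(x) b`, that is, `α'(x)[a ⊗ b]`, of a one form `α`. -/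
def oneFormDeriv (α : V → V →L[ℝ] W) (x : V) : V →ₗ[ℝ] V →ₗ[ℝ] W :=
  (fderiv ℝ α x).toLinearMap₁₂

/-- `I = ∫ α(dX)` on `[0,S]`: the weakly geometric rough path `I` in `W` starting at `0` with
`I¹_{s,t} ≃ α(x_s) x_{s,t} + α'(x_s) 𝕏_{s,t}` and `I²_{s,t} ≃ (α(x_s) ⊗ α(x_s)) 𝕏_{s,t}`. -/
structure IsRoughIntegral (p : ℝ) (ω : ℝ → ℝ → ℝ) (S : ℝ) (α : V → V →L[ℝ] W)
    (X : RoughPair V) (I : RoughPair W) : Prop where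
  weaklyGeometric : IsWeaklyGeometric p ω S I
  start : I.trace 0 = 0
  first : ApproxEq p ω S I.incr fun s t =>
    α (X.trace s) (X.incr s t) + evalTensor (oneFormDeriv α (X.trace s)) (X.second s t)
  second : ApproxEq p ω S I.second fun s t =>
    TensorProduct.map (α (X.trace s)).toLinearMap (α (X.trace s)).toLinearMap (X.second s t)

end RoughPaths

/-! ## Embedded submanifolds and vector fields -/

section Manifold

variable {N : ℕ}

/-- `F : U → ℝ^{N-d}` is a local defining function of `M`. -/
structure IsLocalDefining (d : ℕ) (M : Set (Euc N)) (U : Set (Euc N))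
    (F : Euc N → Euc (N - d)) : Prop where
  isOpen : IsOpen U
  smooth : ContDiffOn ℝ (⊤ : ℕ∞) F U
  zeroSet : U ∩ M = {x ∈ U | F x = 0}
  surjective : ∀ x ∈ U, Function.Surjective (fderiv ℝ F x)

/-- `M` is a `d`-dimensional embedded submanifold of `ℝ^N`, `d ∈ {1, …, N}`. -/
structure IsEmbeddedSubmanifold (d : ℕ) (M : Set (Euc N)) : Prop where
  one_le : 1 ≤ d
  le : d ≤ N
  exists_defining : ∀ m ∈ M, ∃ (U : Set (Euc N)) (F : Euc N → Euc (N - d)),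
    m ∈ U ∧ IsLocalDefining d M U F

/-- The tangent plane to `M` at `m`: the null space of `F'(m)`, where `F` is a local defining
function around `m`. All local defining functions around `m ∈ M` give the same null space (see
`tangentPlane_eq_ker`), so their intersection is the null space of each of them. -/
def tangentPlane (d : ℕ) (M : Set (Euc N)) (m : Euc N) : Submodule ℝ (Euc N) :=
  ⨅ (U : Set (Euc N)) (F : Euc N → Euc (N - d)) (_ : m ∈ U) (_ : IsLocalDefining d M U F),
    (fderiv ℝ F m).ker

theorem ker_le_ker_of_isLocalDefining {d : ℕ} {M : Set (Euc N)} {m : Euc N} (hm : m ∈ M)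
    {U U' : Set (Euc N)} {F F' : Euc N → Euc (N - d)} (hU : m ∈ U) (hU' : m ∈ U')
    (hF : IsLocalDefining d M U F) (hF' : IsLocalDefining d M U' F') :
    (fderiv ℝ F m).ker ≤ (fderiv ℝ F' m).ker := by
  intro v hv
  have hs : HasStrictFDerivAt F (fderiv ℝ F m) m :=
    (hF.smooth.contDiffAt (hF.isOpen.mem_nhds hU)).hasStrictFDerivAt (by simp)
  have hd : HasFDerivAt F' (fderiv ℝ F' m) m :=
    ((hF'.smooth.contDiffAt (hF'.isOpen.mem_nhds hU')).differentiableAt (by simp)).hasFDerivAt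
  have hr : (fderiv ℝ F m).range = ⊤ := LinearMap.range_eq_top.2 (hF.surjective m hU)
  have hzero : ∀ {U : Set (Euc N)} {F : Euc N → Euc (N - d)}, IsLocalDefining d M U F →
      ∀ x ∈ U, (x ∈ M ↔ F x = 0) := by
    intro U F h x hx
    have := Set.ext_iff.1 h.zeroSet x
    simpa [hx] using this
  have hFm : F m = 0 := (hzero hF m hU).1 hm
  set φ : (fderiv ℝ F m).ker → Euc N := hs.implicitFunction F (fderiv ℝ F m) hr (F m) with hφ
  have hφ0 : φ 0 = m := hs.implicitFunction_apply_image hr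
  have hφd : HasFDerivAt φ (fderiv ℝ F m).ker.subtypeL 0 :=
    (hs.to_implicitFunction hr).hasFDerivAt
  have hφc : Filter.Tendsto φ (𝓝 0) (𝓝 m) := by
    have := hφd.continuousAt.tendsto
    rwa [hφ0] at this
  have h1 : ∀ᶠ w in 𝓝 (0 : (fderiv ℝ F m).ker), F (φ w) = 0 := by
    have h := hs.map_implicitFunction_eq hr
    have hc : Filter.Tendsto (fun w : (fderiv ℝ F m).ker => (F m, w)) (𝓝 0) (𝓝 (F m, 0)) :=
      tendsto_const_nhds.prodMk_nhds Filter.tendsto_id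
    filter_upwards [hc.eventually h] with w hw
    rw [← hFm]
    exact hw
  have h2 : (fun w => F' (φ w)) =ᶠ[𝓝 0] fun _ => (0 : Euc (N - d)) := by
    filter_upwards [h1, hφc.eventually (hF.isOpen.mem_nhds hU),
      hφc.eventually (hF'.isOpen.mem_nhds hU')] with w hw hwU hwU'
    exact (hzero hF' _ hwU').1 ((hzero hF _ hwU).2 hw)
  have hd0 : HasFDerivAt F' (fderiv ℝ F' m) (φ 0) := by rw [hφ0]; exact hd
  have h3 : HasFDerivAt (fun w => F' (φ w))
      ((fderiv ℝ F' m).comp (fderiv ℝ F m).ker.subtypeL) 0 := hd0.comp 0 hφd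
  have h4 : HasFDerivAt (fun w => F' (φ w))
      (0 : (fderiv ℝ F m).ker →L[ℝ] Euc (N - d)) 0 :=
    (hasFDerivAt_const (0 : Euc (N - d)) (0 : (fderiv ℝ F m).ker)).congr_of_eventuallyEq h2
  have h5 := DFunLike.congr_fun (h3.unique h4) ⟨v, hv⟩
  simpa using h5

/-- The tangent plane is the null space of `F'(m)` for any local defining function `F`. -/
theorem tangentPlane_eq_ker {d : ℕ} {M : Set (Euc N)} {m : Euc N} (hm : m ∈ M)
    {U : Set (Euc N)} {F : Euc N → Euc (N - d)} (hU : m ∈ U) (hF : IsLocalDefining d M U F) :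
    tangentPlane d M m = (fderiv ℝ F m).ker := by
  apply le_antisymm
  · exact iInf_le_of_le U (iInf_le_of_le F (iInf_le_of_le hU (iInf_le _ hF)))
  · refine le_iInf fun U' => le_iInf fun F' => le_iInf fun hU' => le_iInf fun hF' => ?_
    exact ker_le_ker_of_isLocalDefining hm hU hU' hF hF'

/-- A function on `M ⊆ ℝ^N` is smooth if around each point of `M` it is the restriction of a
smooth function defined on an open subset of `ℝ^N`. -/
def IsSmoothOnSubset {W : Type*} [NormedAddCommGroup W] [NormedSpace ℝ W] {M : Set (Euc N)}
    (f : M → W) : Prop :=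
  ∀ m : M, ∃ (U : Set (Euc N)) (g : Euc N → W), IsOpen U ∧ (m : Euc N) ∈ U ∧
    ContDiffOn ℝ (⊤ : ℕ∞) g U ∧ ∀ x : M, (x : Euc N) ∈ U → g x = f x

/-- `Γ(TM)`: the vector space of smooth maps `f : M → ℝ^N` with `f m` in the tangent plane to `M`
at `m` for every `m ∈ M`. -/
def vectorFields (d : ℕ) (M : Set (Euc N)) : Submodule ℝ (M → Euc N) where
  carrier := {f | IsSmoothOnSubset f ∧ ∀ m : M, f m ∈ tangentPlane d M m}
  zero_mem' := ⟨fun _ => ⟨Set.univ, fun _ => 0, isOpen_univ, trivial, contDiffOn_const,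
    fun _ _ => rfl⟩, fun _ => Submodule.zero_mem _⟩
  add_mem' := by
    rintro f g ⟨hf, hf'⟩ ⟨hg, hg'⟩
    refine ⟨fun m => ?_, fun m => Submodule.add_mem _ (hf' m) (hg' m)⟩
    obtain ⟨U, u, hU, hmU, hu, hfu⟩ := hf m
    obtain ⟨V, v, hV, hmV, hv, hgv⟩ := hg m
    refine ⟨U ∩ V, fun x => u x + v x, hU.inter hV, ⟨hmU, hmV⟩,
      (hu.mono Set.inter_subset_left).add (hv.mono Set.inter_subset_right), fun x hx => ?_⟩
    simp only [Pi.add_apply, hfu x hx.1, hgv x hx.2]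
  smul_mem' := by
    rintro c f ⟨hf, hf'⟩
    refine ⟨fun m => ?_, fun m => Submodule.smul_mem _ c (hf' m)⟩
    obtain ⟨U, u, hU, hmU, hu, hfu⟩ := hf m
    refine ⟨U, fun x => c • u x, hU, hmU, hu.const_smul c, fun x hx => ?_⟩
    simp only [Pi.smul_apply, hfu x hx]

variable {n d : ℕ} {M : Set (Euc N)}

/-- For `x ∈ M`, the linear map `a ↦ Y_a(x)`; the value off `M` is irrelevant. -/
def coeff (Y : Euc n →ₗ[ℝ] vectorFields d M) (x : Euc N) : Euc n →L[ℝ] Euc N :=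
  open Classical in
  if h : x ∈ M then
    LinearMap.toContinuousLinearMap
      ((LinearMap.proj (⟨x, h⟩ : M)) ∘ₗ (vectorFields d M).subtype ∘ₗ Y)
  else 0

theorem coeff_apply (Y : Euc n →ₗ[ℝ] vectorFields d M) (x : M) (a : Euc n) :
    coeff Y x a = (Y a : M → Euc N) x := by
  simp [coeff]

/-- For `x ∈ M`, the bilinear map `(a, b) ↦ (∂_{Y_a} Y_b)(x)`. Here `Y_a(x)` is tangent to `M`, and
the derivative of the function `Y_b` on `M` in a direction tangent to `M` is its derivative along
any curve in `M` with that velocity, see `hasDerivAt_curve`. -/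
def fieldDeriv (Y : Euc n →ₗ[ℝ] vectorFields d M) (x : Euc N) :
    Euc n →ₗ[ℝ] Euc n →ₗ[ℝ] Euc N :=
  (fderivWithin ℝ (coeff Y) M x).toLinearMap₁₂ ∘ₗ (coeff Y x).toLinearMap

theorem differentiableWithinAt_coeff (Y : Euc n →ₗ[ℝ] vectorFields d M) (x : M) :
    DifferentiableWithinAt ℝ (coeff Y) M x := by
  have key : ∀ b : Euc n, DifferentiableWithinAt ℝ (fun y => coeff Y y b) M x := by
    intro b
    obtain ⟨U, g, hU, hxU, hg, hgf⟩ := (Y b).2.1 x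
    have hd : DifferentiableWithinAt ℝ g M x :=
      ((hg.contDiffAt (hU.mem_nhds hxU)).differentiableAt (by simp)).differentiableWithinAt
    refine hd.congr_of_eventuallyEq ?_ ?_
    · filter_upwards [self_mem_nhdsWithin, mem_nhdsWithin_of_mem_nhds (hU.mem_nhds hxU)]
        with y hyM hyU
      rw [hgf ⟨y, hyM⟩ hyU]
      exact coeff_apply Y ⟨y, hyM⟩ b
    · rw [hgf x hxU]
      exact coeff_apply Y x b
  let e₁ : Euc n ≃L[ℝ] (Fin n → ℝ) := EuclideanSpace.equiv (Fin n) ℝ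
  let e₂ : (Euc n →L[ℝ] Euc N) ≃L[ℝ] (Fin n → Euc N) :=
    (e₁.arrowCongr (1 : Euc N ≃L[ℝ] Euc N)).trans (ContinuousLinearEquiv.piRing (Fin n))
  have h : DifferentiableWithinAt ℝ (fun y => e₂ (coeff Y y)) M x :=
    differentiableWithinAt_pi.2 fun i => key _
  have h' := e₂.symm.differentiableAt.comp_differentiableWithinAt (x : Euc N) h
  simpa [Function.comp_def] using h'

/-- `(∂_{Y_a} Y_b)(x)` is the derivative of `Y_b` along any curve in `M` through `x` with velocity
`Y_a(x)`. -/
theorem hasDerivAt_curve (Y : Euc n →ₗ[ℝ] vectorFields d M) (a b : Euc n) (σ : ℝ → M)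
    (hσ : HasDerivAt (fun t => (σ t : Euc N)) ((Y a : M → Euc N) (σ 0)) 0) :
    HasDerivAt (fun t => (Y b : M → Euc N) (σ t)) (fieldDeriv Y (σ 0) a b) 0 := by
  have h1 : HasFDerivWithinAt (coeff Y) (fderivWithin ℝ (coeff Y) M (σ 0)) M (σ 0) :=
    (differentiableWithinAt_coeff Y (σ 0)).hasFDerivWithinAt
  have h2 : HasDerivAt (fun t => coeff Y (σ t))
      (fderivWithin ℝ (coeff Y) M (σ 0) ((Y a : M → Euc N) (σ 0))) 0 := by
    have := h1.comp_hasDerivWithinAt (s := Set.univ) (0 : ℝ) hσ.hasDerivWithinAt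
      (fun t _ => (σ t).2)
    exact this.hasDerivAt Filter.univ_mem
  have h3 := h2.clm_apply (hasDerivAt_const (0 : ℝ) b)
  simpa [fieldDeriv, coeff_apply] using h3

/-! ## Rough paths on `M` and constrained equations -/

/-- `WG_p([0,S],M)`: weakly geometric rough paths `X` in `ℝ^N` with trace in `M` such that
`∫ α(dX) ≡ 0` for every finite dimensional `W = ℝ^k` and every smooth `W`-valued one form `α` on
`ℝ^N` which vanishes on `TM`. -/
structure IsWeaklyGeometricOn (p : ℝ) (ω : ℝ → ℝ → ℝ) (d : ℕ) (M : Set (Euc N)) (S : ℝ)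
    (X : RoughPair (Euc N)) : Prop where
  weaklyGeometric : IsWeaklyGeometric p ω S X
  trace_mem : ∀ t, 0 ≤ t → t ≤ S → X.trace t ∈ M
  integral_eq_zero : ∀ (k : ℕ) (α : Euc N → Euc N →L[ℝ] Euc k), ContDiff ℝ (⊤ : ℕ∞) α →
    (∀ m ∈ M, ∀ v ∈ tangentPlane d M m, α m v = 0) →
    IsRoughIntegral p ω S α X (RoughPair.zero (Euc k))

/-- `X ∈ WG_p([0,S],M)` solves `dX = Y_{dZ}(x)`, `x(0) = x₀`, on `[0,S]`. -/
structure SolvesOn (p : ℝ) (ω : ℝ → ℝ → ℝ) (Y : Euc n →ₗ[ℝ] vectorFields d M)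
    (Z : RoughPair (Euc n)) (x₀ : Euc N) (S : ℝ) (X : RoughPair (Euc N)) : Prop where
  mem : IsWeaklyGeometricOn p ω d M S X
  start : X.trace 0 = x₀
  first : ApproxEq p ω S X.incr fun s t =>
    coeff Y (X.trace s) (Z.incr s t) + evalTensor (fieldDeriv Y (X.trace s)) (Z.second s t)
  second : ApproxEq p ω S X.second fun s t =>
    TensorProduct.map (coeff Y (X.trace s)).toLinearMap (coeff Y (X.trace s)).toLinearMap
      (Z.second s t)

/-- `X` solves the equation on the half-open interval `[0,τ)`: its restriction to every `[0,S]`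
with `0 < S < τ` is a solution on `[0,S]`. -/
def SolvesBefore (p : ℝ) (ω : ℝ → ℝ → ℝ) (Y : Euc n →ₗ[ℝ] vectorFields d M)
    (Z : RoughPair (Euc n)) (x₀ : Euc N) (τ : ℝ) (X : RoughPair (Euc N)) : Prop :=
  ∀ S, 0 < S → S < τ → SolvesOn p ω Y Z x₀ S X

/-- The closure in `M` (not in `ℝ^N`) of `{x(t) : 0 ≤ t < τ}`. -/
def traceClosure (M : Set (Euc N)) (τ : ℝ) (X : RoughPair (Euc N)) : Set M :=
  closure {m : M | ∃ t, 0 ≤ t ∧ t < τ ∧ X.trace t = m}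

end Manifold

end RoughManifold

end

open RoughManifold

/-!
The trace of a solution is characterised by its own second order expansion, so the trace is
constructed first, in the ambient space, and the second order process is recovered from it.

Near a compact subset of `M` the vector fields extend to a compactly supported smooth field `G` of
linear maps on `ℝ^N` (`exists_extension_of_isCompact`), and `∂_{Y_a} Y_b` can be computed from the
extension. The second order Euler steps `x ↦ x + G(x) z_{s,t} + (∂_G G)(x) ℤ_{s,t}` form a `C¹`
almost flow: they compose up to an error `O(ω(s,t)^{3/p})`, which is moreover Lipschitz in `x`
(`exists_rdeStep_bounds`). Since `3 / p > 1`, such an almost flow is followed, up to the same order,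
by a limit of Euler schemes (`exists_path_of_almostFlow`), and by only one path from each starting
point (`eq_of_follow_almostFlow`). This gives the uniqueness of traces. For local existence the
extension is chosen tangent to *all* level sets of a local defining function `F`
(`exists_tangent_extension`). As `Z` is weakly geometric, the second order expansion of `F` along
the path cancels, so `F` is constant along it and the path stays in `M`
(`eq_of_fderiv_comp_eq_zero`).

Given the trace `x`, the second order process is obtained by sewing the germ
`x_s ⊗ x_{s,t} + (G(x_s) ⊗ G(x_s)) ℤ_{s,t}`, which again is a path following an almost flow
(`exists_second`). It is weakly geometric because the defect of its symmetric part is additive and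
of order `3 / p > 1`, hence zero (`symPart_eq_of_chen`); the same argument gives the uniqueness of
the second level (`second_eq_of_chen`). A one form which vanishes on `TM` vanishes on the `Y_a`, and
differentiating this identity along the `Y_a` shows that its integral vanishes
(`oneForm_apply_secondCoeff_add`). So every path in `M` with the right expansion is the trace of a
solution (`IsTracePath.exists_solvesOn`).

The local existence time is bounded below on compact subsets of `M`
(`exists_uniform_local_tracePath`). Let `τ` be the supremum of the times up to which there are
solutions. By uniqueness these fit together to a solution on `[0, τ)`. If its trace had compact
closure in `M`, it could be extended from a time close to `τ` to a time past `τ`, or to `T`.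
-/

open scoped TensorProduct Topology

namespace RoughManifold

open Asymptotics Filter

/-! ### Smooth maps with compact support -/

/-- Smooth maps with compact support. All their derivatives are bounded, so that Taylor estimates
hold with constants that do not depend on the base point. -/
structure IsTestMap {E F : Type*} [NormedAddCommGroup E] [NormedSpace ℝ E]
    [NormedAddCommGroup F] [NormedSpace ℝ F] (f : E → F) : Prop where
  contDiff : ContDiff ℝ (⊤ : ℕ∞) f
  hasCompactSupport : HasCompactSupport f

namespace IsTestMap

variable {E F F' : Type*} [NormedAddCommGroup E] [NormedSpace ℝ E]
  [NormedAddCommGroup F] [NormedSpace ℝ F] [NormedAddCommGroup F'] [NormedSpace ℝ F']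

theorem differentiable {f : E → F} (hf : IsTestMap f) : Differentiable ℝ f :=
  hf.contDiff.differentiable (by simp)

theorem hasFDerivAt {f : E → F} (hf : IsTestMap f) (x : E) : HasFDerivAt f (fderiv ℝ f x) x :=
  (hf.differentiable x).hasFDerivAt

theorem continuous {f : E → F} (hf : IsTestMap f) : Continuous f := hf.contDiff.continuous

theorem fderiv {f : E → F} (hf : IsTestMap f) : IsTestMap (fderiv ℝ f) :=
  ⟨hf.contDiff.fderiv_right (by simp), hf.hasCompactSupport.fderiv (𝕜 := ℝ)⟩

theorem clm_comp {G H : Type*} [NormedAddCommGroup G] [NormedSpace ℝ G] [NormedAddCommGroup H]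
    [NormedSpace ℝ H] {f : E → G →L[ℝ] H} {g : E → F →L[ℝ] G} (hf : IsTestMap f)
    (hg : IsTestMap g) : IsTestMap fun x => (f x).comp (g x) :=
  ⟨hf.contDiff.clm_comp hg.contDiff, hg.hasCompactSupport.mono fun x hx => by
    rw [Function.mem_support] at hx ⊢
    rintro h
    exact hx (by rw [h, ContinuousLinearMap.comp_zero])⟩

theorem continuousLinearMap_comp {f : E → F} (hf : IsTestMap f) (L : F →L[ℝ] F') :
    IsTestMap fun x => L (f x) :=
  ⟨L.contDiff.comp hf.contDiff, hf.hasCompactSupport.comp_left (map_zero L)⟩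

theorem exists_norm_le {f : E → F} (hf : IsTestMap f) : ∃ K, 0 ≤ K ∧ ∀ x, ‖f x‖ ≤ K := by
  obtain ⟨K, hK⟩ := hf.hasCompactSupport.exists_bound_of_continuous hf.continuous
  exact ⟨K, (norm_nonneg _).trans (hK 0), hK⟩

theorem exists_norm_sub_le {f : E → F} (hf : IsTestMap f) :
    ∃ K, 0 ≤ K ∧ ∀ x y, ‖f x - f y‖ ≤ K * ‖x - y‖ := by
  obtain ⟨K, hK0, hK⟩ := hf.fderiv.exists_norm_le
  exact ⟨K, hK0, fun x y => convex_univ.norm_image_sub_le_of_norm_fderiv_le (𝕜 := ℝ)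
    (fun z _ => hf.differentiable z) (fun z _ => hK z) (Set.mem_univ y) (Set.mem_univ x)⟩

/-- The first differences of a test map are Lipschitz in the base point. -/
theorem exists_norm_diff_sub_diff_le {f : E → F} (hf : IsTestMap f) :
    ∃ K, 0 ≤ K ∧ ∀ x y h, ‖(f (x + h) - f x) - (f (y + h) - f y)‖ ≤ K * ‖h‖ * ‖x - y‖ := by
  obtain ⟨K, hK0, hK⟩ := hf.fderiv.exists_norm_sub_le
  refine ⟨K, hK0, fun x y h => ?_⟩
  have hd : ∀ z, HasFDerivAt (fun z => f (z + h) - f z)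
      (_root_.fderiv ℝ f (z + h) - _root_.fderiv ℝ f z) z := fun z =>
    ((hasFDerivAt_comp_add_right h).2 (hf.hasFDerivAt (z + h))).sub (hf.hasFDerivAt z)
  refine convex_univ.norm_image_sub_le_of_norm_hasFDerivWithin_le (𝕜 := ℝ)
    (f := fun z => f (z + h) - f z)
    (fun z _ => (hd z).hasFDerivWithinAt) (fun z _ => ?_) (Set.mem_univ y) (Set.mem_univ x)
  simpa using hK (z + h) z

/-- The first order Taylor remainder, as a function of the increment. -/
theorem exists_norm_taylor_sub_le {f : E → F} (hf : IsTestMap f) :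
    ∃ K, 0 ≤ K ∧ ∀ x h k, ‖(f (x + h) - f x - _root_.fderiv ℝ f x h) -
      (f (x + k) - f x - _root_.fderiv ℝ f x k)‖ ≤ K * (‖h‖ + ‖k‖) * ‖h - k‖ := by
  obtain ⟨K, hK0, hK⟩ := hf.fderiv.exists_norm_sub_le
  refine ⟨K, hK0, fun x h k => ?_⟩
  have hd : ∀ z, HasFDerivAt (fun z => f (x + z) - f x - _root_.fderiv ℝ f x z)
      (_root_.fderiv ℝ f (x + z) - _root_.fderiv ℝ f x) z := fun z =>
    (((hasFDerivAt_comp_add_left x).2 (hf.hasFDerivAt (x + z))).sub_const _).sub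
      (_root_.fderiv ℝ f x).hasFDerivAt
  refine (convex_closedBall (0 : E) (‖h‖ + ‖k‖)).norm_image_sub_le_of_norm_hasFDerivWithin_le
    (𝕜 := ℝ) (f := fun z => f (x + z) - f x - _root_.fderiv ℝ f x z)
    (fun z _ => (hd z).hasFDerivWithinAt) (fun z hz => ?_) (by simp) (by simp)
  have := hK (x + z) x
  rw [add_sub_cancel_left] at this
  exact this.trans (by gcongr; simpa using hz)

theorem exists_norm_taylor_le {f : E → F} (hf : IsTestMap f) :
    ∃ K, 0 ≤ K ∧ ∀ x h, ‖f (x + h) - f x - _root_.fderiv ℝ f x h‖ ≤ K * ‖h‖ ^ 2 := by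
  obtain ⟨K, hK0, hK⟩ := hf.exists_norm_taylor_sub_le
  refine ⟨K, hK0, fun x h => ?_⟩
  simpa [pow_two, mul_assoc] using hK x h 0

theorem fderiv_fderiv_symm {f : E → F} (hf : IsTestMap f) (x v w : E) :
    _root_.fderiv ℝ (_root_.fderiv ℝ f) x v w = _root_.fderiv ℝ (_root_.fderiv ℝ f) x w v :=
  (hf.contDiff.contDiffAt.isSymmSndFDerivAt (by
    simp only [minSmoothness_of_isRCLikeNormedField]; exact WithTop.coe_le_coe.2 le_top)) v w

/-- The first order Taylor remainder is Lipschitz in the base point, quadratically in the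
increment. -/
theorem exists_norm_taylor_base_sub_le {f : E → F} (hf : IsTestMap f) :
    ∃ K, 0 ≤ K ∧ ∀ x y h, ‖(f (x + h) - f x - _root_.fderiv ℝ f x h) -
      (f (y + h) - f y - _root_.fderiv ℝ f y h)‖ ≤ K * ‖h‖ ^ 2 * ‖x - y‖ := by
  obtain ⟨K, hK0, hK⟩ := hf.fderiv.exists_norm_taylor_le
  refine ⟨K, hK0, fun x y h => ?_⟩
  have hd : ∀ z, HasFDerivAt (fun z => f (z + h) - f z - _root_.fderiv ℝ f z h)
      (_root_.fderiv ℝ f (z + h) - _root_.fderiv ℝ f z -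
        (_root_.fderiv ℝ (_root_.fderiv ℝ f) z).flip h) z := fun z =>
    (((hasFDerivAt_comp_add_right h).2 (hf.hasFDerivAt (z + h))).sub (hf.hasFDerivAt z)).sub (by
      simpa using (hf.fderiv.hasFDerivAt z).clm_apply (hasFDerivAt_const h z))
  refine convex_univ.norm_image_sub_le_of_norm_hasFDerivWithin_le (𝕜 := ℝ)
    (f := fun z => f (z + h) - f z - _root_.fderiv ℝ f z h)
    (fun z _ => (hd z).hasFDerivWithinAt) (fun z _ => ?_) (Set.mem_univ y) (Set.mem_univ x)
  have : (_root_.fderiv ℝ (_root_.fderiv ℝ f) z).flip h =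
      _root_.fderiv ℝ (_root_.fderiv ℝ f) z h := by
    ext v
    exact hf.fderiv_fderiv_symm z v h
  rw [this]
  exact hK z h

theorem exists_norm_taylor_two_le {f : E → F} (hf : IsTestMap f) :
    ∃ K, 0 ≤ K ∧ ∀ x h, ‖f (x + h) - f x - _root_.fderiv ℝ f x h -
      (1 / 2 : ℝ) • _root_.fderiv ℝ (_root_.fderiv ℝ f) x h h‖ ≤ K * ‖h‖ ^ 3 := by
  obtain ⟨K, hK0, hK⟩ := hf.fderiv.exists_norm_taylor_le
  refine ⟨K, hK0, fun x h => ?_⟩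
  set B := _root_.fderiv ℝ (_root_.fderiv ℝ f) x with hB
  have hd : ∀ z, HasFDerivAt (fun z => f (x + z) - f x - _root_.fderiv ℝ f x z -
      (1 / 2 : ℝ) • B z z)
      (_root_.fderiv ℝ f (x + z) - _root_.fderiv ℝ f x - B z) z := fun z => by
    have h1 := (B.hasFDerivAt (x := z)).clm_apply (hasFDerivAt_id z)
    have h2 : (1 / 2 : ℝ) • (((B z).comp (ContinuousLinearMap.id ℝ E)) + B.flip (id z)) = B z := by
      ext v
      have := hf.fderiv_fderiv_symm x v z
      simp only [smul_apply, add_apply,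
        ContinuousLinearMap.comp_id, ContinuousLinearMap.flip_apply, id, hB, this]
      rw [← two_smul ℝ, smul_smul]
      norm_num
    have h3 := h1.const_smul (1 / 2 : ℝ)
    rw [h2] at h3
    exact (((hasFDerivAt_comp_add_left x).2 (hf.hasFDerivAt (x + z))).sub_const _).sub
      (_root_.fderiv ℝ f x).hasFDerivAt |>.sub h3
  have := (convex_closedBall (0 : E) ‖h‖).norm_image_sub_le_of_norm_hasFDerivWithin_le
    (𝕜 := ℝ) (f := fun z => f (x + z) - f x - _root_.fderiv ℝ f x z - (1 / 2 : ℝ) • B z z)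
    (C := K * ‖h‖ ^ 2)
    (fun z _ => (hd z).hasFDerivWithinAt) (fun z hz => (hK x z).trans (by
      gcongr; simpa using hz)) (x := 0) (y := h) (by simp) (by simp)
  simpa [pow_succ, mul_assoc] using this

end IsTestMap

/-! ### Tensors -/

section Tensor

variable {V E : Type*} [NormedAddCommGroup V] [InnerProductSpace ℝ V] [FiniteDimensional ℝ V]
  [NormedAddCommGroup E] [NormedSpace ℝ E] [FiniteDimensional ℝ E]

/-- The map `B ↦ (A ↦ B(a,b)|_{a ⊗ b = A})`, as a continuous linear map. -/
noncomputable def evalTensorL : (V →L[ℝ] V →L[ℝ] E) →L[ℝ] (V ⊗[ℝ] V) →L[ℝ] E :=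
  LinearMap.toContinuousLinearMap
    { toFun := fun B => LinearMap.toContinuousLinearMap (TensorProduct.lift B.toLinearMap₁₂)
      map_add' := fun B B' => by
        ext A
        induction A using TensorProduct.induction_on with
        | zero => simp
        | tmul a b => simp
        | add a b ha hb =>
          exact (map_add _ _ _).trans ((congrArg₂ _ ha hb).trans (map_add _ _ _).symm)
      map_smul' := fun c B => by
        ext A
        induction A using TensorProduct.induction_on with
        | zero => simp
        | tmul a b => simp
        | add a b ha hb =>
          exact (map_add _ _ _).trans ((congrArg₂ _ ha hb).trans (map_add _ _ _).symm) }

theorem evalTensorL_apply (B : V →L[ℝ] V →L[ℝ] E) (A : V ⊗[ℝ] V) :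
    evalTensorL B A = evalTensor B.toLinearMap₁₂ A := rfl

@[simp] theorem evalTensorL_tmul (B : V →L[ℝ] V →L[ℝ] E) (a b : V) :
    evalTensorL B (a ⊗ₜ[ℝ] b) = B a b := by
  simp [evalTensorL_apply, evalTensor]

/-- A symmetric bilinear map only sees the symmetric part of a tensor. -/
theorem evalTensorL_of_symm {B : V →L[ℝ] V →L[ℝ] E} (hB : ∀ a b, B a b = B b a)
    {A : V ⊗[ℝ] V} {a : V} (hA : symPart A = (1 / 2 : ℝ) • (a ⊗ₜ[ℝ] a)) :
    evalTensorL B A = (1 / 2 : ℝ) • B a a := by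
  have h : ∀ A : V ⊗[ℝ] V, evalTensorL B (TensorProduct.comm ℝ V V A) = evalTensorL B A := by
    intro A
    induction A using TensorProduct.induction_on with
    | zero => simp
    | tmul a b => simp [hB a b]
    | add a b ha hb => simp only [map_add, ha, hb]
  have h2 := congrArg (evalTensorL B) hA
  rw [symPart, map_smul, map_add, h, map_smul, evalTensorL_tmul, ← two_smul ℝ, smul_smul] at h2
  simpa using h2

end Tensor

/-! ### Asymptotic calculus for test maps -/

section BigO

variable {ι : Type*} {l : Filter ι}
variable {E F : Type*} [NormedAddCommGroup E] [NormedSpace ℝ E] [NormedAddCommGroup F]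
  [NormedSpace ℝ F]

theorem isBigO_clm_apply {L : ι → E →L[ℝ] F} {u : ι → E} {α β : ι → ℝ} (hL : L =O[l] α)
    (hu : u =O[l] β) : (fun i => L i (u i)) =O[l] fun i => α i * β i := by
  refine IsBigO.trans ?_ (hL.norm_left.mul hu.norm_left)
  refine IsBigO.of_norm_le fun i => ?_
  simpa using (L i).le_opNorm (u i)

namespace IsTestMap

variable {f : E → F}

theorem isBigO_one (hf : IsTestMap f) (u : ι → E) :
    (fun i => f (u i)) =O[l] fun _ => (1 : ℝ) := by
  obtain ⟨K, _, hK⟩ := hf.exists_norm_le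
  exact IsBigO.of_bound K (Eventually.of_forall fun i => by simpa using hK (u i))

theorem isBigO_sub (hf : IsTestMap f) (u v : ι → E) :
    (fun i => f (u i) - f (v i)) =O[l] fun i => ‖u i - v i‖ := by
  obtain ⟨K, _, hK⟩ := hf.exists_norm_sub_le
  exact IsBigO.of_bound K (Eventually.of_forall fun i => by simpa using hK (u i) (v i))

theorem isBigO_diff_sub_diff (hf : IsTestMap f) (u v h : ι → E) :
    (fun i => (f (u i + h i) - f (u i)) - (f (v i + h i) - f (v i))) =O[l]
      fun i => ‖h i‖ * ‖u i - v i‖ := by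
  obtain ⟨K, _, hK⟩ := hf.exists_norm_diff_sub_diff_le
  exact IsBigO.of_bound K (Eventually.of_forall fun i => by
    simpa [mul_assoc] using hK (u i) (v i) (h i))

theorem isBigO_taylor_sub (hf : IsTestMap f) (u h k : ι → E) :
    (fun i => (f (u i + h i) - f (u i) - _root_.fderiv ℝ f (u i) (h i)) -
      (f (u i + k i) - f (u i) - _root_.fderiv ℝ f (u i) (k i))) =O[l]
      fun i => (‖h i‖ + ‖k i‖) * ‖h i - k i‖ := by
  obtain ⟨K, _, hK⟩ := hf.exists_norm_taylor_sub_le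
  exact IsBigO.of_bound K (Eventually.of_forall fun i => (hK (u i) (h i) (k i)).trans
    (by rw [norm_mul, norm_norm, Real.norm_of_nonneg (by positivity), mul_assoc]))

theorem isBigO_taylor (hf : IsTestMap f) (u h : ι → E) :
    (fun i => f (u i + h i) - f (u i) - _root_.fderiv ℝ f (u i) (h i)) =O[l]
      fun i => ‖h i‖ ^ 2 := by
  obtain ⟨K, _, hK⟩ := hf.exists_norm_taylor_le
  exact IsBigO.of_bound K (Eventually.of_forall fun i => by simpa using hK (u i) (h i))

theorem isBigO_taylor_base_sub (hf : IsTestMap f) (u v h : ι → E) :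
    (fun i => (f (u i + h i) - f (u i) - _root_.fderiv ℝ f (u i) (h i)) -
      (f (v i + h i) - f (v i) - _root_.fderiv ℝ f (v i) (h i))) =O[l]
      fun i => ‖h i‖ ^ 2 * ‖u i - v i‖ := by
  obtain ⟨K, _, hK⟩ := hf.exists_norm_taylor_base_sub_le
  exact IsBigO.of_bound K (Eventually.of_forall fun i => by
    simpa [mul_assoc] using hK (u i) (v i) (h i))

theorem isBigO_taylor_two (hf : IsTestMap f) (u h : ι → E) :
    (fun i => f (u i + h i) - f (u i) - _root_.fderiv ℝ f (u i) (h i) -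
      (1 / 2 : ℝ) • _root_.fderiv ℝ (_root_.fderiv ℝ f) (u i) (h i) (h i)) =O[l]
      fun i => ‖h i‖ ^ 3 := by
  obtain ⟨K, _, hK⟩ := hf.exists_norm_taylor_two_le
  exact IsBigO.of_bound K (Eventually.of_forall fun i => by simpa using hK (u i) (h i))

end IsTestMap

end BigO

/-! ### The second order Euler step -/

section Step

variable {V E : Type*} [NormedAddCommGroup V] [InnerProductSpace ℝ V] [FiniteDimensional ℝ V]
  [NormedAddCommGroup E] [NormedSpace ℝ E] [FiniteDimensional ℝ E]

/-- For a field `G` of linear maps, the map `a ⊗ b ↦ (∂_{G(x)a} G)(x) b`. -/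
noncomputable def secondCoeff (G : E → V →L[ℝ] E) (x : E) : (V ⊗[ℝ] V) →L[ℝ] E :=
  evalTensorL ((fderiv ℝ G x).comp (G x))

theorem secondCoeff_tmul (G : E → V →L[ℝ] E) (x : E) (a b : V) :
    secondCoeff G x (a ⊗ₜ[ℝ] b) = fderiv ℝ G x (G x a) b := by
  simp [secondCoeff]

theorem IsTestMap.secondCoeff {G : E → V →L[ℝ] E} (hG : IsTestMap G) :
    IsTestMap (secondCoeff G) := by
  have h : IsTestMap fun x => (_root_.fderiv ℝ G x).comp (G x) := hG.fderiv.clm_comp hG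
  exact h.continuousLinearMap_comp (F' := (V ⊗[ℝ] V) →L[ℝ] E) evalTensorL

/-- The increment of the second order Euler step with driving increments `a`, `A`. -/
noncomputable def stepIncr (G : E → V →L[ℝ] E) (a : V) (A : V ⊗[ℝ] V) (x : E) : E :=
  G x a + secondCoeff G x A

/-- The second order Euler step with driving increments `a`, `A`. -/
noncomputable def step (G : E → V →L[ℝ] E) (a : V) (A : V ⊗[ℝ] V) (x : E) : E :=
  x + stepIncr G a A x

variable {ι : Type*} {l : Filter ι} {lam : ι → ℝ} {G : E → V →L[ℝ] E}
  {a b : ι → V} {A B : ι → V ⊗[ℝ] V} {x y h : ι → E}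

theorem isBigO_sq_of_isBigO_one (hl : lam =O[l] fun _ => (1 : ℝ)) :
    (fun i => lam i ^ 2) =O[l] lam := by
  simpa [pow_two] using hl.mul (isBigO_refl lam l)

theorem stepIncr_isBigO (hG : IsTestMap G) (hl : lam =O[l] fun _ => (1 : ℝ)) (ha : a =O[l] lam)
    (hA : A =O[l] fun i => lam i ^ 2) (x : ι → E) :
    (fun i => stepIncr G (a i) (A i) (x i)) =O[l] lam := by
  have h1 := isBigO_clm_apply (hG.isBigO_one (l := l) x) ha
  have h2 := isBigO_clm_apply (hG.secondCoeff.isBigO_one (l := l) x) hA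
  simp only [one_mul] at h1 h2
  exact h1.add (h2.trans (isBigO_sq_of_isBigO_one hl))

theorem stepIncr_sub_isBigO (hG : IsTestMap G) (hl : lam =O[l] fun _ => (1 : ℝ))
    (ha : a =O[l] lam) (hA : A =O[l] fun i => lam i ^ 2) (x y : ι → E) :
    (fun i => stepIncr G (a i) (A i) (x i) - stepIncr G (a i) (A i) (y i)) =O[l]
      fun i => lam i * ‖x i - y i‖ := by
  have h1 := isBigO_clm_apply (hG.isBigO_sub (l := l) x y) ha
  have h2 := isBigO_clm_apply (hG.secondCoeff.isBigO_sub (l := l) x y)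
    (hA.trans (isBigO_sq_of_isBigO_one hl))
  refine ((h1.add h2).congr_left fun i => ?_).congr_right fun i => mul_comm _ _
  simp only [stepIncr, sub_apply]
  abel

theorem stepIncr_diff_sub_diff_isBigO (hG : IsTestMap G) (hl : lam =O[l] fun _ => (1 : ℝ))
    (ha : a =O[l] lam) (hA : A =O[l] fun i => lam i ^ 2) (x y h : ι → E) :
    (fun i => (stepIncr G (a i) (A i) (x i + h i) - stepIncr G (a i) (A i) (x i)) -
      (stepIncr G (a i) (A i) (y i + h i) - stepIncr G (a i) (A i) (y i))) =O[l]
      fun i => lam i * (‖h i‖ * ‖x i - y i‖) := by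
  have h1 := isBigO_clm_apply (hG.isBigO_diff_sub_diff (l := l) x y h) ha
  have h2 := isBigO_clm_apply (hG.secondCoeff.isBigO_diff_sub_diff (l := l) x y h)
    (hA.trans (isBigO_sq_of_isBigO_one hl))
  refine ((h1.add h2).congr_left fun i => ?_).congr_right fun i => mul_comm _ _
  simp only [stepIncr, sub_apply]
  abel

/-- The failure of the Euler steps to compose, written as a sum of third order terms. -/
theorem step_step_sub_step (G : E → V →L[ℝ] E) (a b : V) (A B : V ⊗[ℝ] V) (x : E) :
    step G b B (step G a A x) - step G (a + b) (A + B + a ⊗ₜ[ℝ] b) x =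
      (G (x + stepIncr G a A x) - G x - fderiv ℝ G x (stepIncr G a A x)) b +
      ((fderiv ℝ G x).comp (secondCoeff G x)) A b +
      (secondCoeff G (x + stepIncr G a A x) - secondCoeff G x) B := by
  have h : fderiv ℝ G x (stepIncr G a A x) b = secondCoeff G x (a ⊗ₜ[ℝ] b) +
      fderiv ℝ G x (secondCoeff G x A) b := by
    rw [secondCoeff_tmul, stepIncr, map_add, add_apply]
  simp only [step, sub_apply, h, ContinuousLinearMap.comp_apply]
  simp only [stepIncr, map_add]
  abel

theorem step_step_sub_step_isBigO (hG : IsTestMap G) (hl : lam =O[l] fun _ => (1 : ℝ))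
    (ha : a =O[l] lam) (hA : A =O[l] fun i => lam i ^ 2) (hb : b =O[l] lam)
    (hB : B =O[l] fun i => lam i ^ 2) (x : ι → E) :
    (fun i => step G (b i) (B i) (step G (a i) (A i) (x i)) -
      step G (a i + b i) (A i + B i + a i ⊗ₜ[ℝ] b i) (x i)) =O[l] fun i => lam i ^ 3 := by
  have hh := stepIncr_isBigO hG hl ha hA x
  have h1 := isBigO_clm_apply ((hG.isBigO_taylor (l := l) x _).trans (hh.norm_left.pow 2)) hb
  have h2 := isBigO_clm_apply (isBigO_clm_apply
    ((hG.fderiv.clm_comp hG.secondCoeff).isBigO_one (l := l) x) hA) hb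
  have h3 := isBigO_clm_apply ((hG.secondCoeff.isBigO_sub (l := l)
    (fun i => x i + stepIncr G (a i) (A i) (x i)) x).trans (by simpa using hh.norm_left)) hB
  have e1 : (fun i => lam i ^ 2 * lam i) = fun i => lam i ^ 3 := by ext; ring
  have e2 : (fun i => 1 * lam i ^ 2 * lam i) = fun i => lam i ^ 3 := by ext; ring
  have e3 : (fun i => lam i * lam i ^ 2) = fun i => lam i ^ 3 := by ext; ring
  rw [e1] at h1
  rw [e2] at h2
  rw [e3] at h3
  exact ((h1.add h2).add h3).congr_left fun i => (step_step_sub_step G _ _ _ _ _).symm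

/-- The failure of the Euler steps to compose is Lipschitz in the base point. The difference of the
Taylor remainders at `x` and `y` is split into a change of base point and a change of increment. -/
theorem step_step_sub_step_sub_isBigO (hG : IsTestMap G) (hl : lam =O[l] fun _ => (1 : ℝ))
    (ha : a =O[l] lam) (hA : A =O[l] fun i => lam i ^ 2) (hb : b =O[l] lam)
    (hB : B =O[l] fun i => lam i ^ 2) (x y : ι → E) :
    (fun i => (step G (b i) (B i) (step G (a i) (A i) (x i)) -
        step G (a i + b i) (A i + B i + a i ⊗ₜ[ℝ] b i) (x i)) -
      (step G (b i) (B i) (step G (a i) (A i) (y i)) -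
        step G (a i + b i) (A i + B i + a i ⊗ₜ[ℝ] b i) (y i))) =O[l]
      fun i => lam i ^ 3 * ‖x i - y i‖ := by
  set hx : ι → E := fun i => stepIncr G (a i) (A i) (x i) with hxdef
  set hy : ι → E := fun i => stepIncr G (a i) (A i) (y i) with hydef
  have hhx : hx =O[l] lam := stepIncr_isBigO hG hl ha hA x
  have hhy : hy =O[l] lam := stepIncr_isBigO hG hl ha hA y
  have hhd : (fun i => hx i - hy i) =O[l] fun i => lam i * ‖x i - y i‖ :=
    stepIncr_sub_isBigO hG hl ha hA x y
  have hd := isBigO_refl (fun i => ‖x i - y i‖) l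
  have h1 := isBigO_clm_apply ((hG.isBigO_taylor_base_sub (l := l) x y hx).trans
    ((hhx.norm_left.pow 2).mul hd)) hb
  have h1' := isBigO_clm_apply ((hG.isBigO_taylor_sub (l := l) y hx hy).trans
    ((hhx.norm_left.add hhy.norm_left).mul hhd.norm_left)) hb
  have h2 := isBigO_clm_apply (isBigO_clm_apply
    ((hG.fderiv.clm_comp hG.secondCoeff).isBigO_sub (l := l) x y) hA) hb
  have h3 := isBigO_clm_apply ((hG.secondCoeff.isBigO_diff_sub_diff (l := l) x y hx).trans
    (hhx.norm_left.mul hd)) hB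
  have h3' := isBigO_clm_apply ((hG.secondCoeff.isBigO_sub (l := l) (fun i => y i + hx i)
    (fun i => y i + hy i)).trans (by simpa using hhd.norm_left)) hB
  have e1 : (fun i => lam i ^ 2 * ‖x i - y i‖ * lam i) = fun i => lam i ^ 3 * ‖x i - y i‖ := by
    ext; ring
  have e1' : (fun i => lam i * (lam i * ‖x i - y i‖) * lam i) =
    fun i => lam i ^ 3 * ‖x i - y i‖ := by ext; ring
  have e2 : (fun i => ‖x i - y i‖ * lam i ^ 2 * lam i) =
    fun i => lam i ^ 3 * ‖x i - y i‖ := by ext; ring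
  have e3 : (fun i => lam i * ‖x i - y i‖ * lam i ^ 2) =
    fun i => lam i ^ 3 * ‖x i - y i‖ := by ext; ring
  rw [e1] at h1
  rw [e1'] at h1'
  rw [e2] at h2
  rw [e3] at h3 h3'
  refine ((((h1.add h1').add h2).add h3).add h3').congr_left fun i => ?_
  rw [step_step_sub_step, step_step_sub_step]
  simp only [sub_apply, hxdef, hydef]
  abel

end Step

/-! ### Controls -/

section Control

variable {T : ℝ} {ω : ℝ → ℝ → ℝ}

theorem isCompact_simplex (T : ℝ) :
    IsCompact {q : ℝ × ℝ | 0 ≤ q.1 ∧ q.1 ≤ q.2 ∧ q.2 ≤ T} := by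
  refine (isCompact_Icc (a := ((0 : ℝ), (0 : ℝ))) (b := (T, T))).of_isClosed_subset ?_ ?_
  · exact (isClosed_le continuous_const continuous_fst).inter
      ((isClosed_le continuous_fst continuous_snd).inter
        (isClosed_le continuous_snd continuous_const))
  · rintro ⟨s, t⟩ ⟨h1, h2, h3⟩
    exact ⟨⟨h1, h1.trans h2⟩, ⟨h2.trans h3, h3⟩⟩

namespace IsControl

theorem nonneg (hω : IsControl T ω) {s t : ℝ} (hs : 0 ≤ s) (hst : s ≤ t) (ht : t ≤ T) :
    0 ≤ ω s t := by
  rcases hst.eq_or_lt with rfl | h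
  · exact (hω.diag s hs ht).ge
  · exact (hω.pos s t hs h ht).le

theorem mono (hω : IsControl T ω) {s' s t t' : ℝ} (hs' : 0 ≤ s') (hs : s' ≤ s) (hst : s ≤ t)
    (ht : t ≤ t') (ht' : t' ≤ T) : ω s t ≤ ω s' t' := by
  have h1 := hω.superadditive s' s t' hs' hs (hst.trans ht) ht'
  have h2 := hω.superadditive s t t' (hs'.trans hs) hst ht ht'
  have h3 := hω.nonneg hs' hs ((hst.trans ht).trans ht')
  have h4 := hω.nonneg ((hs'.trans hs).trans hst) ht ht'
  linarith

theorem exists_lt (hω : IsControl T ω) {ε : ℝ} (hε : 0 < ε) :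
    ∃ δ > 0, ∀ s t, 0 ≤ s → s ≤ t → t ≤ T → t - s < δ → ω s t < ε := by
  have hu := (isCompact_simplex T).uniformContinuousOn_of_continuous hω.continuousOn
  obtain ⟨δ, hδ, h⟩ := Metric.uniformContinuousOn_iff.1 hu ε hε
  refine ⟨δ, hδ, fun s t hs hst ht hd => ?_⟩
  have := h (s, t) ⟨hs, hst, ht⟩ (s, s) ⟨hs, le_rfl, hst.trans ht⟩ (by
    simp only [Prod.dist_eq, dist_self, Real.dist_eq]
    rw [abs_of_nonneg (by linarith)]
    exact max_lt hδ hd)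
  rw [hω.diag s hs (hst.trans ht), Real.dist_eq, sub_zero] at this
  exact (le_abs_self _).trans_lt this

theorem exists_pos_le (hω : IsControl T ω) {δ : ℝ} (hδ : 0 < δ) :
    ∃ c > 0, ∀ s t, 0 ≤ s → s ≤ t → t ≤ T → δ ≤ t - s → c ≤ ω s t := by
  set K := {q : ℝ × ℝ | 0 ≤ q.1 ∧ q.1 ≤ q.2 ∧ q.2 ≤ T} ∩ {q | δ ≤ q.2 - q.1} with hK
  have hKc : IsCompact K := (isCompact_simplex T).inter_right
    (isClosed_le continuous_const (continuous_snd.sub continuous_fst))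
  rcases K.eq_empty_or_nonempty with he | hne
  · exact ⟨1, one_pos, fun s t hs hst ht hd =>
      absurd (show (s, t) ∈ K from ⟨⟨hs, hst, ht⟩, hd⟩) (by simp [he])⟩
  · obtain ⟨q, hq, hmin⟩ := hKc.exists_isMinOn hne (hω.continuousOn.mono Set.inter_subset_left)
    have hd : δ ≤ q.2 - q.1 := hq.2
    exact ⟨ω q.1 q.2, hω.pos _ _ hq.1.1 (by linarith) hq.1.2.2,
      fun s t hs hst ht hd => hmin (show (s, t) ∈ K from ⟨⟨hs, hst, ht⟩, hd⟩)⟩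

/-- By continuity and superadditivity, an interval splits into two parts each of which carries at
most half of the control. -/
theorem exists_half (hω : IsControl T ω) {s t : ℝ} (hs : 0 ≤ s) (hst : s ≤ t) (ht : t ≤ T) :
    ∃ m, s ≤ m ∧ m ≤ t ∧ ω s m ≤ ω s t / 2 ∧ ω m t ≤ ω s t / 2 := by
  have hc : ContinuousOn (fun u => ω s u) (Set.Icc s t) :=
    hω.continuousOn.comp (f := fun u => (s, u)) (by fun_prop)
      fun u hu => ⟨hs, hu.1, hu.2.trans ht⟩
  have h0 := hω.nonneg hs hst ht
  have hmem : ω s t / 2 ∈ Set.Icc (ω s s) (ω s t) := by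
    rw [hω.diag s hs (hst.trans ht)]
    constructor <;> linarith
  obtain ⟨m, hm, hm'⟩ := intermediate_value_Icc hst hc hmem
  simp only at hm'
  have := hω.superadditive s m t hs hm.1 hm.2 ht
  exact ⟨m, hm.1, hm.2, hm'.le, by linarith⟩

/-- Discrete version of `exists_half`: some step of the grid splits it into two parts each of which
carries at most half of the control. -/
theorem exists_half_grid (hω : IsControl T ω) {t : ℕ → ℝ} (ht : Monotone t)
    (h0 : ∀ k, 0 ≤ t k) {i j : ℕ} (hij : i < j) (hT : t j ≤ T) :
    ∃ k, i ≤ k ∧ k < j ∧ ω (t i) (t k) ≤ ω (t i) (t j) / 2 ∧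
      ω (t (k + 1)) (t j) ≤ ω (t i) (t j) / 2 := by
  have hn := hω.nonneg (h0 i) (ht hij.le) hT
  have hex : ∃ k, i ≤ k ∧ (j ≤ k ∨ ω (t i) (t j) / 2 < ω (t i) (t k)) := ⟨j, hij.le, Or.inl le_rfl⟩
  classical
  obtain ⟨h1, h2⟩ := Nat.find_spec hex
  set m := Nat.find hex with hm
  have hmj : m ≤ j := Nat.find_min' hex ⟨hij.le, Or.inl le_rfl⟩
  have him : i ≠ m := by
    intro h
    rw [← h, hω.diag _ (h0 i) ((ht hij.le).trans hT)] at h2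
    rcases h2 with h2 | h2
    · omega
    · linarith
  obtain ⟨k, hk⟩ : ∃ k, m = k + 1 := ⟨m - 1, by omega⟩
  have hlt := Nat.find_min hex (m := k) (by omega)
  push Not at hlt
  have hlt := hlt (by omega)
  refine ⟨k, by omega, by omega, hlt.2, ?_⟩
  rw [← hk]
  rcases h2 with h2 | h2
  · rw [le_antisymm hmj h2, hω.diag _ (h0 j) hT]
    linarith
  · have := hω.superadditive (t i) (t m) (t j) (h0 i) (ht h1) (ht hmj) hT
    linarith

end IsControl

/-- If every bound `g ≤ a w` improves to `g ≤ (ρ a + b) w` with `ρ < 1`, then `g ≤ b / (1 - ρ) w`. -/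
theorem le_mul_of_contraction {ι : Type*} {S : Set ι} {g w : ι → ℝ} {ρ b a₀ : ℝ} (hρ : 0 ≤ ρ)
    (hρ1 : ρ < 1) (hb : 0 ≤ b) (ha₀ : 0 ≤ a₀) (h0 : ∀ i ∈ S, g i ≤ a₀ * w i)
    (hstep : ∀ a, 0 ≤ a → (∀ i ∈ S, g i ≤ a * w i) → ∀ i ∈ S, g i ≤ (ρ * a + b) * w i) :
    ∀ i ∈ S, g i ≤ b / (1 - ρ) * w i := by
  have hq : 0 ≤ b / (1 - ρ) := div_nonneg hb (by linarith)
  have key : ∀ n : ℕ, 0 ≤ ρ ^ n * (a₀ - b / (1 - ρ)) + b / (1 - ρ) ∧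
      ∀ i ∈ S, g i ≤ (ρ ^ n * (a₀ - b / (1 - ρ)) + b / (1 - ρ)) * w i := by
    intro n
    induction n with
    | zero => simpa using ⟨ha₀, h0⟩
    | succ n ih =>
      have e : ρ ^ (n + 1) * (a₀ - b / (1 - ρ)) + b / (1 - ρ) =
          ρ * (ρ ^ n * (a₀ - b / (1 - ρ)) + b / (1 - ρ)) + b := by
        have : (1 - ρ) ≠ 0 := by linarith
        field_simp
        ring
      rw [e]
      exact ⟨by have := mul_nonneg hρ ih.1; linarith, hstep _ ih.1 ih.2⟩
  intro i hi
  have hlim : Tendsto (fun n : ℕ => (ρ ^ n * (a₀ - b / (1 - ρ)) + b / (1 - ρ)) * w i) atTop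
      (𝓝 ((0 * (a₀ - b / (1 - ρ)) + b / (1 - ρ)) * w i)) :=
    (((tendsto_pow_atTop_nhds_zero_of_lt_one hρ hρ1).mul_const _).add_const _).mul_const _
  simpa using ge_of_tendsto' hlim fun n => (key n).2 i hi

theorem rpow_le_half_rpow {x w γ : ℝ} (hx : 0 ≤ x) (hw : 0 ≤ w) (hγ : 0 ≤ γ) (h : x ≤ w / 2) :
    x ^ γ ≤ (1 / 2 : ℝ) ^ γ * w ^ γ := by
  rw [← Real.mul_rpow (by norm_num) hw]
  exact Real.rpow_le_rpow hx (by linarith) hγ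

theorem two_mul_half_rpow_lt_one {γ : ℝ} (hγ : 1 < γ) : 2 * (1 / 2 : ℝ) ^ γ < 1 := by
  have := Real.rpow_lt_rpow_of_exponent_gt (x := 1 / 2) (by norm_num) (by norm_num) hγ
  rw [Real.rpow_one] at this
  linarith

/-- A path whose increments are controlled by `ω ^ γ` with `γ > 1` is constant. -/
theorem eq_of_norm_sub_le_rpow {E : Type*} [NormedAddCommGroup E] (hω : IsControl T ω) {γ : ℝ}
    (hγ : 1 < γ) {s₀ s₁ : ℝ} (hs₀ : 0 ≤ s₀) (hs₁ : s₁ ≤ T) {f : ℝ → E} {C : ℝ}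
    (hf : ∀ s t, s₀ ≤ s → s ≤ t → t ≤ s₁ → ‖f t - f s‖ ≤ C * ω s t ^ γ) {t : ℝ}
    (ht : s₀ ≤ t) (ht' : t ≤ s₁) : f t = f s₀ := by
  have h := le_mul_of_contraction (S := {q : ℝ × ℝ | s₀ ≤ q.1 ∧ q.1 ≤ q.2 ∧ q.2 ≤ s₁})
    (g := fun q => ‖f q.2 - f q.1‖) (w := fun q => ω q.1 q.2 ^ γ)
    (ρ := 2 * (1 / 2) ^ γ) (b := 0) (a₀ := |C|) (by positivity) (two_mul_half_rpow_lt_one hγ)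
    le_rfl (abs_nonneg C) ?_ ?_ (s₀, t) ⟨le_rfl, ht, ht'⟩
  · simpa [sub_eq_zero] using h
  · rintro ⟨s, t⟩ ⟨h1, h2, h3⟩
    have := hω.nonneg (hs₀.trans h1) h2 (h3.trans hs₁)
    exact (hf s t h1 h2 h3).trans (by gcongr; exact le_abs_self C)
  · rintro a ha hh ⟨s, t⟩ ⟨h1, h2, h3⟩
    obtain ⟨m, hm1, hm2, hm3, hm4⟩ := hω.exists_half (hs₀.trans h1) h2 (h3.trans hs₁)
    have e1 := hh (s, m) ⟨h1, hm1, hm2.trans h3⟩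
    have e2 := hh (m, t) ⟨h1.trans hm1, hm2, h3⟩
    have n0 := hω.nonneg (hs₀.trans h1) h2 (h3.trans hs₁)
    have r1 := rpow_le_half_rpow (hω.nonneg (hs₀.trans h1) hm1 ((hm2.trans h3).trans hs₁)) n0
      (zero_le_one.trans hγ.le) hm3
    have r2 := rpow_le_half_rpow (hω.nonneg ((hs₀.trans h1).trans hm1) hm2 (h3.trans hs₁)) n0
      (zero_le_one.trans hγ.le) hm4
    simp only at e1 e2 ⊢
    calc ‖f t - f s‖ ≤ ‖f t - f m‖ + ‖f m - f s‖ := norm_sub_le_norm_sub_add_norm_sub _ _ _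
      _ ≤ a * ((1 / 2 : ℝ) ^ γ * ω s t ^ γ) + a * ((1 / 2 : ℝ) ^ γ * ω s t ^ γ) :=
        add_le_add (e2.trans (by gcongr)) (e1.trans (by gcongr))
      _ = _ := by ring

end Control

/-! ### Paths that follow an almost flow -/

section AlmostFlow

variable {T : ℝ} {ω : ℝ → ℝ → ℝ} {E : Type*} [NormedAddCommGroup E]

/-- Along a grid, the discrete scheme of an almost flow stays close to the almost flow, with a
constant that does not depend on the grid. The proof is by induction on the number of steps: each
part produced by `exists_half_grid` inherits the bound with the factor `(1 / 2) ^ γ`, and the step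
in between costs one Lipschitz constant more, whence the factor `1 + κ ^ 2`. -/
theorem norm_scheme_sub_le (hω : IsControl T ω) {s₀ s₁ : ℝ} (hs₀ : 0 ≤ s₀) (hs₁ : s₁ ≤ T)
    {μ : ℝ → ℝ → E → E} {γ κ C : ℝ} (hγ : 0 < γ) (hκ : 0 ≤ κ) (hC : 0 ≤ C)
    (hρ : (1 + κ ^ 2) * (1 / 2) ^ γ < 1)
    (hlip : ∀ s t x y, s₀ ≤ s → s ≤ t → t ≤ s₁ → ‖μ s t x - μ s t y‖ ≤ κ * ‖x - y‖)
    (hcomp : ∀ s u t x, s₀ ≤ s → s ≤ u → u ≤ t → t ≤ s₁ →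
      ‖μ u t (μ s u x) - μ s t x‖ ≤ C * ω s t ^ γ)
    (hid : ∀ t x, s₀ ≤ t → t ≤ s₁ → μ t t x = x)
    {t : ℕ → ℝ} (ht : Monotone t) (ht0 : ∀ k, s₀ ≤ t k) {K : ℕ} (htK : t K ≤ s₁) {y : ℕ → E}
    (hy : ∀ k, k < K → y (k + 1) = μ (t k) (t (k + 1)) (y k)) {i j : ℕ} (hij : i ≤ j)
    (hjK : j ≤ K) :
    ‖y j - μ (t i) (t j) (y i)‖ ≤
      (1 + κ) * C / (1 - (1 + κ ^ 2) * (1 / 2) ^ γ) * ω (t i) (t j) ^ γ := by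
  set ρ := (1 + κ ^ 2) * (1 / 2 : ℝ) ^ γ with hρdef
  set L := (1 + κ) * C / (1 - ρ) with hL
  have hL0 : 0 ≤ L := div_nonneg (by positivity) (by linarith)
  have hts : ∀ k, k ≤ K → t k ≤ s₁ := fun k hk => (ht hk).trans htK
  have h0 : ∀ k, 0 ≤ t k := fun k => hs₀.trans (ht0 k)
  have key : ∀ n i j, i ≤ j → j ≤ K → j - i ≤ n →
      ‖y j - μ (t i) (t j) (y i)‖ ≤ L * ω (t i) (t j) ^ γ := by
    intro n
    induction n with
    | zero =>
      intro i j hij hjK hn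
      obtain rfl : i = j := by omega
      rw [hid _ _ (ht0 i) (hts i hjK), sub_self, norm_zero]
      have := hω.nonneg (h0 i) le_rfl ((hts i hjK).trans hs₁)
      positivity
    | succ n ih =>
      intro i j hij hjK hn
      rcases hij.eq_or_lt with rfl | hlt
      · rw [hid _ _ (ht0 i) (hts i hjK), sub_self, norm_zero]
        have := hω.nonneg (h0 i) le_rfl ((hts i hjK).trans hs₁)
        positivity
      obtain ⟨k, hik, hkj, hk1, hk2⟩ := hω.exists_half_grid ht h0 hlt ((hts j hjK).trans hs₁)
      have hj1 := hts j hjK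
      have hw0 := hω.nonneg (h0 i) (ht hij) (hj1.trans hs₁)
      have w1 := rpow_le_half_rpow
        (hω.nonneg (h0 i) (ht hik) ((hts k (by omega)).trans hs₁)) hw0 hγ.le hk1
      have w2 := rpow_le_half_rpow
        (hω.nonneg (h0 (k + 1)) (ht (by omega : k + 1 ≤ j)) (hj1.trans hs₁)) hw0 hγ.le hk2
      have a1 := ih i k hik (by omega) (by omega)
      have a2 := ih (k + 1) j (by omega) hjK (by omega)
      have b1 := hlip (t k) (t (k + 1)) (y k) (μ (t i) (t k) (y i)) (ht0 k)
        (ht (Nat.le_succ k)) (hts _ (by omega))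
      have b2 := hcomp (t i) (t k) (t (k + 1)) (y i) (ht0 i) (ht hik)
        (ht (Nat.le_succ k)) (hts _ (by omega))
      have hmono : ω (t i) (t (k + 1)) ^ γ ≤ ω (t i) (t j) ^ γ :=
        Real.rpow_le_rpow (hω.nonneg (h0 i) (ht (by omega)) ((hts _ (by omega)).trans hs₁))
          (hω.mono (h0 i) le_rfl (ht (by omega)) (ht (by omega)) (hj1.trans hs₁)) hγ.le
      have c1 : ‖y (k + 1) - μ (t i) (t (k + 1)) (y i)‖ ≤
          κ * (L * ((1 / 2 : ℝ) ^ γ * ω (t i) (t j) ^ γ)) + C * ω (t i) (t j) ^ γ := by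
        rw [hy k (by omega)]
        refine (norm_sub_le_norm_sub_add_norm_sub _ (μ (t k) (t (k + 1))
          (μ (t i) (t k) (y i))) _).trans (add_le_add (b1.trans ?_) (b2.trans ?_))
        · gcongr
          exact a1.trans (by gcongr)
        · gcongr
      have b3 := hlip (t (k + 1)) (t j) (y (k + 1)) (μ (t i) (t (k + 1)) (y i)) (ht0 _)
        (ht (by omega)) hj1
      have b4 := hcomp (t i) (t (k + 1)) (t j) (y i) (ht0 i) (ht (by omega)) (ht (by omega)) hj1
      have hLeq : L * (1 - ρ) = (1 + κ) * C := div_mul_cancel₀ _ (by linarith)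
      calc ‖y j - μ (t i) (t j) (y i)‖
          ≤ ‖y j - μ (t (k + 1)) (t j) (y (k + 1))‖ +
            (‖μ (t (k + 1)) (t j) (y (k + 1)) -
              μ (t (k + 1)) (t j) (μ (t i) (t (k + 1)) (y i))‖ +
            ‖μ (t (k + 1)) (t j) (μ (t i) (t (k + 1)) (y i)) - μ (t i) (t j) (y i)‖) :=
            (norm_sub_le_norm_sub_add_norm_sub _ _ _).trans
              (add_le_add le_rfl (norm_sub_le_norm_sub_add_norm_sub _ _ _))
        _ ≤ L * ((1 / 2 : ℝ) ^ γ * ω (t i) (t j) ^ γ) +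
            (κ * (κ * (L * ((1 / 2 : ℝ) ^ γ * ω (t i) (t j) ^ γ)) + C * ω (t i) (t j) ^ γ) +
              C * ω (t i) (t j) ^ γ) := by
            refine add_le_add (a2.trans (by gcongr)) (add_le_add (b3.trans (by gcongr)) b4)
        _ = (L * ρ + (1 + κ) * C) * ω (t i) (t j) ^ γ := by rw [hρdef]; ring
        _ = L * ω (t i) (t j) ^ γ := by rw [← hLeq]; ring
  exact key (j - i) i j hij hjK le_rfl

/-- The Euler scheme of `μ` along the grid `t`, started at `x₀`. -/
def eulerScheme (μ : ℝ → ℝ → E → E) (t : ℕ → ℝ) (x₀ : E) : ℕ → E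
  | 0 => x₀
  | k + 1 => μ (t k) (t (k + 1)) (eulerScheme μ t x₀ k)

/-- An almost flow `μ` (Lipschitz steps which compose up to `ω ^ γ`) is followed by some path: a
limit of Euler schemes along an ultrafilter. -/
theorem exists_path_of_almostFlow [ProperSpace E] (hω : IsControl T ω) {s₀ s₁ : ℝ} (hs₀ : 0 ≤ s₀)
    (hs₀₁ : s₀ ≤ s₁) (hs₁ : s₁ ≤ T)
    {μ : ℝ → ℝ → E → E} {γ β κ C D : ℝ} (hγ : 0 < γ) (hβ : 0 < β) (hκ : 0 ≤ κ) (hC : 0 ≤ C)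
    (hD : 0 ≤ D) (hρ : (1 + κ ^ 2) * (1 / 2) ^ γ < 1)
    (hlip : ∀ s t x y, s₀ ≤ s → s ≤ t → t ≤ s₁ → ‖μ s t x - μ s t y‖ ≤ κ * ‖x - y‖)
    (hcomp : ∀ s u t x, s₀ ≤ s → s ≤ u → u ≤ t → t ≤ s₁ →
      ‖μ u t (μ s u x) - μ s t x‖ ≤ C * ω s t ^ γ)
    (hnear : ∀ s t x, s₀ ≤ s → s ≤ t → t ≤ s₁ → ‖μ s t x - x‖ ≤ D * ω s t ^ β)
    (hcont : ContinuousOn (fun q : (ℝ × ℝ) × E => μ q.1.1 q.1.2 q.2)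
      {q | s₀ ≤ q.1.1 ∧ q.1.1 ≤ q.1.2 ∧ q.1.2 ≤ s₁}) (x₀ : E) :
    ∃ x : ℝ → E, x s₀ = x₀ ∧ ContinuousOn x (Set.Icc s₀ s₁) ∧
      ∀ s t, s₀ ≤ s → s ≤ t → t ≤ s₁ → ‖x t - μ s t (x s)‖ ≤
        (1 + κ) * C / (1 - (1 + κ ^ 2) * (1 / 2) ^ γ) * ω s t ^ γ := by
  set L := (1 + κ) * C / (1 - (1 + κ ^ 2) * (1 / 2 : ℝ) ^ γ) with hL
  have hL0 : 0 ≤ L := div_nonneg (by positivity) (by linarith)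
  have hid : ∀ t x, s₀ ≤ t → t ≤ s₁ → μ t t x = x := fun t x h1 h2 => by
    have := hnear t t x h1 le_rfl h2
    rw [hω.diag t (hs₀.trans h1) (h2.trans hs₁), Real.zero_rpow hβ.ne', mul_zero] at this
    exact sub_eq_zero.1 (norm_le_zero_iff.1 this)
  -- the grid with `n + 1` steps, and the index of the last grid point before `t`
  set h : ℕ → ℝ := fun n => (s₁ - s₀) / (n + 1) with hh
  have hhn : ∀ n, 0 ≤ h n := fun n => div_nonneg (by linarith) (by positivity)
  set g : ℕ → ℕ → ℝ := fun n k => s₀ + k * h n with hg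
  have hgm : ∀ n, Monotone (g n) := fun n i j hij => by
    simp only [hg]
    have : (i : ℝ) ≤ j := by exact_mod_cast hij
    gcongr
  have hg0 : ∀ n k, s₀ ≤ g n k := fun n k => le_add_of_nonneg_right
    (mul_nonneg (Nat.cast_nonneg k) (hhn n))
  have hgn : ∀ n, g n (n + 1) = s₁ := fun n => by
    simp only [hg, hh]
    push_cast
    field_simp
    ring
  -- for `s₀ = s₁` the quotient is `0`, and every grid point is `s₀`
  set κi : ℕ → ℝ → ℕ := fun n t => ⌊(t - s₀) / (s₁ - s₀) * (n + 1)⌋₊ with hκi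
  have hki : ∀ n t, s₀ ≤ t → t ≤ s₁ → κi n t ≤ n + 1 := fun n t h1 h2 => by
    have : (t - s₀) / (s₁ - s₀) ≤ 1 := div_le_one_of_le₀ (by linarith) (by linarith)
    refine Nat.floor_le_of_le ?_
    push_cast
    exact mul_le_of_le_one_left (by positivity) this
  have hkm : ∀ n s t, s ≤ t → κi n s ≤ κi n t := fun n s t hst => by
    refine Nat.floor_mono ?_
    have : 0 ≤ s₁ - s₀ := by linarith
    gcongr
  have hgt : ∀ n t, s₀ ≤ t → t ≤ s₁ → |g n (κi n t) - t| ≤ h n := by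
    intro n t h1 h2
    rcases hs₀₁.eq_or_lt with heq | hlt
    · have : t = s₀ := le_antisymm (by linarith) h1
      simp [hg, hh, this, ← heq]
    · have hp : 0 < s₁ - s₀ := by linarith
      have hn1 : (0 : ℝ) < n + 1 := by positivity
      set r := (t - s₀) / (s₁ - s₀) * (n + 1) with hr
      have hr0 : 0 ≤ r := mul_nonneg (div_nonneg (by linarith) hp.le) hn1.le
      have e : t = s₀ + r * h n := by
        simp only [hr, hh]
        field_simp
        ring
      have f1 := Nat.floor_le hr0
      have f2 := Nat.lt_floor_add_one r
      have e2 : g n (κi n t) - t = ((⌊r⌋₊ : ℝ) - r) * h n := by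
        have e3 : g n (κi n t) = s₀ + ⌊r⌋₊ * h n := rfl
        rw [e3]
        linear_combination (-1 : ℝ) * e
      rw [e2, abs_mul, abs_of_nonneg (hhn n)]
      refine mul_le_of_le_one_left (hhn n) ?_
      rw [abs_le]
      constructor <;> linarith
  have hh0 : Tendsto h atTop (𝓝 0) := tendsto_const_nhds.div_atTop
    (tendsto_atTop_add_const_right _ _ tendsto_natCast_atTop_atTop)
  have hglim : ∀ t, s₀ ≤ t → t ≤ s₁ → Tendsto (fun n => g n (κi n t)) atTop (𝓝 t) := by
    intro t h1 h2
    rw [tendsto_iff_norm_sub_tendsto_zero]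
    exact squeeze_zero (fun _ => norm_nonneg _) (fun n => hgt n t h1 h2) hh0
  set X : ℕ → ℝ → E := fun n t => eulerScheme μ (g n) x₀ (κi n t) with hX
  have hXbd : ∀ n s t, s₀ ≤ s → s ≤ t → t ≤ s₁ →
      ‖X n t - μ (g n (κi n s)) (g n (κi n t)) (X n s)‖ ≤
        L * ω (g n (κi n s)) (g n (κi n t)) ^ γ := fun n s t h1 h2 h3 =>
    norm_scheme_sub_le hω hs₀ hs₁ hγ hκ hC hρ hlip hcomp hid (hgm n) (hg0 n) (hgn n).le
      (fun k _ => rfl) (hkm n s t h2) (hki n t (h1.trans h2) h3)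
  have hgs₁ : ∀ n t, s₀ ≤ t → t ≤ s₁ → g n (κi n t) ≤ s₁ := fun n t h1 h2 =>
    (hgm n (hki n t h1 h2)).trans (hgn n).le
  have hk0 : ∀ n, κi n s₀ = 0 := fun n => by simp [hκi]
  have hX0 : ∀ n, X n s₀ = x₀ := fun n => by simp [hX, hk0, eulerScheme]
  set R := D * ω s₀ s₁ ^ β + L * ω s₀ s₁ ^ γ with hR
  have hXR : ∀ n t, s₀ ≤ t → t ≤ s₁ → X n t ∈ Metric.closedBall x₀ R := by
    intro n t h1 h2
    have b1 := hXbd n s₀ t le_rfl h1 h2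
    have hgt1 := hgs₁ n t h1 h2
    have hgt0 := hg0 n (κi n t)
    have eg : g n (κi n s₀) = s₀ := by simp [hg, hk0]
    rw [eg, hX0] at b1
    have b2 := hnear s₀ (g n (κi n t)) x₀ le_rfl hgt0 hgt1
    have w0 := hω.nonneg hs₀ hgt0 (hgt1.trans hs₁)
    have w1 := hω.mono hs₀ le_rfl hgt0 hgt1 hs₁
    rw [mem_closedBall_iff_norm]
    calc ‖X n t - x₀‖ ≤ _ := norm_sub_le_norm_sub_add_norm_sub _ (μ s₀ (g n (κi n t)) x₀) _
      _ ≤ L * ω s₀ s₁ ^ γ + D * ω s₀ s₁ ^ β :=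
        add_le_add (b1.trans (by gcongr)) (b2.trans (by gcongr))
      _ = R := add_comm _ _
  set 𝒰 : Ultrafilter ℕ := hyperfilter ℕ with h𝒰
  have h𝒰top : (𝒰 : Filter ℕ) ≤ atTop := Nat.hyperfilter_le_atTop
  have hex : ∀ t, ∃ z, s₀ ≤ t → t ≤ s₁ → Tendsto (fun n => X n t) 𝒰 (𝓝 z) := by
    intro t
    by_cases ht : s₀ ≤ t ∧ t ≤ s₁
    · obtain ⟨z, _, hz⟩ := (isCompact_closedBall x₀ R).ultrafilter_le_nhds
        (𝒰.map fun n => X n t) (by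
          rw [Ultrafilter.coe_map, le_principal_iff, mem_map]
          exact univ_mem' fun n => hXR n t ht.1 ht.2)
      exact ⟨z, fun _ _ => hz⟩
    · exact ⟨x₀, fun h1 h2 => absurd ⟨h1, h2⟩ ht⟩
  choose x hx using hex
  have hmain : ∀ s t, s₀ ≤ s → s ≤ t → t ≤ s₁ → ‖x t - μ s t (x s)‖ ≤ L * ω s t ^ γ := by
    intro s t h1 h2 h3
    have gs := (hglim s h1 (h2.trans h3)).mono_left h𝒰top
    have gt := (hglim t (h1.trans h2) h3).mono_left h𝒰top
    have xs := hx s h1 (h2.trans h3)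
    have xt := hx t (h1.trans h2) h3
    have c1 : Tendsto (fun n => μ (g n (κi n s)) (g n (κi n t)) (X n s)) 𝒰 (𝓝 (μ s t (x s))) := by
      have hc := hcont ((s, t), x s) ⟨h1, h2, h3⟩
      refine hc.tendsto.comp (tendsto_nhdsWithin_iff.2 ⟨(gs.prodMk_nhds gt).prodMk_nhds xs,
        Eventually.of_forall fun n => ⟨hg0 _ _, hgm n (hkm n s t h2),
          hgs₁ n t (h1.trans h2) h3⟩⟩)
    have c2 : Tendsto (fun n => ω (g n (κi n s)) (g n (κi n t))) 𝒰 (𝓝 (ω s t)) := by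
      have hc := hω.continuousOn (s, t) ⟨hs₀.trans h1, h2, h3.trans hs₁⟩
      refine hc.tendsto.comp (tendsto_nhdsWithin_iff.2 ⟨gs.prodMk_nhds gt,
        Eventually.of_forall fun n => ⟨hs₀.trans (hg0 _ _), hgm n (hkm n s t h2),
          (hgs₁ n t (h1.trans h2) h3).trans hs₁⟩⟩)
    exact le_of_tendsto_of_tendsto' (xt.sub c1).norm
      ((c2.rpow_const (Or.inr hγ.le)).const_mul L) fun n => hXbd n s t h1 h2 h3
  refine ⟨x, ?_, ?_, hmain⟩
  · refine tendsto_nhds_unique (hx s₀ le_rfl hs₀₁) ?_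
    simp only [hX0]
    exact tendsto_const_nhds
  · rw [Metric.continuousOn_iff]
    intro t ht ε hε
    have hlim : ContinuousAt (fun w : ℝ => L * w ^ γ + D * w ^ β) 0 :=
      ((Real.continuousAt_rpow_const _ _ (Or.inr hγ.le)).const_mul L).add
        ((Real.continuousAt_rpow_const _ _ (Or.inr hβ.le)).const_mul D)
    have hev := hlim.eventually_lt (continuousAt_const (y := ε)) (by
      simpa [Real.zero_rpow hγ.ne', Real.zero_rpow hβ.ne'] using hε)
    obtain ⟨η, hη, hη'⟩ := Metric.eventually_nhds_iff.1 hev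
    obtain ⟨δ, hδ, hδ'⟩ := hω.exists_lt hη
    have hsm : ∀ s t, s₀ ≤ s → s ≤ t → t ≤ s₁ → t - s < δ → ‖x t - x s‖ < ε := by
      intro s t h1 h2 h3 h4
      have w0 := hω.nonneg (hs₀.trans h1) h2 (h3.trans hs₁)
      have w1 := hδ' s t (hs₀.trans h1) h2 (h3.trans hs₁) h4
      refine lt_of_le_of_lt ((norm_sub_le_norm_sub_add_norm_sub _ (μ s t (x s)) _).trans
        (add_le_add (hmain s t h1 h2 h3) (hnear s t (x s) h1 h2 h3))) (hη' ?_)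
      rwa [Real.dist_eq, sub_zero, abs_of_nonneg w0]
    refine ⟨δ, hδ, fun s hs hd => ?_⟩
    rw [Real.dist_eq] at hd
    rcases le_total s t with hst | hst
    · rw [dist_comm, dist_eq_norm]
      exact hsm s t hs.1 hst ht.2 (by linarith [neg_abs_le (s - t)])
    · rw [dist_eq_norm]
      exact hsm t s ht.1 hst hs.2 (by linarith [le_abs_self (s - t)])

/-- Two paths which follow the same `C¹` almost flow and start at the same point coincide, on
intervals on which the control is small. With `N` the maximal distance of the paths, the difference
of their remainders is `O(N ω ^ γ)`, uniformly, by `le_mul_of_contraction`; at the point of maximal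
distance this gives `N ≤ θ N` with `θ < 1`. -/
theorem eq_of_follow_almostFlow (hω : IsControl T ω) {s₀ s₁ : ℝ} (hs₀ : 0 ≤ s₀)
    (hs₁ : s₁ ≤ T) {μ : ℝ → ℝ → E → E} {γ κ C C' K : ℝ} (hγ : 0 < γ) (hκ : 0 ≤ κ)
    (hC : 0 ≤ C) (hC' : 0 ≤ C') (hK : 0 ≤ K)
    (hρ : (1 + κ) * (1 / 2) ^ γ < 1)
    (hlip : ∀ s t x y, s₀ ≤ s → s ≤ t → t ≤ s₁ → ‖μ s t x - μ s t y‖ ≤ κ * ‖x - y‖)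
    (hcomp : ∀ s u t x y, s₀ ≤ s → s ≤ u → u ≤ t → t ≤ s₁ →
      ‖(μ u t (μ s u x) - μ s t x) - (μ u t (μ s u y) - μ s t y)‖ ≤ C * ω s t ^ γ * ‖x - y‖)
    (hdiff : ∀ s t x y r, s₀ ≤ s → s ≤ t → t ≤ s₁ →
      ‖(μ s t (x + r) - μ s t x) - (μ s t (y + r) - μ s t y)‖ ≤ K * ‖r‖ * ‖x - y‖)
    {x y : ℝ → E} (hx : ∀ s t, s₀ ≤ s → s ≤ t → t ≤ s₁ → ‖x t - μ s t (x s)‖ ≤ C' * ω s t ^ γ)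
    (hy : ∀ s t, s₀ ≤ s → s ≤ t → t ≤ s₁ → ‖y t - μ s t (y s)‖ ≤ C' * ω s t ^ γ)
    (hxc : ContinuousOn x (Set.Icc s₀ s₁)) (hyc : ContinuousOn y (Set.Icc s₀ s₁))
    (hxy : x s₀ = y s₀)
    (hsmall : (C + K * C' * κ) / (1 - (1 + κ) * (1 / 2) ^ γ) * ω s₀ s₁ ^ γ < 1)
    {t : ℝ} (ht : s₀ ≤ t) (ht' : t ≤ s₁) : x t = y t := by
  obtain ⟨τ, hτ, hmax⟩ := isCompact_Icc.exists_isMaxOn ⟨t, ht, ht'⟩ (hxc.sub hyc).norm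
  set N := ‖x τ - y τ‖ with hN
  have hNle : ∀ u, s₀ ≤ u → u ≤ s₁ → ‖x u - y u‖ ≤ N := fun u h1 h2 => hmax ⟨h1, h2⟩
  have hN0 : 0 ≤ N := norm_nonneg _
  have hb : 0 ≤ (C + K * C' * κ) * N := by positivity
  have key := le_mul_of_contraction
    (S := {q : ℝ × ℝ | s₀ ≤ q.1 ∧ q.1 ≤ q.2 ∧ q.2 ≤ s₁})
    (g := fun q => ‖(x q.2 - μ q.1 q.2 (x q.1)) - (y q.2 - μ q.1 q.2 (y q.1))‖)
    (w := fun q => ω q.1 q.2 ^ γ) (ρ := (1 + κ) * (1 / 2) ^ γ) (b := (C + K * C' * κ) * N)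
    (a₀ := 2 * C') (by positivity) hρ hb (by positivity) ?_ ?_
  · have h1 := key (s₀, τ) ⟨le_rfl, hτ.1, hτ.2⟩
    simp only [hxy, sub_sub_sub_cancel_right] at h1
    have hw0 := hω.nonneg hs₀ hτ.1 (hτ.2.trans hs₁)
    have hw := hω.mono hs₀ le_rfl hτ.1 hτ.2 hs₁
    have hq : 0 ≤ (C + K * C' * κ) / (1 - (1 + κ) * (1 / 2) ^ γ) :=
      div_nonneg (by positivity) (by linarith)
    have h2 : N ≤ (C + K * C' * κ) / (1 - (1 + κ) * (1 / 2) ^ γ) * ω s₀ s₁ ^ γ * N := by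
      calc N ≤ _ := h1
        _ = (C + K * C' * κ) / (1 - (1 + κ) * (1 / 2) ^ γ) * ω s₀ τ ^ γ * N := by ring
        _ ≤ _ := by gcongr
    have hN00 : N = 0 := by
      by_contra hne
      have : 0 < N := lt_of_le_of_ne hN0 (Ne.symm hne)
      nlinarith
    exact sub_eq_zero.1 (norm_le_zero_iff.1 ((hNle t ht ht').trans hN00.le))
  · rintro ⟨s, t⟩ ⟨h1, h2, h3⟩
    have e1 := hx s t h1 h2 h3
    have e2 := hy s t h1 h2 h3
    calc _ ≤ _ := norm_sub_le _ _
      _ ≤ C' * ω s t ^ γ + C' * ω s t ^ γ := add_le_add e1 e2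
      _ = _ := by ring
  · rintro a ha hh ⟨s, t⟩ ⟨h1, h2, h3⟩
    simp only at h1 h2 h3 ⊢
    obtain ⟨u, hu1, hu2, hu3, hu4⟩ := hω.exists_half (hs₀.trans h1) h2 (h3.trans hs₁)
    have n0 := hω.nonneg (hs₀.trans h1) h2 (h3.trans hs₁)
    have nsu := hω.nonneg (hs₀.trans h1) hu1 ((hu2.trans h3).trans hs₁)
    have r1 := rpow_le_half_rpow nsu n0 hγ.le hu3
    have r2 := rpow_le_half_rpow (hω.nonneg ((hs₀.trans h1).trans hu1) hu2 (h3.trans hs₁)) n0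
      hγ.le hu4
    have e1 := hh (s, u) ⟨h1, hu1, hu2.trans h3⟩
    have e2 := hh (u, t) ⟨h1.trans hu1, hu2, h3⟩
    simp only at e1 e2
    -- `p`, `q` are the two steps from `s` to `u`, and `r`, `r'` the errors made there
    set p := μ s u (x s)
    set q := μ s u (y s)
    set r := x u - p with hr
    set r' := y u - q with hr'
    have hxu : x u = p + r := by rw [hr]; abel
    have hyu : y u = q + r' := by rw [hr']; abel
    have d1 := hdiff u t p q r (h1.trans hu1) hu2 h3
    have d2 := hlip u t (q + r) (q + r') (h1.trans hu1) hu2 h3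
    have d3 := hcomp s u t (x s) (y s) h1 hu1 hu2 h3
    have d4 := hlip s u (x s) (y s) h1 hu1 (hu2.trans h3)
    have d5 : ‖r‖ ≤ C' * ω s t ^ γ := (hx s u h1 hu1 (hu2.trans h3)).trans (by
      gcongr
      exact hω.mono (hs₀.trans h1) le_rfl hu1 hu2 (h3.trans hs₁))
    have d6 := hNle s h1 (h2.trans h3)
    rw [add_sub_add_left_eq_sub] at d2
    have heq : (x t - μ s t (x s)) - (y t - μ s t (y s)) =
        ((x t - μ u t (x u)) - (y t - μ u t (y u))) +
        (((μ u t (p + r) - μ u t p) - (μ u t (q + r) - μ u t q)) +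
        ((μ u t (q + r) - μ u t (q + r')) +
        ((μ u t p - μ s t (x s)) - (μ u t q - μ s t (y s))))) := by
      rw [← hxu, ← hyu]
      abel
    rw [heq]
    calc _ ≤ _ := (norm_add_le _ _).trans (add_le_add le_rfl ((norm_add_le _ _).trans
          (add_le_add le_rfl (norm_add_le _ _))))
      _ ≤ a * ((1 / 2 : ℝ) ^ γ * ω s t ^ γ) + (K * (C' * ω s t ^ γ) * (κ * N) +
          (κ * (a * ((1 / 2 : ℝ) ^ γ * ω s t ^ γ)) + C * ω s t ^ γ * N)) := by
        refine add_le_add (e2.trans (by gcongr)) (add_le_add (d1.trans ?_) (add_le_add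
          (d2.trans ?_) (d3.trans (by gcongr))))
        · gcongr
          exact d4.trans (by gcongr)
        · gcongr
          exact e1.trans (by gcongr)
      _ = _ := by ring

end AlmostFlow

/-! ### Bounds for rough paths -/

section Bounds

variable {T S p : ℝ} {ω : ℝ → ℝ → ℝ}

theorem rpow_one_div_pow {w p : ℝ} (hw : 0 ≤ w) (k : ℕ) : (w ^ (1 / p)) ^ k = w ^ (k / p) := by
  rw [← Real.rpow_natCast, ← Real.rpow_mul hw]
  congr 1
  ring

theorem IsControl.mono_right (hω : IsControl T ω) (hS : S ≤ T) : IsControl S ω where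
  continuousOn := hω.continuousOn.mono fun _ hq => ⟨hq.1, hq.2.1, hq.2.2.trans hS⟩
  superadditive s u t h1 h2 h3 h4 := hω.superadditive s u t h1 h2 h3 (h4.trans hS)
  pos s t h1 h2 h3 := hω.pos s t h1 h2 (h3.trans hS)
  diag t h1 h2 := hω.diag t h1 (h2.trans hS)

theorem IsControl.exists_rpow_le (hω : IsControl T ω) {γ : ℝ} (hγ : 0 ≤ γ) :
    ∃ c, 0 ≤ c ∧ ∀ s t, 0 ≤ s → s ≤ t → t ≤ T → ω s t ^ γ ≤ c := by
  refine ⟨|ω 0 T| ^ γ, by positivity, fun s t h1 h2 h3 => ?_⟩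
  exact Real.rpow_le_rpow (hω.nonneg h1 h2 h3)
    ((hω.mono le_rfl h1 h2 h3 le_rfl).trans (le_abs_self _)) hγ

variable {V : Type*} [NormedAddCommGroup V] [InnerProductSpace ℝ V]

theorem IsRoughPath.second_self {X : RoughPair V} (hX : IsRoughPath p ω S X) {t : ℝ} (h0 : 0 ≤ t)
    (hS : t ≤ S) : X.second t t = 0 := by
  have := hX.chen t t t h0 le_rfl le_rfl hS
  simpa [RoughPair.incr] using this

theorem IsRoughPath.exists_bound (hω : IsControl S ω) {X : RoughPair V}
    (hX : IsRoughPath p ω S X) : ∃ c, 0 ≤ c ∧ ∀ s t, 0 ≤ s → s ≤ t → t ≤ S →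
      ‖X.incr s t‖ ≤ c * ω s t ^ (1 / p) ∧ ‖X.second s t‖ ≤ c * (ω s t ^ (1 / p)) ^ 2 := by
  obtain ⟨C₁, h₁⟩ := hX.bound_trace
  obtain ⟨C₂, h₂⟩ := hX.bound_second
  refine ⟨max (max C₁ C₂) 0, le_max_right _ _, fun s t hs hst ht => ?_⟩
  rcases hst.eq_or_lt with rfl | hlt
  · rw [hX.second_self hs ht, RoughPair.incr, sub_self, norm_zero, norm_zero]
    have := hω.nonneg hs le_rfl ht
    constructor <;> positivity
  · have hw := hω.pos s t hs hlt ht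
    have e1 := h₁ s t hs hlt ht
    have e2 := h₂ s t hs hlt ht
    rw [div_le_iff₀ (by positivity)] at e1 e2
    rw [rpow_one_div_pow hw.le]
    exact ⟨e1.trans (by gcongr; exact (le_max_left _ _).trans (le_max_left _ _)),
      e2.trans (by push_cast; gcongr; exact (le_max_right _ _).trans (le_max_left _ _))⟩

end Bounds

/-! ### Rough differential equations in a vector space -/

section FlatEquation

variable {T p : ℝ} {ω : ℝ → ℝ → ℝ}
variable {V E : Type*} [NormedAddCommGroup V] [InnerProductSpace ℝ V]

theorem isBigO_principal_nonneg {ι F : Type*} [Norm F] {f : ι → F} {g : ι → ℝ} {s : Set ι}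
    (h : f =O[𝓟 s] g) (hg : ∀ i ∈ s, 0 ≤ g i) : ∃ C, 0 ≤ C ∧ ∀ i ∈ s, ‖f i‖ ≤ C * g i := by
  obtain ⟨C, hC⟩ := isBigO_principal.1 h
  refine ⟨max C 0, le_max_right _ _, fun i hi => (hC i hi).trans ?_⟩
  rw [Real.norm_of_nonneg (hg i hi)]
  exact mul_le_mul_of_nonneg_right (le_max_left _ _) (hg i hi)

theorem isBigO_incr (hω : IsControl T ω) {Z : RoughPair V} (hZ : IsRoughPath p ω T Z)
    {ι : Type*} {D : Set ι} {a b : ι → ℝ} {w : ι → ℝ}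
    (hD : ∀ i ∈ D, 0 ≤ a i ∧ a i ≤ b i ∧ b i ≤ T ∧ ω (a i) (b i) ^ (1 / p) ≤ w i) :
    (fun i => Z.incr (a i) (b i)) =O[𝓟 D] w ∧
      (fun i => Z.second (a i) (b i)) =O[𝓟 D] fun i => w i ^ 2 := by
  obtain ⟨c, hc, h⟩ := hZ.exists_bound hω
  constructor <;> refine isBigO_principal.2 ⟨c, fun i hi => ?_⟩ <;>
    obtain ⟨h1, h2, h3, h4⟩ := hD i hi <;> have hn := hω.nonneg h1 h2 h3 <;>
    have hn' : 0 ≤ ω (a i) (b i) ^ (1 / p) := by positivity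
  · rw [Real.norm_of_nonneg (hn'.trans h4)]
    exact (h _ _ h1 h2 h3).1.trans (by gcongr)
  · rw [Real.norm_of_nonneg (by positivity)]
    exact (h _ _ h1 h2 h3).2.trans (by gcongr)

theorem isBigO_control_rpow (hω : IsControl T ω) (hp : 0 < p) {ι : Type*} {D : Set ι}
    {a b : ι → ℝ} (hD : ∀ i ∈ D, 0 ≤ a i ∧ a i ≤ b i ∧ b i ≤ T) :
    (fun i => ω (a i) (b i) ^ (1 / p)) =O[𝓟 D] fun _ => (1 : ℝ) := by
  obtain ⟨c, _, h⟩ := hω.exists_rpow_le (γ := 1 / p) (by positivity)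
  refine isBigO_principal.2 ⟨c, fun i hi => ?_⟩
  obtain ⟨h1, h2, h3⟩ := hD i hi
  have := hω.nonneg h1 h2 h3
  rw [Real.norm_of_nonneg (by positivity)]
  simpa using h _ _ h1 h2 h3

variable [FiniteDimensional ℝ V] [NormedAddCommGroup E] [NormedSpace ℝ E] [FiniteDimensional ℝ E]

/-- The second order Euler step over `[s,t]` of the equation `dx = G(x) dZ`. -/
noncomputable def rdeStep (G : E → V →L[ℝ] E) (Z : RoughPair V) (s t : ℝ) (x : E) : E :=
  step G (Z.incr s t) (Z.second s t) x

theorem rdeStep_sub_self (G : E → V →L[ℝ] E) (Z : RoughPair V) (s t : ℝ) (x : E) :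
    rdeStep G Z s t x - x = stepIncr G (Z.incr s t) (Z.second s t) x := by
  simp [rdeStep, step]

theorem rdeStep_sub_rdeStep (G : E → V →L[ℝ] E) (Z : RoughPair V) (s t : ℝ) (x y : E) :
    rdeStep G Z s t x - rdeStep G Z s t y = (x - y) +
      (stepIncr G (Z.incr s t) (Z.second s t) x - stepIncr G (Z.incr s t) (Z.second s t) y) := by
  simp only [rdeStep, step]
  abel

/-- The Euler steps of a rough differential equation with compactly supported smooth coefficients
form a `C¹` almost flow. -/
theorem exists_rdeStep_bounds (hω : IsControl T ω) (hp : 0 < p) {G : E → V →L[ℝ] E}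
    (hG : IsTestMap G) {Z : RoughPair V} (hZ : IsRoughPath p ω T Z) :
    ∃ C, 0 ≤ C ∧
      (∀ s t x, 0 ≤ s → s ≤ t → t ≤ T → ‖rdeStep G Z s t x - x‖ ≤ C * ω s t ^ (1 / p)) ∧
      (∀ s t x y, 0 ≤ s → s ≤ t → t ≤ T →
        ‖rdeStep G Z s t x - rdeStep G Z s t y‖ ≤ (1 + C * ω s t ^ (1 / p)) * ‖x - y‖) ∧
      (∀ s u t x, 0 ≤ s → s ≤ u → u ≤ t → t ≤ T →
        ‖rdeStep G Z u t (rdeStep G Z s u x) - rdeStep G Z s t x‖ ≤ C * ω s t ^ (3 / p)) ∧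
      (∀ s u t x y, 0 ≤ s → s ≤ u → u ≤ t → t ≤ T →
        ‖(rdeStep G Z u t (rdeStep G Z s u x) - rdeStep G Z s t x) -
          (rdeStep G Z u t (rdeStep G Z s u y) - rdeStep G Z s t y)‖ ≤
          C * ω s t ^ (3 / p) * ‖x - y‖) ∧
      (∀ s t x y r, 0 ≤ s → s ≤ t → t ≤ T →
        ‖(rdeStep G Z s t (x + r) - rdeStep G Z s t x) -
          (rdeStep G Z s t (y + r) - rdeStep G Z s t y)‖ ≤ C * ‖r‖ * ‖x - y‖) := by
  have hpow : ∀ {s t}, 0 ≤ s → s ≤ t → t ≤ T → (ω s t ^ (1 / p)) ^ 3 = ω s t ^ (3 / p) :=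
    fun h1 h2 h3 => by simpa using rpow_one_div_pow (p := p) (hω.nonneg h1 h2 h3) 3
  -- two time parameters and three space parameters
  set D₂ : Set ((ℝ × ℝ) × E × E × E) := {q | 0 ≤ q.1.1 ∧ q.1.1 ≤ q.1.2 ∧ q.1.2 ≤ T} with hD₂
  set lam₂ : (ℝ × ℝ) × E × E × E → ℝ := fun q => ω q.1.1 q.1.2 ^ (1 / p) with hlam₂
  have hl₂ : lam₂ =O[𝓟 D₂] fun _ => (1 : ℝ) :=
    isBigO_control_rpow hω hp (ι := (ℝ × ℝ) × E × E × E)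
      (a := fun q => q.1.1) (b := fun q => q.1.2) fun i hi => hi
  have hn₂ : ∀ q ∈ D₂, 0 ≤ lam₂ q := fun q hq => by
    have := hω.nonneg hq.1 hq.2.1 hq.2.2
    simp only [hlam₂]
    positivity
  obtain ⟨hz₂, hzz₂⟩ := isBigO_incr hω hZ (ι := (ℝ × ℝ) × E × E × E) (D := D₂)
     (a := fun q => q.1.1) (b := fun q => q.1.2)
    (w := lam₂) fun i hi => ⟨hi.1, hi.2.1, hi.2.2, le_rfl⟩
  obtain ⟨C₁, hC₁, h₁⟩ := isBigO_principal_nonneg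
    (stepIncr_isBigO hG hl₂ hz₂ hzz₂ (fun q => q.2.1)) hn₂
  obtain ⟨C₂, hC₂, h₂⟩ := isBigO_principal_nonneg
    (stepIncr_sub_isBigO hG hl₂ hz₂ hzz₂ (fun q => q.2.1) (fun q => q.2.2.1))
    (fun q hq => mul_nonneg (hn₂ q hq) (norm_nonneg _))
  obtain ⟨C₅, hC₅, h₅⟩ := isBigO_principal_nonneg
    (((stepIncr_diff_sub_diff_isBigO hG hl₂ hz₂ hzz₂ (fun q => q.2.1) (fun q => q.2.2.1)
      (fun q => q.2.2.2)).trans (hl₂.mul (isBigO_refl _ _))))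
    (fun q hq => by positivity)
  -- three time parameters and two space parameters
  set D₃ : Set ((ℝ × ℝ × ℝ) × E × E) :=
    {q | 0 ≤ q.1.1 ∧ q.1.1 ≤ q.1.2.1 ∧ q.1.2.1 ≤ q.1.2.2 ∧ q.1.2.2 ≤ T} with hD₃
  set lam₃ : (ℝ × ℝ × ℝ) × E × E → ℝ := fun q => ω q.1.1 q.1.2.2 ^ (1 / p) with hlam₃
  have hl₃ : lam₃ =O[𝓟 D₃] fun _ => (1 : ℝ) :=
    isBigO_control_rpow hω hp (ι := (ℝ × ℝ × ℝ) × E × E)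
      (a := fun q => q.1.1) (b := fun q => q.1.2.2)
      fun i hi => ⟨hi.1, hi.2.1.trans hi.2.2.1, hi.2.2.2⟩
  have hn₃ : ∀ q ∈ D₃, 0 ≤ lam₃ q := fun q hq => by
    have := hω.nonneg hq.1 (hq.2.1.trans hq.2.2.1) hq.2.2.2
    simp only [hlam₃]
    positivity
  obtain ⟨ha, hA⟩ := isBigO_incr hω hZ (ι := (ℝ × ℝ × ℝ) × E × E) (D := D₃)
     (a := fun q => q.1.1) (b := fun q => q.1.2.1)
    (w := lam₃) fun i hi => ⟨hi.1, hi.2.1, hi.2.2.1.trans hi.2.2.2,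
      Real.rpow_le_rpow (hω.nonneg hi.1 hi.2.1 (hi.2.2.1.trans hi.2.2.2))
        (hω.mono hi.1 le_rfl hi.2.1 hi.2.2.1 hi.2.2.2) (by positivity)⟩
  obtain ⟨hb, hB⟩ := isBigO_incr hω hZ (ι := (ℝ × ℝ × ℝ) × E × E) (D := D₃)
     (a := fun q => q.1.2.1) (b := fun q => q.1.2.2)
    (w := lam₃) fun i hi => ⟨hi.1.trans hi.2.1, hi.2.2.1, hi.2.2.2,
      Real.rpow_le_rpow (hω.nonneg (hi.1.trans hi.2.1) hi.2.2.1 hi.2.2.2)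
        (hω.mono hi.1 hi.2.1 hi.2.2.1 le_rfl hi.2.2.2) (by positivity)⟩
  obtain ⟨C₃, hC₃, h₃⟩ := isBigO_principal_nonneg
    (step_step_sub_step_isBigO hG hl₃ ha hA hb hB (fun q => q.2.1))
    (fun q hq => pow_nonneg (hn₃ q hq) 3)
  obtain ⟨C₄, hC₄, h₄⟩ := isBigO_principal_nonneg
    (step_step_sub_step_sub_isBigO hG hl₃ ha hA hb hB (fun q => q.2.1) (fun q => q.2.2))
    (fun q hq => mul_nonneg (pow_nonneg (hn₃ q hq) 3) (norm_nonneg _))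
  have hchen : ∀ s u t, 0 ≤ s → s ≤ u → u ≤ t → t ≤ T → Z.second s u + Z.second u t +
      Z.incr s u ⊗ₜ[ℝ] Z.incr u t = Z.second s t :=
    fun s u t a1 a2 a3 a4 => (hZ.chen s u t a1 a2 a3 a4).symm
  have hadd : ∀ s u t, Z.incr s u + Z.incr u t = Z.incr s t := fun s u t => by
    simp only [RoughPair.incr]; abel
  refine ⟨C₁ + C₂ + C₃ + C₄ + C₅, by positivity, ?_, ?_, ?_, ?_, ?_⟩
  · intro s t x a1 a2 a3
    have := hω.nonneg a1 a2 a3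
    rw [rdeStep_sub_self]
    refine (h₁ ((s, t), x, x, x) ⟨a1, a2, a3⟩).trans ?_
    gcongr
    linarith
  · intro s t x y a1 a2 a3
    have := hω.nonneg a1 a2 a3
    rw [rdeStep_sub_rdeStep, add_mul, one_mul, mul_assoc]
    refine (norm_add_le _ _).trans (add_le_add le_rfl
      ((h₂ ((s, t), x, y, y) ⟨a1, a2, a3⟩).trans ?_))
    gcongr
    linarith
  · intro s u t x a1 a2 a3 a4
    have := hω.nonneg a1 (a2.trans a3) a4
    have h := h₃ ((s, u, t), x, x) ⟨a1, a2, a3, a4⟩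
    simp only [hchen s u t a1 a2 a3 a4, hadd, hlam₃, hpow a1 (a2.trans a3) a4] at h
    refine h.trans ?_
    gcongr
    linarith
  · intro s u t x y a1 a2 a3 a4
    have := hω.nonneg a1 (a2.trans a3) a4
    have h := h₄ ((s, u, t), x, y) ⟨a1, a2, a3, a4⟩
    simp only [hchen s u t a1 a2 a3 a4, hadd, hlam₃, hpow a1 (a2.trans a3) a4] at h
    refine h.trans ?_
    rw [mul_assoc]
    gcongr
    linarith
  · intro s t x y r a1 a2 a3
    have e : (rdeStep G Z s t (x + r) - rdeStep G Z s t x) -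
        (rdeStep G Z s t (y + r) - rdeStep G Z s t y) =
        (stepIncr G (Z.incr s t) (Z.second s t) (x + r) -
          stepIncr G (Z.incr s t) (Z.second s t) x) -
        (stepIncr G (Z.incr s t) (Z.second s t) (y + r) -
          stepIncr G (Z.incr s t) (Z.second s t) y) := by
      rw [rdeStep_sub_rdeStep, rdeStep_sub_rdeStep]
      abel
    rw [e]
    refine (h₅ ((s, t), x, y, r) ⟨a1, a2, a3⟩).trans ?_
    simp only [one_mul]
    rw [mul_assoc]
    gcongr
    linarith

theorem continuousOn_rdeStep {G : E → V →L[ℝ] E} (hG : IsTestMap G) {Z : RoughPair V}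
    (hZ : IsRoughPath p ω T Z) :
    ContinuousOn (fun q : (ℝ × ℝ) × E => rdeStep G Z q.1.1 q.1.2 q.2)
      {q | 0 ≤ q.1.1 ∧ q.1.1 ≤ q.1.2 ∧ q.1.2 ≤ T} := by
  have h1 : ContinuousOn (fun q : (ℝ × ℝ) × E => Z.trace q.1.1)
      {q | 0 ≤ q.1.1 ∧ q.1.1 ≤ q.1.2 ∧ q.1.2 ≤ T} :=
    hZ.continuousOn_trace.comp (f := fun q : (ℝ × ℝ) × E => q.1.1) (by fun_prop)
      fun q hq => ⟨hq.1, hq.2.1.trans hq.2.2⟩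
  have h2 : ContinuousOn (fun q : (ℝ × ℝ) × E => Z.trace q.1.2)
      {q | 0 ≤ q.1.1 ∧ q.1.1 ≤ q.1.2 ∧ q.1.2 ≤ T} :=
    hZ.continuousOn_trace.comp (f := fun q : (ℝ × ℝ) × E => q.1.2) (by fun_prop)
      fun q hq => ⟨hq.1.trans hq.2.1, hq.2.2⟩
  have h3 : ContinuousOn (fun q : (ℝ × ℝ) × E => Z.second q.1.1 q.1.2)
      {q | 0 ≤ q.1.1 ∧ q.1.1 ≤ q.1.2 ∧ q.1.2 ≤ T} :=
    hZ.continuousOn_second.comp (f := fun q : (ℝ × ℝ) × E => q.1) (by fun_prop) fun q hq => hq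
  have h4 : Continuous fun q : (ℝ × ℝ) × E => G q.2 := hG.continuous.comp continuous_snd
  have h5 : Continuous fun q : (ℝ × ℝ) × E => secondCoeff G q.2 :=
    hG.secondCoeff.continuous.comp continuous_snd
  exact continuousOn_snd.add ((h4.continuousOn.clm_apply (h2.sub h1)).add
    (h5.continuousOn.clm_apply h3))

/-- On short intervals the Lipschitz constants `1 + η` of the Euler steps are small enough for the
results on almost flows to apply. -/
theorem exists_lipschitz_const {γ : ℝ} (hγ : 1 < γ) :
    ∃ η > 0, (1 + (1 + η) ^ 2) * (1 / 2 : ℝ) ^ γ < 1 := by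
  have hc : ContinuousAt (fun η : ℝ => (1 + (1 + η) ^ 2) * (1 / 2 : ℝ) ^ γ) 0 := by fun_prop
  have hev := hc.eventually_lt (continuousAt_const (y := (1 : ℝ))) (by
    have := two_mul_half_rpow_lt_one hγ
    norm_num at this ⊢
    exact this)
  obtain ⟨ε, hε, h⟩ := Metric.eventually_nhds_iff.1 hev
  refine ⟨ε / 2, by positivity, h ?_⟩
  rw [Real.dist_eq, sub_zero, abs_of_pos (by positivity)]
  linarith

theorem IsControl.exists_rpow_lt (hω : IsControl T ω) {γ : ℝ} (hγ : 0 < γ) {ε : ℝ} (hε : 0 < ε)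
    {C : ℝ} (hC : 0 ≤ C) :
    ∃ δ > 0, ∀ s t, 0 ≤ s → s ≤ t → t ≤ T → t - s < δ → C * ω s t ^ γ < ε := by
  obtain ⟨δ, hδ, h⟩ := hω.exists_lt (ε := (ε / (C + 1)) ^ (1 / γ)) (by positivity)
  refine ⟨δ, hδ, fun s t h1 h2 h3 h4 => ?_⟩
  have h0 := hω.nonneg h1 h2 h3
  have h5 : ω s t ^ γ < ε / (C + 1) := by
    calc ω s t ^ γ < ((ε / (C + 1)) ^ (1 / γ)) ^ γ := Real.rpow_lt_rpow h0 (h s t h1 h2 h3 h4) hγ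
      _ = ε / (C + 1) := by
        rw [← Real.rpow_mul (by positivity), one_div_mul_cancel hγ.ne', Real.rpow_one]
  rw [lt_div_iff₀ (by positivity)] at h5
  have : 0 ≤ ω s t ^ γ := by positivity
  nlinarith

/-- Local existence, on time intervals whose length does not depend on the starting point. -/
theorem exists_rde_path (hω : IsControl T ω) (hp : 0 < p) (hp3 : p < 3) {G : E → V →L[ℝ] E}
    (hG : IsTestMap G) {Z : RoughPair V} (hZ : IsRoughPath p ω T Z) {r : ℝ} (hr : 0 < r) :
    ∃ δ > 0, ∃ C, 0 ≤ C ∧ ∀ s₀ s₁ x₀, 0 ≤ s₀ → s₀ ≤ s₁ → s₁ ≤ T → s₁ - s₀ < δ →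
      ∃ x : ℝ → E, x s₀ = x₀ ∧ ContinuousOn x (Set.Icc s₀ s₁) ∧
        (∀ s t, s₀ ≤ s → s ≤ t → t ≤ s₁ → ‖x t - rdeStep G Z s t (x s)‖ ≤ C * ω s t ^ (3 / p)) ∧
        ∀ t, s₀ ≤ t → t ≤ s₁ → ‖x t - x₀‖ < r := by
  obtain ⟨C, hC, b1, b2, b3, -, -⟩ := exists_rdeStep_bounds hω hp hG hZ
  have hγ : 1 < 3 / p := by rwa [one_lt_div hp]
  have hβ : 0 < 1 / p := by positivity
  obtain ⟨η, hη, hη'⟩ := exists_lipschitz_const hγ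
  set L := (1 + (1 + η)) * C / (1 - (1 + (1 + η) ^ 2) * (1 / 2 : ℝ) ^ (3 / p)) with hL
  have hL0 : 0 ≤ L := div_nonneg (by positivity) (by linarith)
  obtain ⟨δ₁, hδ₁, hs₁⟩ := hω.exists_rpow_lt hβ hη hC
  obtain ⟨δ₂, hδ₂, hs₂⟩ := hω.exists_rpow_lt hβ (half_pos hr) hC
  obtain ⟨δ₃, hδ₃, hs₃⟩ := hω.exists_rpow_lt (zero_lt_one.trans hγ) (half_pos hr) hL0
  refine ⟨min δ₁ (min δ₂ δ₃), by positivity, L, hL0, fun s₀ s₁ x₀ h0 h01 h1 hd => ?_⟩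
  rw [lt_min_iff, lt_min_iff] at hd
  obtain ⟨x, hx0, hxc, hx⟩ := exists_path_of_almostFlow hω h0 h01 h1 (μ := rdeStep G Z)
    (κ := 1 + η) (zero_lt_one.trans hγ) hβ (by positivity) hC hC hη'
    (fun s t x y a1 a2 a3 => (b2 s t x y (h0.trans a1) a2 (a3.trans h1)).trans (by
      gcongr
      exact (hs₁ s t (h0.trans a1) a2 (a3.trans h1) (by linarith)).le))
    (fun s u t x a1 a2 a3 a4 => b3 s u t x (h0.trans a1) a2 a3 (a4.trans h1))
    (fun s t x a1 a2 a3 => b1 s t x (h0.trans a1) a2 (a3.trans h1))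
    ((continuousOn_rdeStep hG hZ).mono fun q hq => ⟨h0.trans hq.1, hq.2.1, hq.2.2.trans h1⟩) x₀
  refine ⟨x, hx0, hxc, hx, fun t a1 a2 => ?_⟩
  have c1 := hx s₀ t le_rfl a1 a2
  rw [hx0] at c1
  have c2 := b1 s₀ t x₀ h0 a1 (a2.trans h1)
  have c3 := hs₂ s₀ t h0 a1 (a2.trans h1) (by linarith)
  have c4 := hs₃ s₀ t h0 a1 (a2.trans h1) (by linarith)
  calc ‖x t - x₀‖ ≤ _ := norm_sub_le_norm_sub_add_norm_sub _ (rdeStep G Z s₀ t x₀) _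
    _ < r := by linarith

/-- Uniqueness: the interval is covered by short ones, to which `eq_of_follow_almostFlow` applies. -/
theorem rde_path_unique (hω : IsControl T ω) (hp : 0 < p) (hp3 : p < 3) {G : E → V →L[ℝ] E}
    (hG : IsTestMap G) {Z : RoughPair V} (hZ : IsRoughPath p ω T Z) {S δ C : ℝ} (hS : S ≤ T)
    (hδ : 0 < δ) (hC : 0 ≤ C) {x y : ℝ → E} (hxc : ContinuousOn x (Set.Icc 0 S))
    (hyc : ContinuousOn y (Set.Icc 0 S))
    (hx : ∀ s t, 0 ≤ s → s ≤ t → t ≤ S → t - s ≤ δ →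
      ‖x t - rdeStep G Z s t (x s)‖ ≤ C * ω s t ^ (3 / p))
    (hy : ∀ s t, 0 ≤ s → s ≤ t → t ≤ S → t - s ≤ δ →
      ‖y t - rdeStep G Z s t (y s)‖ ≤ C * ω s t ^ (3 / p))
    (hxy : x 0 = y 0) {t : ℝ} (ht : 0 ≤ t) (htS : t ≤ S) : x t = y t := by
  obtain ⟨K, hK, -, b2, -, b4, b5⟩ := exists_rdeStep_bounds hω hp hG hZ
  have hγ : 1 < 3 / p := by rwa [one_lt_div hp]
  have hγ0 : 0 < 3 / p := zero_lt_one.trans hγ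
  obtain ⟨η, hη, hη'⟩ := exists_lipschitz_const hγ
  have hρ : (1 + (1 + η)) * (1 / 2 : ℝ) ^ (3 / p) < 1 := by
    refine lt_of_le_of_lt ?_ hη'
    gcongr
    nlinarith
  have hA : 0 ≤ (K + K * C * (1 + η)) / (1 - (1 + (1 + η)) * (1 / 2 : ℝ) ^ (3 / p)) :=
    div_nonneg (by positivity) (by linarith)
  obtain ⟨δ₁, hδ₁, hs₁⟩ := hω.exists_rpow_lt (one_div_pos.2 hp) hη hK
  obtain ⟨δ₂, hδ₂, hs₂⟩ := hω.exists_rpow_lt hγ0 one_pos hA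
  set ε := min δ (min δ₁ δ₂) / 2 with hε
  have hε0 : 0 < ε := by positivity
  have hεδ : ε < δ ∧ ε < δ₁ ∧ ε < δ₂ := by
    have : ε < min δ (min δ₁ δ₂) := half_lt_self (by positivity)
    rwa [lt_min_iff, lt_min_iff] at this
  have key : ∀ k : ℕ, ∀ t, 0 ≤ t → t ≤ S → t ≤ k * ε → x t = y t := by
    intro k
    induction k with
    | zero =>
      intro t h1 _ h2
      have : t = 0 := le_antisymm (by simpa using h2) h1
      rw [this, hxy]
    | succ k ih =>
      intro t h1 h2 h3
      rcases le_total t (k * ε) with h | h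
      · exact ih t h1 h2 h
      have hk0 : 0 ≤ k * ε := by positivity
      push_cast at h3
      have hd : t - k * ε ≤ ε := by linarith
      exact eq_of_follow_almostFlow hω hk0 (h2.trans hS) hγ0
        (κ := 1 + η) (C := K) (C' := C) (K := K) (by positivity) hK hC hK hρ
        (fun s t x y a1 a2 a3 => (b2 s t x y (hk0.trans a1) a2 (by linarith)).trans (by
          gcongr
          exact (hs₁ s t (hk0.trans a1) a2 (by linarith) (by linarith)).le))
        (fun s u t x y a1 a2 a3 a4 => b4 s u t x y (hk0.trans a1) a2 a3 (by linarith))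
        (fun s t x y r a1 a2 a3 => b5 s t x y r (hk0.trans a1) a2 (by linarith))
        (fun s t a1 a2 a3 => hx s t (hk0.trans a1) a2 (a3.trans h2) (by linarith))
        (fun s t a1 a2 a3 => hy s t (hk0.trans a1) a2 (a3.trans h2) (by linarith))
        (hxc.mono (Set.Icc_subset_Icc hk0 h2)) (hyc.mono (Set.Icc_subset_Icc hk0 h2))
        (ih _ hk0 (h.trans h2) le_rfl)
        (hs₂ _ t hk0 h (h2.trans hS) (by linarith)) h le_rfl
  obtain ⟨k, hk⟩ := exists_nat_ge (t / ε)
  exact key k t ht htS ((div_le_iff₀ hε0).1 hk)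

end FlatEquation

/-! ### Smooth extensions off the submanifold -/

section Extension

theorem exists_isTestMap_eqOn_ball {E F : Type*} [NormedAddCommGroup E] [InnerProductSpace ℝ E]
    [FiniteDimensional ℝ E] [NormedAddCommGroup F] [NormedSpace ℝ F] {f : E → F} {U : Set E}
    (hU : IsOpen U) {m : E} (hm : m ∈ U) (hf : ContDiffOn ℝ (⊤ : ℕ∞) f U) :
    ∃ r > 0, Metric.ball m r ⊆ U ∧ ∃ g : E → F, IsTestMap g ∧ ∀ x ∈ Metric.ball m r, g x = f x := by
  obtain ⟨R, hR, hRU⟩ := Metric.nhds_basis_closedBall.mem_iff.1 (hU.mem_nhds hm)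
  let χ : ContDiffBump m := ⟨R / 2, R, by positivity, by linarith⟩
  refine ⟨R / 2, by positivity, (Metric.ball_subset_closedBall.trans
    (Metric.closedBall_subset_closedBall (by linarith))).trans hRU, fun x => χ x • f x,
    ⟨contDiff_iff_contDiffAt.2 fun x => ?_, ?_⟩, fun x hx => ?_⟩
  · by_cases hx : x ∈ tsupport χ
    · rw [χ.tsupport_eq] at hx
      exact χ.contDiffAt.smul (hf.contDiffAt (hU.mem_nhds (hRU hx)))
    · refine (contDiffAt_const (c := (0 : F))).congr_of_eventuallyEq ?_
      filter_upwards [(isClosed_tsupport χ).isOpen_compl.mem_nhds hx] with y hy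
      rw [image_eq_zero_of_notMem_tsupport hy, zero_smul]
  · exact χ.hasCompactSupport.smul_right
  · simp only [χ.one_of_mem_closedBall (Metric.ball_subset_closedBall hx), one_smul]

theorem exists_isTestMap_eqOn_ball_zero {E F : Type*} [NormedAddCommGroup E]
    [InnerProductSpace ℝ E] [FiniteDimensional ℝ E] [NormedAddCommGroup F] [NormedSpace ℝ F]
    {f : E → F} (hf : ContDiff ℝ (⊤ : ℕ∞) f) {R : ℝ} (hR : 0 < R) :
    ∃ g : E → F, IsTestMap g ∧ ∀ x ∈ Metric.ball 0 R, g x = f x := by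
  let χ : ContDiffBump (0 : E) := ⟨R, R + 1, hR, by linarith⟩
  refine ⟨fun x => χ x • f x, ⟨χ.contDiff.smul hf, χ.hasCompactSupport.smul_right⟩,
    fun x hx => ?_⟩
  simp only [χ.one_of_mem_closedBall (Metric.ball_subset_closedBall hx), one_smul]

/-- A function on a closed set which extends smoothly near each point extends smoothly. -/
theorem exists_contDiff_eqOn_of_local {E F : Type*} [NormedAddCommGroup E] [NormedSpace ℝ E]
    [FiniteDimensional ℝ E] [NormedAddCommGroup F] [NormedSpace ℝ F] {C : Set E}
    (hC : IsClosed C) {f : E → F}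
    (h : ∀ x ∈ C, ∃ (U : Set E) (g : E → F), IsOpen U ∧ x ∈ U ∧ ContDiffOn ℝ (⊤ : ℕ∞) g U ∧
      ∀ y ∈ C, y ∈ U → g y = f y) :
    ∃ g : E → F, ContDiff ℝ (⊤ : ℕ∞) g ∧ ∀ y ∈ C, g y = f y := by
  have hconv : ∀ x, Convex ℝ {A : F | x ∈ C → A = f x} := by
    intro x
    by_cases hx : x ∈ C
    · simp only [hx, true_imp_iff, Set.ofPred_eq_eq_singleton]
      exact convex_singleton _
    · simp only [hx, false_imp_iff, Set.ofPred_true]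
      exact convex_univ
  obtain ⟨g, hg⟩ := exists_contMDiffMap_forall_mem_convex_of_local (n := (⊤ : ℕ∞))
    (modelWithCornersSelf ℝ E) hconv fun x => by
      by_cases hx : x ∈ C
      · obtain ⟨U, g, hU, hxU, hg, hgf⟩ := h x hx
        exact ⟨U, hU.mem_nhds hxU, g, hg.contMDiffOn, fun y hy hyM => hgf y hyM hy⟩
      · exact ⟨Cᶜ, hC.isOpen_compl.mem_nhds hx, fun _ => 0, contMDiffOn_const,
          fun y hy hyM => absurd hyM hy⟩
  exact ⟨g, g.contMDiff.contDiff, hg⟩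

variable {N n d : ℕ} {M : Set (Euc N)}

/-- By the implicit function theorem, each tangent vector is the velocity of a curve in `M`. -/
theorem exists_curve {m v : Euc N} (hm : m ∈ M) (hM : IsEmbeddedSubmanifold d M)
    (hv : v ∈ tangentPlane d M m) :
    ∃ σ : ℝ → M, (σ 0 : Euc N) = m ∧ HasDerivAt (fun t => (σ t : Euc N)) v 0 := by
  obtain ⟨U, F, hU, hF⟩ := hM.exists_defining m hm
  rw [tangentPlane_eq_ker hm hU hF] at hv
  have hs : HasStrictFDerivAt F (fderiv ℝ F m) m :=
    (hF.smooth.contDiffAt (hF.isOpen.mem_nhds hU)).hasStrictFDerivAt (by simp)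
  have hr : (fderiv ℝ F m).range = ⊤ := LinearMap.range_eq_top.2 (hF.surjective m hU)
  have hzero : ∀ x ∈ U, (x ∈ M ↔ F x = 0) := by
    intro x hx
    have := Set.ext_iff.1 hF.zeroSet x
    simpa [hx] using this
  have hFm : F m = 0 := (hzero m hU).1 hm
  set φ : (fderiv ℝ F m).ker → Euc N := hs.implicitFunction F (fderiv ℝ F m) hr (F m) with hφ
  have hφ0 : φ 0 = m := hs.implicitFunction_apply_image hr
  have hφd : HasFDerivAt φ (fderiv ℝ F m).ker.subtypeL 0 :=
    (hs.to_implicitFunction hr).hasFDerivAt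
  have hφc : Tendsto φ (𝓝 0) (𝓝 m) := by
    have := hφd.continuousAt.tendsto
    rwa [hφ0] at this
  have h1 : ∀ᶠ w in 𝓝 (0 : (fderiv ℝ F m).ker), φ w ∈ M := by
    have h := hs.map_implicitFunction_eq hr
    have hc : Tendsto (fun w : (fderiv ℝ F m).ker => (F m, w)) (𝓝 0) (𝓝 (F m, 0)) :=
      tendsto_const_nhds.prodMk_nhds tendsto_id
    filter_upwards [hc.eventually h, hφc.eventually (hF.isOpen.mem_nhds hU)] with w hw hwU
    rw [hzero _ hwU, ← hFm]
    exact hw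
  set c : ℝ → (fderiv ℝ F m).ker := fun t => t • ⟨v, hv⟩ with hc
  have hc0 : c 0 = 0 := by simp [hc]
  have hcd : HasDerivAt c ⟨v, hv⟩ 0 := by
    simpa [hc] using (hasDerivAt_id (0 : ℝ)).smul_const (⟨v, hv⟩ : (fderiv ℝ F m).ker)
  have hd : HasDerivAt (fun t => φ (c t)) v 0 := by
    rw [← hc0] at hφd
    exact hφd.comp_hasDerivAt (0 : ℝ) hcd
  have hev : ∀ᶠ t in 𝓝 (0 : ℝ), φ (c t) ∈ M := by
    have : Tendsto c (𝓝 0) (𝓝 0) := by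
      have := hcd.continuousAt.tendsto
      rwa [hc0] at this
    exact this.eventually h1
  classical
  refine ⟨fun t => if h : φ (c t) ∈ M then ⟨φ (c t), h⟩ else ⟨m, hm⟩, ?_, ?_⟩
  · simp [hc0, hφ0, hm]
  · refine hd.congr_of_eventuallyEq ?_
    filter_upwards [hev] with t ht
    simp [ht]

/-- The derivative of a function vanishing on `M` vanishes in the directions tangent to `M`. -/
theorem fderiv_apply_eq_zero_of_eqOn {W : Type*} [NormedAddCommGroup W] [NormedSpace ℝ W]
    (hM : IsEmbeddedSubmanifold d M) {m v : Euc N} (hm : m ∈ M) (hv : v ∈ tangentPlane d M m)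
    {H : Euc N → W} (hH : DifferentiableAt ℝ H m) {O : Set (Euc N)} (hO : IsOpen O) (hmO : m ∈ O)
    (h0 : ∀ x ∈ M, x ∈ O → H x = 0) : fderiv ℝ H m v = 0 := by
  obtain ⟨σ, hσ0, hσ⟩ := exists_curve hm hM hv
  have h1 : HasDerivAt (fun t => H (σ t)) (fderiv ℝ H m v) 0 := by
    rw [← hσ0] at hH ⊢
    exact hH.hasFDerivAt.comp_hasDerivAt (0 : ℝ) hσ
  have h2 : (fun t => H (σ t)) =ᶠ[𝓝 0] fun _ => (0 : W) := by
    have : Tendsto (fun t => (σ t : Euc N)) (𝓝 0) (𝓝 m) := by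
      have := hσ.continuousAt.tendsto
      rwa [hσ0] at this
    filter_upwards [this.eventually (hO.mem_nhds hmO)] with t ht
    exact h0 _ (σ t).2 ht
  exact h1.unique ((hasDerivAt_const (0 : ℝ) (0 : W)).congr_of_eventuallyEq h2)

theorem coeff_apply_mem_tangentPlane (Y : Euc n →ₗ[ℝ] vectorFields d M) {m : Euc N} (hm : m ∈ M)
    (a : Euc n) : coeff Y m a ∈ tangentPlane d M m := by
  rw [coeff_apply Y ⟨m, hm⟩ a]
  exact (Y a).2.2 ⟨m, hm⟩

/-- The derivative `∂_{Y_a} Y_b` can be computed from any local extension of `Y`. -/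
theorem fieldDeriv_eq_fderiv (hM : IsEmbeddedSubmanifold d M)
    (Y : Euc n →ₗ[ℝ] vectorFields d M) {m : Euc N} (hm : m ∈ M) {G : Euc N → Euc n →L[ℝ] Euc N}
    (hG : DifferentiableAt ℝ G m) {O : Set (Euc N)} (hO : IsOpen O) (hmO : m ∈ O)
    (h : ∀ x ∈ M, x ∈ O → G x = coeff Y x) (a b : Euc n) :
    fieldDeriv Y m a b = fderiv ℝ G m (G m a) b := by
  rw [h m hm hmO]
  obtain ⟨σ, hσ0, hσ⟩ := exists_curve hm hM (coeff_apply_mem_tangentPlane Y hm a)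
  have hσ' : σ 0 = ⟨m, hm⟩ := Subtype.ext hσ0
  have h1 : HasDerivAt (fun t => G (σ t) b) (fderiv ℝ G m (coeff Y m a) b) 0 := by
    have h2 : HasDerivAt (fun t => G (σ t)) (fderiv ℝ G m (coeff Y m a)) 0 := by
      have hG' := hG.hasFDerivAt
      rw [← hσ0] at hG'
      have := hG'.comp_hasDerivAt (0 : ℝ) hσ
      rwa [hσ0] at this
    simpa using h2.clm_apply (hasDerivAt_const (0 : ℝ) b)
  have h2 := hasDerivAt_curve Y a b σ (by rwa [← coeff_apply, hσ0])
  rw [hσ0] at h2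
  have h3 : (fun t => (Y b : M → Euc N) (σ t)) =ᶠ[𝓝 0] fun t => G (σ t) b := by
    have : Tendsto (fun t => (σ t : Euc N)) (𝓝 0) (𝓝 m) := by
      have := hσ.continuousAt.tendsto
      rwa [hσ0] at this
    filter_upwards [this.eventually (hO.mem_nhds hmO)] with t ht
    rw [h _ (σ t).2 ht, coeff_apply]
  exact h2.unique (h1.congr_of_eventuallyEq h3)

theorem exists_local_extension (Y : Euc n →ₗ[ℝ] vectorFields d M) {m : Euc N} (hm : m ∈ M) :
    ∃ (U : Set (Euc N)) (g : Euc N → Euc n →L[ℝ] Euc N), IsOpen U ∧ m ∈ U ∧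
      ContDiffOn ℝ (⊤ : ℕ∞) g U ∧ ∀ x ∈ M, x ∈ U → g x = coeff Y x := by
  have h := fun i : Fin n => (Y (EuclideanSpace.basisFun (Fin n) ℝ i)).2.1 ⟨m, hm⟩
  choose U g hU hmU hg hgY using h
  refine ⟨⋂ i, U i, fun x => ∑ i, (EuclideanSpace.proj i : Euc n →L[ℝ] ℝ).smulRight (g i x),
    isOpen_iInter_of_finite hU, Set.mem_iInter.2 hmU, ?_, ?_⟩
  · refine ContDiffOn.sum fun i _ => ?_
    have h1 : ContDiff ℝ (⊤ : ℕ∞) fun y : Euc N =>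
        (EuclideanSpace.proj i : Euc n →L[ℝ] ℝ).smulRight y :=
      (ContinuousLinearMap.smulRightL ℝ (Euc n) (Euc N)
        (EuclideanSpace.proj i : Euc n →L[ℝ] ℝ)).contDiff
    exact h1.comp_contDiffOn ((hg i).mono (Set.iInter_subset U i))
  · intro x hxM hxU
    ext1 a
    have ha : a = ∑ i, a i • EuclideanSpace.basisFun (Fin n) ℝ i := by
      conv_lhs => rw [← (EuclideanSpace.basisFun (Fin n) ℝ).sum_repr a]
      simp
    conv_rhs => rw [ha, map_sum]
    rw [sum_apply]
    refine Finset.sum_congr rfl fun i _ => ?_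
    rw [map_smul, coeff_apply Y ⟨x, hxM⟩, ← hgY i ⟨x, hxM⟩ (Set.mem_iInter.1 hxU i)]
    simp

/-- `M` is locally closed. -/
theorem exists_isClosed_inter_closedBall (hM : IsEmbeddedSubmanifold d M) {m : Euc N}
    (hm : m ∈ M) : ∃ r > 0, IsClosed (M ∩ Metric.closedBall m r) := by
  obtain ⟨U, F, hU, hF⟩ := hM.exists_defining m hm
  obtain ⟨r, hr, hrU⟩ := Metric.nhds_basis_closedBall.mem_iff.1 (hF.isOpen.mem_nhds hU)
  refine ⟨r, hr, ?_⟩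
  have : M ∩ Metric.closedBall m r = Metric.closedBall m r ∩ F ⁻¹' {0} := by
    ext x
    have := Set.ext_iff.1 hF.zeroSet x
    constructor
    · rintro ⟨h1, h2⟩
      exact ⟨h2, (this.1 ⟨hrU h2, h1⟩).2⟩
    · rintro ⟨h1, h2⟩
      exact ⟨(this.2 ⟨hrU h1, h2⟩).2, h1⟩
  rw [this]
  exact (hF.smooth.continuousOn.mono hrU).preimage_isClosed_of_isClosed Metric.isClosed_closedBall
    isClosed_singleton

/-- Near a compact subset of `M` the vector fields extend to a test map on `ℝ^N`. -/
theorem exists_extension_of_isCompact (hM : IsEmbeddedSubmanifold d M)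
    (Y : Euc n →ₗ[ℝ] vectorFields d M) {K : Set (Euc N)} (hK : IsCompact K) (hKM : K ⊆ M) :
    ∃ (G : Euc N → Euc n →L[ℝ] Euc N) (O : Set (Euc N)), IsTestMap G ∧ IsOpen O ∧ K ⊆ O ∧
      ∀ x ∈ M, x ∈ O → G x = coeff Y x := by
  have h := fun m : Euc N => fun hm : m ∈ M => exists_isClosed_inter_closedBall hM hm
  choose! r hr hcl using h
  obtain ⟨t, htK, ht⟩ := hK.elim_nhds_subcover (fun m => Metric.ball m (r m))
    fun m hm => Metric.ball_mem_nhds m (hr m (hKM hm))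
  -- `M` is closed in `L`, a neighbourhood of `K`
  set L : Set (Euc N) := ⋃ m ∈ t, Metric.closedBall m (r m) with hL
  have hML : IsClosed (M ∩ L) := by
    rw [hL, Set.inter_iUnion₂]
    exact t.finite_toSet.isClosed_biUnion fun m hm => hcl m (hKM (htK m hm))
  obtain ⟨G₀, hG₀s, hG₀⟩ := exists_contDiff_eqOn_of_local hML (f := coeff Y) fun x hx => by
    obtain ⟨U, g, hU, hxU, hg, hgY⟩ := exists_local_extension Y hx.1
    exact ⟨U, g, hU, hxU, hg, fun y hy => hgY y hy.1⟩
  obtain ⟨R, hR⟩ := hK.isBounded.subset_ball_lt 0 0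
  obtain ⟨G, hG, hGG⟩ := exists_isTestMap_eqOn_ball_zero hG₀s hR.1
  refine ⟨G, (⋃ m ∈ t, Metric.ball m (r m)) ∩ Metric.ball 0 R, hG,
    (isOpen_biUnion fun m _ => Metric.isOpen_ball).inter Metric.isOpen_ball,
    fun x hx => ⟨ht hx, hR.2 hx⟩, fun x hxM hx => ?_⟩
  rw [hGG x hx.2]
  refine hG₀ x ⟨hxM, ?_⟩
  obtain ⟨m, hm, hxm⟩ := Set.mem_iUnion₂.1 hx.1
  exact Set.mem_iUnion₂.2 ⟨m, hm, Metric.ball_subset_closedBall hxm⟩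

/-- Near a point of `M` the vector fields extend so as to be tangent to all level sets of a
defining function: with `R` a right inverse of `F'(m)`, the projection
`1 - R (F'(x) R)⁻¹ F'(x)` onto the null space of `F'(x)` is applied to some extension. -/
theorem exists_tangent_extension (hM : IsEmbeddedSubmanifold d M)
    (Y : Euc n →ₗ[ℝ] vectorFields d M) {m : Euc N} (hm : m ∈ M) :
    ∃ r > 0, ∃ (G : Euc N → Euc n →L[ℝ] Euc N) (F : Euc N → Euc (N - d)), IsTestMap G ∧
      IsTestMap F ∧ ∀ x ∈ Metric.ball m r, (x ∈ M → G x = coeff Y x) ∧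
        (∀ a, fderiv ℝ F x (G x a) = 0) ∧ (x ∈ M ↔ F x = 0) := by
  obtain ⟨U, F, hU, hF⟩ := hM.exists_defining m hm
  obtain ⟨U', g, hU', hmU', hg, hgY⟩ := exists_local_extension Y hm
  obtain ⟨R₀, hR₀⟩ := (fderiv ℝ F m).toLinearMap.exists_rightInverse_of_surjective
    (LinearMap.range_eq_top.2 (hF.surjective m hU))
  set R : Euc (N - d) →L[ℝ] Euc N := LinearMap.toContinuousLinearMap R₀ with hR
  have hdF : ContDiffOn ℝ (⊤ : ℕ∞) (fderiv ℝ F) U :=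
    hF.smooth.fderiv_of_isOpen hF.isOpen (by simp)
  set A : Euc N → Euc (N - d) →L[ℝ] Euc (N - d) := fun x => (fderiv ℝ F x).comp R with hA
  have hAs : ContDiffOn ℝ (⊤ : ℕ∞) A U := hdF.clm_comp contDiffOn_const
  have hAm : A m = 1 := by
    ext1 v
    exact LinearMap.congr_fun hR₀ v
  set O : Set (Euc N) := (U ∩ A ⁻¹' {B | IsUnit B}) ∩ U' with hO
  have hOo : IsOpen O :=
    (hAs.continuousOn.isOpen_inter_preimage hF.isOpen Units.isOpen).inter hU'
  have hmO : m ∈ O := ⟨⟨hU, by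
    change IsUnit (A m)
    rw [hAm]
    exact isUnit_one⟩, hmU'⟩
  set G₀ : Euc N → Euc n →L[ℝ] Euc N := fun x => g x -
    R.comp ((Ring.inverse (A x)).comp ((fderiv ℝ F x).comp (g x))) with hG₀
  have hG₀s : ContDiffOn ℝ (⊤ : ℕ∞) G₀ O := by
    have h1 : ContDiffOn ℝ (⊤ : ℕ∞) (fun x => Ring.inverse (A x)) O := fun x hx => by
      obtain ⟨u, hu⟩ := hx.1.2
      have h2 : ContDiffAt ℝ (⊤ : ℕ∞) Ring.inverse (A x) := by
        rw [← hu]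
        exact contDiffAt_ringInverse ℝ u
      exact h2.comp_contDiffWithinAt x ((hAs x hx.1.1).mono fun y hy => hy.1.1)
    have hgO : ContDiffOn ℝ (⊤ : ℕ∞) g O := hg.mono fun y hy => hy.2
    exact hgO.sub (contDiffOn_const.clm_comp
      (h1.clm_comp ((hdF.mono fun y hy => hy.1.1).clm_comp hgO)))
  obtain ⟨r₁, hr₁, hrO, G, hG, hGG⟩ := exists_isTestMap_eqOn_ball hOo hmO hG₀s
  obtain ⟨r₂, hr₂, -, F₁, hF₁, hFF⟩ := exists_isTestMap_eqOn_ball hOo hmO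
    (hF.smooth.mono fun y hy => hy.1.1)
  refine ⟨min r₁ r₂, lt_min hr₁ hr₂, G, F₁, hG, hF₁, fun x hx => ?_⟩
  have hx₁ := Metric.ball_subset_ball (min_le_left _ _) hx
  have hx₂ := Metric.ball_subset_ball (min_le_right _ _) hx
  have hxO := hrO hx₁
  have hfd : fderiv ℝ F₁ x = fderiv ℝ F x := by
    refine Filter.EventuallyEq.fderiv_eq ?_
    filter_upwards [Metric.isOpen_ball.mem_nhds hx₂] with y hy using hFF y hy
  have hz := Set.ext_iff.1 hF.zeroSet x
  refine ⟨fun hxM => ?_, fun a => ?_, ?_⟩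
  · have h1 : (fderiv ℝ F x).comp (g x) = 0 := by
      ext1 a
      have := coeff_apply_mem_tangentPlane Y hxM a
      rw [tangentPlane_eq_ker hxM hxO.1.1 hF] at this
      rw [hgY x hxM hxO.2]
      exact this
    rw [hGG x hx₁, hG₀]
    simp only [h1, ContinuousLinearMap.comp_zero, sub_zero]
    exact hgY x hxM hxO.2
  · rw [hGG x hx₁, hfd]
    have h1 : A x * Ring.inverse (A x) = 1 := Ring.mul_inverse_cancel _ hxO.1.2
    have h2 := DFunLike.congr_fun h1 (fderiv ℝ F x (g x a))
    simp only [hG₀, sub_apply, map_sub, ContinuousLinearMap.comp_apply]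
    rw [sub_eq_zero]
    exact h2.symm
  · rw [hFF x hx₂]
    constructor
    · exact fun h => (hz.1 ⟨hxO.1.1, h⟩).2
    · exact fun h => (hz.2 ⟨hxO.1.1, h⟩).2

end Extension

/-! ### The equation for the trace -/

section TracePath

variable {N n d : ℕ} {M : Set (Euc N)} {T p : ℝ} {ω : ℝ → ℝ → ℝ}

/-- The first level of the equation on the interval `[s₀, s₁]`: a continuous path in `M` whose
increments have the second order expansion that the equation prescribes. -/
structure IsTracePath (p : ℝ) (ω : ℝ → ℝ → ℝ) (Y : Euc n →ₗ[ℝ] vectorFields d M)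
    (Z : RoughPair (Euc n)) (s₀ s₁ : ℝ) (x : ℝ → Euc N) : Prop where
  continuousOn : ContinuousOn x (Set.Icc s₀ s₁)
  mem : ∀ t, s₀ ≤ t → t ≤ s₁ → x t ∈ M
  approx : ∃ δ > 0, ∃ C, 0 ≤ C ∧ ∀ s t, s₀ ≤ s → s ≤ t → t ≤ s₁ → t - s ≤ δ →
    ‖x t - x s - (coeff Y (x s) (Z.incr s t) +
      evalTensor (fieldDeriv Y (x s)) (Z.second s t))‖ ≤ C * ω s t ^ (3 / p)

theorem secondCoeff_eq_evalTensor_fieldDeriv (hM : IsEmbeddedSubmanifold d M)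
    (Y : Euc n →ₗ[ℝ] vectorFields d M) {m : Euc N} (hm : m ∈ M) {G : Euc N → Euc n →L[ℝ] Euc N}
    (hG : DifferentiableAt ℝ G m) {O : Set (Euc N)} (hO : IsOpen O) (hmO : m ∈ O)
    (h : ∀ x ∈ M, x ∈ O → G x = coeff Y x) (A : Euc n ⊗[ℝ] Euc n) :
    secondCoeff G m A = evalTensor (fieldDeriv Y m) A := by
  have : ((fderiv ℝ G m).comp (G m)).toLinearMap₁₂ = fieldDeriv Y m :=
    LinearMap.ext₂ fun a b => by
      rw [fieldDeriv_eq_fderiv hM Y hm hG hO hmO h]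
      rfl
  rw [secondCoeff, evalTensorL_apply, this]

theorem sub_sub_eq_sub_rdeStep (hM : IsEmbeddedSubmanifold d M)
    (Y : Euc n →ₗ[ℝ] vectorFields d M) {m : Euc N} (hm : m ∈ M) {G : Euc N → Euc n →L[ℝ] Euc N}
    (hG : IsTestMap G) {O : Set (Euc N)} (hO : IsOpen O) (hmO : m ∈ O)
    (h : ∀ x ∈ M, x ∈ O → G x = coeff Y x) (Z : RoughPair (Euc n)) (s t : ℝ) (y : Euc N) :
    y - m - (coeff Y m (Z.incr s t) + evalTensor (fieldDeriv Y m) (Z.second s t)) =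
      y - rdeStep G Z s t m := by
  rw [← secondCoeff_eq_evalTensor_fieldDeriv hM Y hm (hG.differentiable m) hO hmO h,
    ← h m hm hmO, rdeStep, step, stepIncr]
  abel

theorem IsTracePath.exists_rdeStep {Y : Euc n →ₗ[ℝ] vectorFields d M} {Z : RoughPair (Euc n)}
    (hM : IsEmbeddedSubmanifold d M) {s₀ s₁ : ℝ} {x : ℝ → Euc N}
    (hx : IsTracePath p ω Y Z s₀ s₁ x) {G : Euc N → Euc n →L[ℝ] Euc N} (hG : IsTestMap G)
    {O : Set (Euc N)} (hO : IsOpen O) (hGY : ∀ x ∈ M, x ∈ O → G x = coeff Y x)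
    (hxO : ∀ t, s₀ ≤ t → t ≤ s₁ → x t ∈ O) :
    ∃ δ > 0, ∃ C, 0 ≤ C ∧ ∀ s t, s₀ ≤ s → s ≤ t → t ≤ s₁ → t - s ≤ δ →
      ‖x t - rdeStep G Z s t (x s)‖ ≤ C * ω s t ^ (3 / p) := by
  obtain ⟨δ, hδ, C, hC, hb⟩ := hx.approx
  refine ⟨δ, hδ, C, hC, fun s t h1 h2 h3 h4 => ?_⟩
  rw [← sub_sub_eq_sub_rdeStep hM Y (hx.mem s h1 (h2.trans h3)) hG hO (hxO s h1 (h2.trans h3)) hGY]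
  exact hb s t h1 h2 h3 h4

/-- Along a field tangent to the level sets of `F` the second order terms in the expansion of `F`
cancel. -/
theorem fderiv_secondCoeff_add_eq_zero {V E W : Type*} [NormedAddCommGroup V]
    [InnerProductSpace ℝ V] [FiniteDimensional ℝ V] [NormedAddCommGroup E] [NormedSpace ℝ E]
    [FiniteDimensional ℝ E] [NormedAddCommGroup W] [NormedSpace ℝ W] [FiniteDimensional ℝ W]
    {G : E → V →L[ℝ] E} {F : E → W} (hG : IsTestMap G) (hF : IsTestMap F) {x : E}
    (hx : ∀ᶠ y in 𝓝 x, ∀ a, fderiv ℝ F y (G y a) = 0) {A : V ⊗[ℝ] V} {a : V}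
    (hA : symPart A = (1 / 2 : ℝ) • (a ⊗ₜ[ℝ] a)) :
    fderiv ℝ F x (secondCoeff G x A) +
      (1 / 2 : ℝ) • fderiv ℝ (fderiv ℝ F) x (G x a) (G x a) = 0 := by
  set B : V →L[ℝ] V →L[ℝ] W := (fderiv ℝ (fderiv ℝ F) x).bilinearComp (G x) (G x) with hB
  have hsymm : ∀ a b, B a b = B b a := fun a b => hF.fderiv_fderiv_symm x _ _
  have h1 : ∀ a b, fderiv ℝ F x (fderiv ℝ G x (G x a) b) = - B a b := by
    intro a b
    have hd : HasFDerivAt (fun y => fderiv ℝ F y (G y b))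
        ((fderiv ℝ F x).comp ((fderiv ℝ G x).flip b) +
          (fderiv ℝ (fderiv ℝ F) x).flip (G x b)) x := by
      have h2 : HasFDerivAt (fun y => G y b) ((fderiv ℝ G x).flip b) x := by
        simpa using (hG.hasFDerivAt x).clm_apply (hasFDerivAt_const b x)
      exact (hF.fderiv.hasFDerivAt x).clm_apply h2
    have hz : HasFDerivAt (fun y => fderiv ℝ F y (G y b)) (0 : E →L[ℝ] W) x :=
      (hasFDerivAt_const (0 : W) x).congr_of_eventuallyEq (hx.mono fun y hy => hy b)
    have := DFunLike.congr_fun (hd.unique hz) (G x a)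
    exact eq_neg_of_add_eq_zero_left this
  have h2 : ∀ A : V ⊗[ℝ] V, fderiv ℝ F x (secondCoeff G x A) = - evalTensorL B A := by
    intro A
    induction A using TensorProduct.induction_on with
    | zero => simp
    | tmul a b => rw [secondCoeff_tmul, h1, evalTensorL_tmul]
    | add a b ha hb => rw [map_add, map_add, map_add, ha, hb, neg_add]
  rw [h2, evalTensorL_of_symm hsymm hA]
  exact neg_add_cancel _

/-- A function constant along the directions of `G` is constant along solutions. -/
theorem eq_of_fderiv_comp_eq_zero {V E W : Type*} [NormedAddCommGroup V]
    [InnerProductSpace ℝ V] [FiniteDimensional ℝ V] [NormedAddCommGroup E] [NormedSpace ℝ E]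
    [FiniteDimensional ℝ E] [NormedAddCommGroup W] [NormedSpace ℝ W] [FiniteDimensional ℝ W]
    (hω : IsControl T ω) (hp : 0 < p) (hp3 : p < 3)
    {G : E → V →L[ℝ] E} {F : E → W} (hG : IsTestMap G) (hF : IsTestMap F) {O : Set E}
    (hO : IsOpen O) (hFG : ∀ y ∈ O, ∀ a, fderiv ℝ F y (G y a) = 0) {Z : RoughPair V}
    (hZ : IsWeaklyGeometric p ω T Z) {s₀ s₁ : ℝ} (hs₀ : 0 ≤ s₀) (hs₁ : s₁ ≤ T) {x : ℝ → E}
    {C : ℝ} (hx : ∀ s t, s₀ ≤ s → s ≤ t → t ≤ s₁ →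
      ‖x t - rdeStep G Z s t (x s)‖ ≤ C * ω s t ^ (3 / p))
    (hxO : ∀ t, s₀ ≤ t → t ≤ s₁ → x t ∈ O) {t : ℝ} (ht : s₀ ≤ t) (ht' : t ≤ s₁) :
    F (x t) = F (x s₀) := by
  set D : Set (ℝ × ℝ) := {q | s₀ ≤ q.1 ∧ q.1 ≤ q.2 ∧ q.2 ≤ s₁} with hD
  set lam : ℝ × ℝ → ℝ := fun q => ω q.1 q.2 ^ (1 / p) with hlam
  have hl : lam =O[𝓟 D] fun _ => (1 : ℝ) :=
    isBigO_control_rpow hω hp (a := fun q : ℝ × ℝ => q.1) (b := fun q => q.2)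
      fun i hi => ⟨hs₀.trans hi.1, hi.2.1, hi.2.2.trans hs₁⟩
  have hn : ∀ q ∈ D, 0 ≤ ω q.1 q.2 := fun q hq =>
    hω.nonneg (hs₀.trans hq.1) hq.2.1 (hq.2.2.trans hs₁)
  obtain ⟨hz, hzz⟩ := isBigO_incr hω hZ.isRoughPath (D := D) (a := fun q : ℝ × ℝ => q.1)
    (b := fun q => q.2) (w := lam)
    fun i hi => ⟨hs₀.trans hi.1, hi.2.1, hi.2.2.trans hs₁, le_rfl⟩
  set u : ℝ × ℝ → E := fun q => x q.1 with hu
  set ρ : ℝ × ℝ → E := fun q => x q.2 - rdeStep G Z q.1 q.2 (x q.1) with hρ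
  set g : ℝ × ℝ → E := fun q => G (u q) (Z.incr q.1 q.2) with hg
  set k : ℝ × ℝ → E := fun q => secondCoeff G (u q) (Z.second q.1 q.2) + ρ q with hk
  set h : ℝ × ℝ → E := fun q => x q.2 - x q.1 with hh
  have hhgk : ∀ q, h q = g q + k q := fun q => by
    simp only [hh, hg, hk, hρ, hu, rdeStep, step, stepIncr]
    abel
  have hρO : ρ =O[𝓟 D] fun q => lam q ^ 3 := by
    refine isBigO_principal.2 ⟨C, fun q hq => ?_⟩
    have h3 := rpow_one_div_pow (p := p) (hn q hq) 3
    have hn' := hn q hq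
    rw [Real.norm_of_nonneg (by positivity), hlam, h3]
    exact hx q.1 q.2 hq.1 hq.2.1 hq.2.2
  have hl3 : (fun q => lam q ^ 3) =O[𝓟 D] fun q => lam q ^ 2 :=
    ((isBigO_refl (fun q => lam q ^ 2) _).mul hl).congr (fun q => by ring) fun q => by ring
  have hgO : g =O[𝓟 D] lam := by
    simpa using isBigO_clm_apply (hG.isBigO_one (l := 𝓟 D) u) hz
  have hkO : k =O[𝓟 D] fun q => lam q ^ 2 := by
    refine IsBigO.add ?_ (hρO.trans hl3)
    simpa using isBigO_clm_apply (hG.secondCoeff.isBigO_one (l := 𝓟 D) u) hzz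
  have hhO : h =O[𝓟 D] lam :=
    (hgO.add (hkO.trans (isBigO_sq_of_isBigO_one hl))).congr_left fun q => (hhgk q).symm
  have t1 := (hF.isBigO_taylor_two (l := 𝓟 D) u h).trans (hhO.norm_left.pow 3)
  have t2 := isBigO_clm_apply (hF.fderiv.isBigO_one (l := 𝓟 D) u) hρO
  have t3 := isBigO_clm_apply
    (isBigO_clm_apply (hF.fderiv.fderiv.isBigO_one (l := 𝓟 D) u) hgO) hkO
  have t4 := isBigO_clm_apply
    (isBigO_clm_apply (hF.fderiv.fderiv.isBigO_one (l := 𝓟 D) u) hkO) hhO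
  have e2 : (fun q => 1 * lam q ^ 3) = fun q => lam q ^ 3 := by ext; ring
  have e3 : (fun q => 1 * lam q * lam q ^ 2) = fun q => lam q ^ 3 := by ext; ring
  have e4 : (fun q => 1 * lam q ^ 2 * lam q) = fun q => lam q ^ 3 := by ext; ring
  rw [e2] at t2
  rw [e3] at t3
  rw [e4] at t4
  have hsum : (fun q : ℝ × ℝ => F (x q.2) - F (x q.1)) =O[𝓟 D] fun q => lam q ^ 3 := by
    refine ((t1.add t2).add ((t3.add t4).const_smul_left (1 / 2 : ℝ))).congr' ?_ EventuallyEq.rfl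
    rw [EventuallyEq, eventually_principal]
    intro q hq
    have hq1 : u q ∈ O := hxO _ hq.1 (hq.2.1.trans hq.2.2)
    have c1 := fderiv_secondCoeff_add_eq_zero hG hF
      (x := u q) ((hO.eventually_mem hq1).mono fun y hy => hFG y hy)
      (hZ.sym q.1 q.2 (hs₀.trans hq.1) hq.2.1 (hq.2.2.trans hs₁))
    have c2 : fderiv ℝ F (u q) (g q) = 0 := hFG _ hq1 _
    have c3 : u q + h q = x q.2 := by simp [hu, hh]
    have c4 : fderiv ℝ F (u q) (h q) =
        fderiv ℝ F (u q) (secondCoeff G (u q) (Z.second q.1 q.2)) + fderiv ℝ F (u q) (ρ q) := by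
      rw [hhgk, map_add, c2, zero_add, hk, map_add]
    have c5 : fderiv ℝ (fderiv ℝ F) (u q) (h q) (h q) =
        fderiv ℝ (fderiv ℝ F) (u q) (g q) (g q) + (fderiv ℝ (fderiv ℝ F) (u q) (g q) (k q) +
        fderiv ℝ (fderiv ℝ F) (u q) (k q) (h q)) := by
      simp only [hhgk q, map_add, add_apply]
      abel
    have c6 := eq_neg_of_add_eq_zero_left c1
    simp only [c3, c4, c5, c6, smul_add, Pi.smul_apply]
    simp only [hu, hg]
    abel
  obtain ⟨C', -, hC'⟩ := isBigO_principal_nonneg hsum fun q hq => by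
    have := hn q hq
    positivity
  refine eq_of_norm_sub_le_rpow hω (γ := 3 / p) (by rwa [one_lt_div hp]) hs₀ hs₁
    (f := fun t => F (x t)) (C := C') (fun s t h1 h2 h3 => ?_) ht ht'
  have hb := hC' (s, t) ⟨h1, h2, h3⟩
  have h3 := rpow_one_div_pow (p := p) (hn (s, t) ⟨h1, h2, h3⟩) 3
  simp only [hlam] at hb
  rw [h3] at hb
  exact hb

/-- Local existence near a point of `M`: the field is extended so as to be tangent to all level sets
of a defining function, so that solutions in the ambient space which start in `M` stay there. -/
theorem exists_local_tracePath (hM : IsEmbeddedSubmanifold d M) (hω : IsControl T ω) (hp : 0 < p)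
    (hp3 : p < 3) (Y : Euc n →ₗ[ℝ] vectorFields d M) {Z : RoughPair (Euc n)}
    (hZ : IsWeaklyGeometric p ω T Z) {m : Euc N} (hm : m ∈ M) :
    ∃ r > 0, ∃ δ > 0, ∀ x₀ ∈ M, x₀ ∈ Metric.ball m r → ∀ s₀ s₁, 0 ≤ s₀ → s₀ ≤ s₁ → s₁ ≤ T →
      s₁ - s₀ < δ → ∃ x : ℝ → Euc N, x s₀ = x₀ ∧ IsTracePath p ω Y Z s₀ s₁ x := by
  obtain ⟨r, hr, G, F, hG, hF, hGF⟩ := exists_tangent_extension hM Y hm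
  obtain ⟨δ, hδ, C, hC, hex⟩ := exists_rde_path hω hp hp3 hG hZ.isRoughPath (half_pos hr)
  refine ⟨r / 2, half_pos hr, δ, hδ, fun x₀ hx₀M hx₀ s₀ s₁ h0 h01 h1 hd => ?_⟩
  obtain ⟨x, hxs, hxc, hx, hxr⟩ := hex s₀ s₁ x₀ h0 h01 h1 hd
  have hxO : ∀ t, s₀ ≤ t → t ≤ s₁ → x t ∈ Metric.ball m r := fun t a1 a2 => by
    have b1 := hxr t a1 a2
    rw [mem_ball_iff_norm] at hx₀ ⊢
    calc ‖x t - m‖ ≤ _ := norm_sub_le_norm_sub_add_norm_sub _ x₀ _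
      _ < r := by linarith
  have hxM : ∀ t, s₀ ≤ t → t ≤ s₁ → x t ∈ M := fun t a1 a2 => by
    rw [(hGF _ (hxO t a1 a2)).2.2, eq_of_fderiv_comp_eq_zero hω hp hp3 hG hF Metric.isOpen_ball
      (fun y hy => (hGF y hy).2.1) hZ h0 h1 hx hxO a1 a2, hxs]
    exact (hGF x₀ (by rw [← hxs]; exact hxO s₀ le_rfl h01)).2.2.1 hx₀M
  refine ⟨x, hxs, hxc, hxM, 1, one_pos, C, hC, fun s t a1 a2 a3 _ => ?_⟩
  rw [sub_sub_eq_sub_rdeStep hM Y (hxM s a1 (a2.trans a3)) hG Metric.isOpen_ball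
    (hxO s a1 (a2.trans a3)) fun y hyM hy => (hGF y hy).1 hyM]
  exact hx s t a1 a2 a3

/-- On a compact subset of `M` the local existence time is bounded below. -/
theorem exists_uniform_local_tracePath (hM : IsEmbeddedSubmanifold d M) (hω : IsControl T ω)
    (hp : 0 < p) (hp3 : p < 3) (Y : Euc n →ₗ[ℝ] vectorFields d M) {Z : RoughPair (Euc n)}
    (hZ : IsWeaklyGeometric p ω T Z) {K : Set (Euc N)} (hK : IsCompact K) (hKM : K ⊆ M) :
    ∃ δ > 0, ∀ x₀ ∈ K, ∀ s₀ s₁, 0 ≤ s₀ → s₀ ≤ s₁ → s₁ ≤ T →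
      s₁ - s₀ < δ → ∃ x : ℝ → Euc N, x s₀ = x₀ ∧ IsTracePath p ω Y Z s₀ s₁ x := by
  refine hK.induction_on (p := fun A => ∃ δ > 0, ∀ x₀ ∈ A, ∀ s₀ s₁, 0 ≤ s₀ → s₀ ≤ s₁ → s₁ ≤ T →
      s₁ - s₀ < δ → ∃ x : ℝ → Euc N, x s₀ = x₀ ∧ IsTracePath p ω Y Z s₀ s₁ x) ?_ ?_ ?_ ?_
  · exact ⟨1, one_pos, fun x hx => absurd hx (Set.notMem_empty x)⟩
  · rintro A B hAB ⟨δ, hδ, h⟩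
    exact ⟨δ, hδ, fun x hx => h x (hAB hx)⟩
  · rintro A B ⟨δ, hδ, h⟩ ⟨δ', hδ', h'⟩
    refine ⟨min δ δ', lt_min hδ hδ', fun x hx s₀ s₁ a1 a2 a3 a4 => ?_⟩
    rw [lt_min_iff] at a4
    rcases hx with hx | hx
    · exact h x hx s₀ s₁ a1 a2 a3 a4.1
    · exact h' x hx s₀ s₁ a1 a2 a3 a4.2
  · intro m hm
    obtain ⟨r, hr, δ, hδ, h⟩ := exists_local_tracePath hM hω hp hp3 Y hZ (hKM hm)
    exact ⟨K ∩ Metric.ball m r, inter_mem_nhdsWithin K (Metric.ball_mem_nhds m hr), δ, hδ,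
      fun x hx => h x (hKM hx.1) hx.2⟩

/-- Solutions on adjacent intervals can be concatenated. For times on both sides of `S` the expansion
follows from the two expansions and the approximate composition law of the Euler steps. -/
theorem IsTracePath.glue (hM : IsEmbeddedSubmanifold d M) (hω : IsControl T ω) (hp : 0 < p)
    {Y : Euc n →ₗ[ℝ] vectorFields d M} {Z : RoughPair (Euc n)}
    (hZ : IsRoughPath p ω T Z) {S S' : ℝ} (h0 : 0 ≤ S) (hS : S ≤ S') (hS' : S' ≤ T)
    {x y : ℝ → Euc N} (hx : IsTracePath p ω Y Z 0 S x) (hy : IsTracePath p ω Y Z S S' y)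
    (hxy : x S = y S) :
    IsTracePath p ω Y Z 0 S' fun t => if t ≤ S then x t else y t := by
  set w : ℝ → Euc N := fun t => if t ≤ S then x t else y t with hw
  have hwx : ∀ t, t ≤ S → w t = x t := fun t ht => if_pos ht
  have hwy : ∀ t, S ≤ t → w t = y t := fun t ht => by
    rcases ht.eq_or_lt with rfl | h
    · rw [hwx _ le_rfl, hxy]
    · exact if_neg h.not_ge
  have hc : ContinuousOn w (Set.Icc 0 S') := by
    have : Set.Icc 0 S' = Set.Icc 0 S ∪ Set.Icc S S' := (Set.Icc_union_Icc_eq_Icc h0 hS).symm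
    rw [this]
    exact (hx.continuousOn.congr fun t ht => hwx t ht.2).union_of_isClosed
      (hy.continuousOn.congr fun t ht => hwy t ht.1) isClosed_Icc isClosed_Icc
  have hmem : ∀ t, 0 ≤ t → t ≤ S' → w t ∈ M := fun t h1 h2 => by
    rcases le_total t S with h | h
    · rw [hwx t h]; exact hx.mem t h1 h
    · rw [hwy t h]; exact hy.mem t h h2
  refine ⟨hc, hmem, ?_⟩
  obtain ⟨G, O, hG, hO, hKO, hGY⟩ := exists_extension_of_isCompact hM Y
    (isCompact_Icc.image_of_continuousOn hc) (by
      rintro _ ⟨t, ht, rfl⟩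
      exact hmem t ht.1 ht.2)
  have hwO : ∀ t, 0 ≤ t → t ≤ S' → w t ∈ O := fun t h1 h2 => hKO ⟨t, ⟨h1, h2⟩, rfl⟩
  obtain ⟨δ₁, hδ₁, C₁, hC₁, hx'⟩ := hx.exists_rdeStep hM hG hO hGY fun t h1 h2 => by
    rw [← hwx t h2]
    exact hwO t h1 (h2.trans hS)
  obtain ⟨δ₂, hδ₂, C₂, hC₂, hy'⟩ := hy.exists_rdeStep hM hG hO hGY fun t h1 h2 => by
    rw [← hwy t h1]
    exact hwO t (h0.trans h1) h2
  obtain ⟨K, hK, -, b2, b3, -, -⟩ := exists_rdeStep_bounds hω hp hG hZ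
  obtain ⟨c, hc0, hcb⟩ := hω.exists_rpow_le (γ := 1 / p) (by positivity)
  refine ⟨min δ₁ δ₂, lt_min hδ₁ hδ₂, C₂ + (1 + K * c) * C₁ + C₁ + K, by positivity,
    fun s t a1 a2 a3 a4 => ?_⟩
  rw [le_min_iff] at a4
  rw [sub_sub_eq_sub_rdeStep hM Y (hmem s a1 (a2.trans a3)) hG hO (hwO s a1 (a2.trans a3)) hGY]
  have w0 := hω.nonneg a1 a2 (a3.trans hS')
  have hγ : 0 < 3 / p := by positivity
  have w1 : 0 ≤ ω s t ^ (3 / p) := by positivity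
  have hA : 0 ≤ (1 + K * c) * C₁ := by positivity
  rcases le_total t S with htS | htS
  · rw [hwx t htS, hwx s (a2.trans htS)]
    refine (hx' s t a1 a2 htS a4.1).trans ?_
    gcongr
    linarith
  rcases le_total S s with hsS | hsS
  · rw [hwy t htS, hwy s hsS]
    refine (hy' s t hsS a2 a3 a4.2).trans ?_
    gcongr
    linarith
  · rw [hwy t htS, hwx s hsS]
    have c1 := hy' S t le_rfl htS a3 (by linarith)
    have c2 := hx' s S a1 hsS le_rfl (by linarith)
    have c3 := b2 S t (x S) (rdeStep G Z s S (x s)) h0 htS (a3.trans hS')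
    have c4 := b3 s S t (x s) a1 hsS htS (a3.trans hS')
    have m1 : ω S t ^ (3 / p) ≤ ω s t ^ (3 / p) := Real.rpow_le_rpow
      (hω.nonneg h0 htS (a3.trans hS')) (hω.mono a1 hsS htS le_rfl (a3.trans hS')) hγ.le
    have m2 : ω s S ^ (3 / p) ≤ ω s t ^ (3 / p) := Real.rpow_le_rpow
      (hω.nonneg a1 hsS (hS.trans hS')) (hω.mono a1 le_rfl hsS htS (a3.trans hS')) hγ.le
    have m3 := hcb S t h0 htS (a3.trans hS')
    rw [← hxy] at c1
    calc ‖y t - rdeStep G Z s t (x s)‖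
        ≤ ‖y t - rdeStep G Z S t (x S)‖ +
          (‖rdeStep G Z S t (x S) - rdeStep G Z S t (rdeStep G Z s S (x s))‖ +
            ‖rdeStep G Z S t (rdeStep G Z s S (x s)) - rdeStep G Z s t (x s)‖) :=
          (norm_sub_le_norm_sub_add_norm_sub _ _ _).trans
            (add_le_add le_rfl (norm_sub_le_norm_sub_add_norm_sub _ _ _))
      _ ≤ C₂ * ω s t ^ (3 / p) + ((1 + K * c) * (C₁ * ω s t ^ (3 / p)) + K * ω s t ^ (3 / p)) := by
          refine add_le_add (c1.trans (by gcongr)) (add_le_add (c3.trans ?_) c4)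
          gcongr
          exact c2.trans (by gcongr)
      _ ≤ _ := by nlinarith [mul_nonneg hC₁ w1]

end TracePath

/-! ### The second level -/

section Lift

theorem isBigO_tmul {ι : Type*} {l : Filter ι} {V W : Type*} [NormedAddCommGroup V]
    [InnerProductSpace ℝ V] [NormedAddCommGroup W] [InnerProductSpace ℝ W] {u : ι → V} {v : ι → W}
    {α β : ι → ℝ} (hu : u =O[l] α) (hv : v =O[l] β) :
    (fun i => u i ⊗ₜ[ℝ] v i) =O[l] fun i => α i * β i :=
  IsBigO.trans (IsBigO.of_norm_le fun _ => (TensorProduct.norm_tmul _ _).le)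
    (hu.norm_left.mul hv.norm_left)

variable {S p : ℝ} {ω : ℝ → ℝ → ℝ}

/-- The set of pairs of times `0 ≤ s ≤ t ≤ S`. -/
def simplex (S : ℝ) : Set (ℝ × ℝ) := {q | 0 ≤ q.1 ∧ q.1 ≤ q.2 ∧ q.2 ≤ S}

theorem isBigO_of_norm_le_rpow {F : Type*} [NormedAddCommGroup F] {f : ℝ → ℝ → F} {k : ℕ}
    (hω : IsControl S ω)
    (h : (fun q : ℝ × ℝ => f q.1 q.2) =O[𝓟 (simplex S)] fun q => (ω q.1 q.2 ^ (1 / p)) ^ k)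
    {ι : Type*} {D : Set ι} {a b : ι → ℝ} {w : ι → ℝ}
    (hD : ∀ i ∈ D, 0 ≤ a i ∧ a i ≤ b i ∧ b i ≤ S ∧ ω (a i) (b i) ^ (1 / p) ≤ w i) :
    (fun i => f (a i) (b i)) =O[𝓟 D] fun i => w i ^ k := by
  obtain ⟨c, hc, h⟩ := isBigO_principal_nonneg h fun q hq => by
    have := hω.nonneg hq.1 hq.2.1 hq.2.2
    positivity
  refine isBigO_principal.2 ⟨c, fun i hi => ?_⟩
  obtain ⟨h1, h2, h3, h4⟩ := hD i hi
  have hn := hω.nonneg h1 h2 h3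
  have hn' : 0 ≤ ω (a i) (b i) ^ (1 / p) := by positivity
  rw [Real.norm_of_nonneg (pow_nonneg (hn'.trans h4) k)]
  exact (h (a i, b i) ⟨h1, h2, h3⟩).trans (by gcongr)

theorem exists_norm_le_rpow_of_isBigO {F : Type*} [NormedAddCommGroup F] {f : ℝ → ℝ → F} {k : ℕ}
    (hω : IsControl S ω)
    (h : (fun q : ℝ × ℝ => f q.1 q.2) =O[𝓟 (simplex S)] fun q => (ω q.1 q.2 ^ (1 / p)) ^ k) :
    ∃ C, 0 ≤ C ∧ ∀ s t, 0 ≤ s → s ≤ t → t ≤ S → ‖f s t‖ ≤ C * ω s t ^ (k / p) := by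
  obtain ⟨c, hc, h⟩ := isBigO_principal_nonneg h fun q hq => by
    have := hω.nonneg hq.1 hq.2.1 hq.2.2
    positivity
  refine ⟨c, hc, fun s t h1 h2 h3 => ?_⟩
  rw [← rpow_one_div_pow (hω.nonneg h1 h2 h3)]
  exact h (s, t) ⟨h1, h2, h3⟩

theorem approxEq_of_isBigO {W : Type*} [NormedAddCommGroup W] [InnerProductSpace ℝ W]
    {g h : ℝ → ℝ → W} (hω : IsControl S ω)
    (hgh : (fun q : ℝ × ℝ => g q.1 q.2 - h q.1 q.2) =O[𝓟 (simplex S)]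
      fun q => (ω q.1 q.2 ^ (1 / p)) ^ 3) :
    ApproxEq p ω S g h := by
  obtain ⟨C, hC, hb⟩ := exists_norm_le_rpow_of_isBigO (f := fun s t => g s t - h s t) hω hgh
  refine ⟨1, one_pos, C + 1, by positivity, fun s t h1 h2 h3 _ => (hb s t h1 h2 h3).trans ?_⟩
  have := hω.nonneg h1 h2 h3
  push_cast
  gcongr
  linarith

/-- Bounds for close times extend to all times, for bounded two-parameter functions. -/
theorem IsControl.exists_le_rpow_of_local (hω : IsControl S ω) {γ : ℝ} (hγ : 0 ≤ γ)
    {f : ℝ → ℝ → ℝ} {δ C B : ℝ} (hδ : 0 < δ) (hC : 0 ≤ C)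
    (hloc : ∀ s t, 0 ≤ s → s ≤ t → t ≤ S → t - s ≤ δ → f s t ≤ C * ω s t ^ γ)
    (hB : ∀ s t, 0 ≤ s → s ≤ t → t ≤ S → f s t ≤ B) :
    ∃ C', 0 ≤ C' ∧ ∀ s t, 0 ≤ s → s ≤ t → t ≤ S → f s t ≤ C' * ω s t ^ γ := by
  obtain ⟨c, hc, hcω⟩ := hω.exists_pos_le hδ
  refine ⟨C + |B| / c ^ γ, by positivity, fun s t h1 h2 h3 => ?_⟩
  have h0 := hω.nonneg h1 h2 h3
  have hw : 0 ≤ ω s t ^ γ := by positivity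
  rw [add_mul]
  rcases le_total (t - s) δ with h | h
  · have : 0 ≤ |B| / c ^ γ * ω s t ^ γ := by positivity
    linarith [hloc s t h1 h2 h3 h]
  · have h4 : c ^ γ ≤ ω s t ^ γ := Real.rpow_le_rpow hc.le (hcω s t h1 h2 h3 h) hγ
    have h5 : |B| ≤ |B| / c ^ γ * ω s t ^ γ := by
      rw [div_mul_eq_mul_div, le_div_iff₀ (by positivity)]
      gcongr
    have h6 : 0 ≤ C * ω s t ^ γ := by positivity
    linarith [hB s t h1 h2 h3, le_abs_self B]

theorem isWeaklyGeometric_zero {V : Type*} [NormedAddCommGroup V] [InnerProductSpace ℝ V] :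
    IsWeaklyGeometric p ω S (RoughPair.zero V) where
  isRoughPath :=
    { continuousOn_trace := continuousOn_const
      continuousOn_second := continuousOn_const
      chen := fun s u t _ _ _ _ => by simp [RoughPair.zero, RoughPair.incr]
      bound_trace := ⟨0, fun s t _ _ _ => by simp [RoughPair.zero, RoughPair.incr]⟩
      bound_second := ⟨0, fun s t _ _ _ => by simp [RoughPair.zero]⟩ }
  sym := fun s t _ _ _ => by simp [RoughPair.zero, RoughPair.incr, symPart]

theorem norm_symPart_le {V : Type*} [NormedAddCommGroup V] [InnerProductSpace ℝ V]
    (A : V ⊗[ℝ] V) : ‖symPart A‖ ≤ ‖A‖ := by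
  rw [symPart, norm_smul]
  have := norm_add_le A (TensorProduct.comm ℝ V V A)
  rw [TensorProduct.norm_comm] at this
  norm_num
  linarith

theorem symPart_add {V : Type*} [NormedAddCommGroup V] [InnerProductSpace ℝ V]
    (A B : V ⊗[ℝ] V) : symPart (A + B) = symPart A + symPart B := by
  simp only [symPart, map_add, ← smul_add]
  congr 1
  abel

theorem symPart_mapL {V W : Type*} [NormedAddCommGroup V] [InnerProductSpace ℝ V]
    [NormedAddCommGroup W] [InnerProductSpace ℝ W] (f : V →L[ℝ] W) (A : V ⊗[ℝ] V) :
    symPart (TensorProduct.mapL f f A) = TensorProduct.mapL f f (symPart A) := by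
  have h : TensorProduct.comm ℝ W W (TensorProduct.mapL f f A) =
      TensorProduct.mapL f f (TensorProduct.comm ℝ V V A) := by
    induction A using TensorProduct.induction_on with
    | zero => simp
    | tmul a b => simp
    | add a b ha hb => simp only [map_add, ha, hb]
  rw [symPart, symPart, h, map_smul, map_add]

/-- A two-parameter process which satisfies Chen's relation and has the second order expansion of
the square of `x` is weakly geometric: the failure of this is additive and of third order. -/
theorem symPart_eq_of_chen {V : Type*} [NormedAddCommGroup V] [InnerProductSpace ℝ V]
    (hω : IsControl S ω) (hp : 0 < p) (hp3 : p < 3) {X : RoughPair V}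
    (hchen : ∀ s u t, 0 ≤ s → s ≤ u → u ≤ t → t ≤ S →
      X.second s t = X.second s u + X.second u t + X.incr s u ⊗ₜ[ℝ] X.incr u t)
    (hX : (fun q : ℝ × ℝ => symPart (X.second q.1 q.2) -
      (1 / 2 : ℝ) • (X.incr q.1 q.2 ⊗ₜ[ℝ] X.incr q.1 q.2)) =O[𝓟 (simplex S)]
        fun q => (ω q.1 q.2 ^ (1 / p)) ^ 3) {s t : ℝ} (hs : 0 ≤ s) (hst : s ≤ t) (ht : t ≤ S) :
    symPart (X.second s t) = (1 / 2 : ℝ) • (X.incr s t ⊗ₜ[ℝ] X.incr s t) := by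
  set f : ℝ → V ⊗[ℝ] V := fun t => symPart (X.second 0 t) -
    (1 / 2 : ℝ) • (X.incr 0 t ⊗ₜ[ℝ] X.incr 0 t) with hf
  have hadd : ∀ s t, 0 ≤ s → s ≤ t → t ≤ S → f t - f s = symPart (X.second s t) -
      (1 / 2 : ℝ) • (X.incr s t ⊗ₜ[ℝ] X.incr s t) := by
    intro s t h1 h2 h3
    have e1 : X.incr 0 t = X.incr 0 s + X.incr s t := by
      simp only [RoughPair.incr]; abel
    simp only [hf]
    rw [hchen 0 s t le_rfl h1 h2 h3, e1, symPart_add, symPart_add]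
    simp only [symPart, TensorProduct.comm_tmul, TensorProduct.tmul_add, TensorProduct.add_tmul,
      smul_add]
    abel
  obtain ⟨C, -, hC⟩ := exists_norm_le_rpow_of_isBigO (f := fun s t => symPart (X.second s t) -
      (1 / 2 : ℝ) • (X.incr s t ⊗ₜ[ℝ] X.incr s t)) hω hX
  have hcst : ∀ t, 0 ≤ t → t ≤ S → f t = f 0 := fun t h1 h2 =>
    eq_of_norm_sub_le_rpow hω (γ := 3 / p) (by rwa [one_lt_div hp]) le_rfl le_rfl (C := C)
      (fun s t a1 a2 a3 => by
        rw [hadd s t a1 a2 a3]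
        exact_mod_cast hC s t a1 a2 a3) h1 h2
  have h := hadd s t hs hst ht
  rw [hcst t (hs.trans hst) ht, hcst s hs (hst.trans ht), sub_self] at h
  exact (sub_eq_zero.1 h.symm)

theorem norm_mapL_sub_mapL_le {V E : Type*} [NormedAddCommGroup V] [InnerProductSpace ℝ V]
    [NormedAddCommGroup E] [InnerProductSpace ℝ E] (f g : V →L[ℝ] E) :
    ‖TensorProduct.mapL f f - TensorProduct.mapL g g‖ ≤ (‖f‖ + ‖g‖) * ‖f - g‖ := by
  have e : TensorProduct.mapL f f - TensorProduct.mapL g g =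
      TensorProduct.mapL (f - g) f + TensorProduct.mapL g (f - g) := by
    have e1 : TensorProduct.mapL f f = TensorProduct.mapL (f - g) f + TensorProduct.mapL g f := by
      rw [← TensorProduct.mapL_add_left, sub_add_cancel]
    have e2 : TensorProduct.mapL g f = TensorProduct.mapL g (f - g) + TensorProduct.mapL g g := by
      rw [← TensorProduct.mapL_add_right, sub_add_cancel]
    rw [e1, e2]
    abel
  rw [e]
  have h1 := TensorProduct.norm_mapL_le (f - g) f
  have h2 := TensorProduct.norm_mapL_le g (f - g)
  have h3 : ‖TensorProduct.mapL (f - g) f + TensorProduct.mapL g (f - g)‖ ≤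
      ‖TensorProduct.mapL (f - g) f‖ + ‖TensorProduct.mapL g (f - g)‖ :=
    norm_add_le (E := (V ⊗[ℝ] V) →L[ℝ] (E ⊗[ℝ] E)) _ _
  linarith

theorem isBigO_mapL_sub {ι : Type*} {l : Filter ι} {V E : Type*} [NormedAddCommGroup V]
    [InnerProductSpace ℝ V] [NormedAddCommGroup E] [InnerProductSpace ℝ E]
    {f g : ι → V →L[ℝ] E} {w : ι → ℝ} (hf : f =O[l] fun _ => (1 : ℝ))
    (hg : g =O[l] fun _ => (1 : ℝ)) (hfg : (fun i => f i - g i) =O[l] w) :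
    (fun i => TensorProduct.mapL (f i) (f i) - TensorProduct.mapL (g i) (g i)) =O[l] w := by
  refine IsBigO.trans (IsBigO.of_norm_le fun i => norm_mapL_sub_mapL_le _ _) ?_
  simpa using (hf.norm_left.add hg.norm_left).mul hfg.norm_left

theorem isBigO_mapL {ι : Type*} {l : Filter ι} {V E : Type*} [NormedAddCommGroup V]
    [InnerProductSpace ℝ V] [NormedAddCommGroup E] [InnerProductSpace ℝ E]
    {f : ι → V →L[ℝ] E} (hf : f =O[l] fun _ => (1 : ℝ)) :
    (fun i => TensorProduct.mapL (f i) (f i)) =O[l] fun _ => (1 : ℝ) := by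
  refine IsBigO.trans (IsBigO.of_norm_le fun i => TensorProduct.norm_mapL_le _ _) ?_
  simpa using hf.norm_left.mul hf.norm_left

theorem continuous_mapL_self {V E : Type*} [NormedAddCommGroup V] [InnerProductSpace ℝ V]
    [NormedAddCommGroup E] [InnerProductSpace ℝ E] :
    Continuous fun f : V →L[ℝ] E => TensorProduct.mapL f f := by
  rw [continuous_iff_continuousAt]
  intro g
  have hloc : Tendsto (fun f : V →L[ℝ] E => (‖f‖ + ‖g‖) * ‖f - g‖) (𝓝 g) (𝓝 0) := by
    have : Continuous fun f : V →L[ℝ] E => (‖f‖ + ‖g‖) * ‖f - g‖ := by fun_prop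
    simpa using this.tendsto g
  exact (tendsto_iff_norm_sub_tendsto_zero (E := (V ⊗[ℝ] V) →L[ℝ] (E ⊗[ℝ] E))).2
    (squeeze_zero (fun _ => norm_nonneg (E := (V ⊗[ℝ] V) →L[ℝ] (E ⊗[ℝ] E)) _)
      (fun f => norm_mapL_sub_mapL_le f g) hloc)

/-- The second level of a solution exists: it is obtained from the trace by sewing together
`x_s ⊗ x_{s,t} + (G(x_s) ⊗ G(x_s)) ℤ_{s,t}`. -/
theorem exists_second {V E : Type*} [NormedAddCommGroup V] [InnerProductSpace ℝ V]
    [NormedAddCommGroup E] [InnerProductSpace ℝ E] [FiniteDimensional ℝ E]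
    (hω : IsControl S ω) (hp : 0 < p) (hp3 : p < 3) (hS : 0 ≤ S)
    {G : E → V →L[ℝ] E} (hG : IsTestMap G) {Z : RoughPair V} (hZ : IsRoughPath p ω S Z)
    {x : ℝ → E} (hxc : ContinuousOn x (Set.Icc 0 S))
    (h1 : (fun q : ℝ × ℝ => x q.2 - x q.1) =O[𝓟 (simplex S)]
      fun q => (ω q.1 q.2 ^ (1 / p)) ^ 1)
    (h2 : (fun q : ℝ × ℝ => x q.2 - x q.1 - G (x q.1) (Z.incr q.1 q.2)) =O[𝓟 (simplex S)]
      fun q => (ω q.1 q.2 ^ (1 / p)) ^ 2) :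
    ∃ XX : ℝ → ℝ → E ⊗[ℝ] E,
      ContinuousOn (fun q : ℝ × ℝ => XX q.1 q.2) (simplex S) ∧
      (∀ s u t, XX s t = XX s u + XX u t + (x u - x s) ⊗ₜ[ℝ] (x t - x u)) ∧
      (fun q : ℝ × ℝ => XX q.1 q.2 -
        TensorProduct.mapL (G (x q.1)) (G (x q.1)) (Z.second q.1 q.2)) =O[𝓟 (simplex S)]
        fun q => (ω q.1 q.2 ^ (1 / p)) ^ 3 := by
  set Ξ : ℝ → (V ⊗[ℝ] V) →L[ℝ] (E ⊗[ℝ] E) :=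
    fun s => TensorProduct.mapL (G (x s)) (G (x s)) with hΞ
  set A : ℝ → ℝ → E ⊗[ℝ] E := fun s t => x s ⊗ₜ[ℝ] (x t - x s) + Ξ s (Z.second s t) with hA
  have hcx1 : ContinuousOn (fun q : ℝ × ℝ => x q.1) (simplex S) :=
    hxc.comp continuousOn_fst fun q hq => ⟨hq.1, hq.2.1.trans hq.2.2⟩
  have hcx2 : ContinuousOn (fun q : ℝ × ℝ => x q.2) (simplex S) :=
    hxc.comp continuousOn_snd fun q hq => ⟨hq.1.trans hq.2.1, hq.2.2⟩
  have hcxx : ContinuousOn (fun q : ℝ × ℝ => x q.1 ⊗ₜ[ℝ] (x q.2 - x q.1)) (simplex S) :=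
    TensorProduct.continuous_tmul.comp_continuousOn (hcx1.prodMk (hcx2.sub hcx1))
  have hcA : ContinuousOn (fun q : ℝ × ℝ => A q.1 q.2) (simplex S) :=
    hcxx.add (((continuous_mapL_self.comp hG.continuous).comp_continuousOn hcx1).clm_apply
      hZ.continuousOn_second)
  -- third order bound for the failure of additivity
  set D₃ : Set (ℝ × ℝ × ℝ) := {q | 0 ≤ q.1 ∧ q.1 ≤ q.2.1 ∧ q.2.1 ≤ q.2.2 ∧ q.2.2 ≤ S} with hD₃
  set lam : ℝ × ℝ × ℝ → ℝ := fun q => ω q.1 q.2.2 ^ (1 / p) with hlam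
  have hl : lam =O[𝓟 D₃] fun _ => (1 : ℝ) := isBigO_control_rpow hω hp
    (a := fun q : ℝ × ℝ × ℝ => q.1) (b := fun q => q.2.2)
    fun i hi => ⟨hi.1, hi.2.1.trans hi.2.2.1, hi.2.2.2⟩
  have hsu : ∀ i ∈ D₃, 0 ≤ i.1 ∧ i.1 ≤ i.2.1 ∧ i.2.1 ≤ S ∧ ω i.1 i.2.1 ^ (1 / p) ≤ lam i :=
    fun i hi => ⟨hi.1, hi.2.1, hi.2.2.1.trans hi.2.2.2,
      Real.rpow_le_rpow (hω.nonneg hi.1 hi.2.1 (hi.2.2.1.trans hi.2.2.2))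
        (hω.mono hi.1 le_rfl hi.2.1 hi.2.2.1 hi.2.2.2) (by positivity)⟩
  have hut : ∀ i ∈ D₃, 0 ≤ i.2.1 ∧ i.2.1 ≤ i.2.2 ∧ i.2.2 ≤ S ∧
      ω i.2.1 i.2.2 ^ (1 / p) ≤ lam i :=
    fun i hi => ⟨hi.1.trans hi.2.1, hi.2.2.1, hi.2.2.2,
      Real.rpow_le_rpow (hω.nonneg (hi.1.trans hi.2.1) hi.2.2.1 hi.2.2.2)
        (hω.mono hi.1 hi.2.1 hi.2.2.1 le_rfl hi.2.2.2) (by positivity)⟩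
  obtain ⟨z1, -⟩ := isBigO_incr hω hZ hsu
  obtain ⟨z2, zz2⟩ := isBigO_incr hω hZ hut
  have x1 := isBigO_of_norm_le_rpow (f := fun s t => x t - x s) hω h1 hsu
  have x2 := isBigO_of_norm_le_rpow (f := fun s t => x t - x s) hω h1 hut
  have y1 := isBigO_of_norm_le_rpow (f := fun s t => x t - x s - G (x s) (Z.incr s t)) hω h2 hsu
  have y2 := isBigO_of_norm_le_rpow (f := fun s t => x t - x s - G (x s) (Z.incr s t)) hω h2 hut
  simp only [pow_one] at x1 x2
  have hGd : (fun i : ℝ × ℝ × ℝ => G (x i.2.1) - G (x i.1)) =O[𝓟 D₃] lam :=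
    (hG.isBigO_sub (l := 𝓟 D₃) (fun i : ℝ × ℝ × ℝ => x i.2.1) (fun i => x i.1)).trans x1.norm_left
  have hG1 := hG.isBigO_one (l := 𝓟 D₃) fun i : ℝ × ℝ × ℝ => x i.1
  have hG2 := hG.isBigO_one (l := 𝓟 D₃) fun i : ℝ × ℝ × ℝ => x i.2.1
  have t1 := isBigO_tmul y1 x2
  have t2 := isBigO_tmul (isBigO_clm_apply hG1 z1) (y2.add ((isBigO_clm_apply hGd z2).congr_right
    fun i => (pow_two (lam i)).symm))
  have t3 := isBigO_clm_apply (isBigO_mapL_sub hG2 hG1 hGd) zz2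
  have e1 : (fun i => lam i ^ 2 * lam i) = fun i => lam i ^ 3 := by ext; ring
  have e2 : (fun i => 1 * lam i * lam i ^ 2) = fun i => lam i ^ 3 := by ext; ring
  have e3 : (fun i => lam i * lam i ^ 2) = fun i => lam i ^ 3 := by ext; ring
  rw [e1] at t1
  rw [e2] at t2
  rw [e3] at t3
  have hdefect : (fun i : ℝ × ℝ × ℝ => A i.1 i.2.1 + A i.2.1 i.2.2 - A i.1 i.2.2) =O[𝓟 D₃]
      fun i => lam i ^ 3 := by
    refine ((t1.add t2).add t3).congr' ?_ EventuallyEq.rfl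
    rw [EventuallyEq, eventually_principal]
    rintro ⟨s, u, t⟩ ⟨a1, a2, a3, a4⟩
    simp only [hA, hΞ]
    rw [hZ.chen s u t a1 a2 a3 a4]
    have f1 : x s ⊗ₜ[ℝ] (x t - x s) = x s ⊗ₜ[ℝ] (x u - x s) + x s ⊗ₜ[ℝ] (x t - x u) := by
      rw [← TensorProduct.tmul_add]
      congr 1
      abel
    have f2 : x u ⊗ₜ[ℝ] (x t - x u) = x s ⊗ₜ[ℝ] (x t - x u) +
        (x u - x s) ⊗ₜ[ℝ] (x t - x u) := by
      rw [← TensorProduct.add_tmul]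
      congr 1
      abel
    have f3 : x t - x u - G (x u) (Z.incr u t) + (G (x u) - G (x s)) (Z.incr u t) =
        (x t - x u) - G (x s) (Z.incr u t) := by
      rw [sub_apply]
      abel
    rw [f1, f2, f3, TensorProduct.sub_tmul, TensorProduct.tmul_sub, map_add, map_add,
      TensorProduct.mapL_tmul, sub_apply]
    simp only [TensorProduct.tmul_sub, TensorProduct.sub_tmul]
    abel
  obtain ⟨C, hC, hCb⟩ := isBigO_principal_nonneg hdefect fun i hi => by
    have := hω.nonneg hi.1 (hi.2.1.trans hi.2.2.1) hi.2.2.2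
    simp only [hlam]
    positivity
  -- first order bound for the germ
  have hzz := (isBigO_incr hω hZ (D := simplex S) (a := fun q : ℝ × ℝ => q.1)
    (b := fun q => q.2) (w := fun q => ω q.1 q.2 ^ (1 / p))
    fun i hi => ⟨hi.1, hi.2.1, hi.2.2, le_rfl⟩).2
  have hl₂ : (fun q : ℝ × ℝ => ω q.1 q.2 ^ (1 / p)) =O[𝓟 (simplex S)] fun _ => (1 : ℝ) :=
    isBigO_control_rpow hω hp (a := fun q : ℝ × ℝ => q.1) (b := fun q => q.2) fun i hi => hi
  have hx1 : (fun q : ℝ × ℝ => x q.1) =O[𝓟 (simplex S)] fun _ => (1 : ℝ) := by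
    obtain ⟨B, hB⟩ := isCompact_Icc.exists_bound_of_continuousOn hxc
    exact isBigO_principal.2 ⟨B, fun q hq => by
      simpa using hB q.1 ⟨hq.1, hq.2.1.trans hq.2.2⟩⟩
  have hAO : (fun q : ℝ × ℝ => A q.1 q.2) =O[𝓟 (simplex S)] fun q => ω q.1 q.2 ^ (1 / p) := by
    have a1 := isBigO_tmul hx1 h1
    have a2 := isBigO_clm_apply (isBigO_mapL (hG.isBigO_one (l := 𝓟 (simplex S))
      fun q : ℝ × ℝ => x q.1)) hzz
    simp only [pow_one, one_mul] at a1 a2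
    exact a1.add (a2.trans (isBigO_sq_of_isBigO_one hl₂))
  obtain ⟨D, hD, hDb⟩ := isBigO_principal_nonneg hAO fun q hq => by
    have := hω.nonneg hq.1 hq.2.1 hq.2.2
    positivity
  have hγ : 1 < 3 / p := by rwa [one_lt_div hp]
  have : ProperSpace (E ⊗[ℝ] E) := FiniteDimensional.proper ℝ _
  -- the translations by the germ form an almost flow
  obtain ⟨J, -, hJc, hJ⟩ := exists_path_of_almostFlow hω le_rfl hS le_rfl
    (μ := fun s t y => y + A s t) (κ := 1) (γ := 3 / p) (β := 1 / p) (C := C) (D := D)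
    (zero_lt_one.trans hγ) (by positivity) zero_le_one hC hD
    (by have := two_mul_half_rpow_lt_one hγ; norm_num at this ⊢; exact this)
    (fun s t y y' _ _ _ => by simp)
    (fun s u t y a1 a2 a3 a4 => by
      have := hCb (s, u, t) ⟨a1, a2, a3, a4⟩
      have h3 := rpow_one_div_pow (p := p) (hω.nonneg a1 (a2.trans a3) a4) 3
      simp only [hlam] at this
      rw [h3] at this
      have e : y + A s u + A u t - (y + A s t) = A s u + A u t - A s t := by abel
      rw [e]
      exact this)
    (fun s t y a1 a2 a3 => by
      rw [add_sub_cancel_left]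
      exact hDb (s, t) ⟨a1, a2, a3⟩)
    (continuousOn_snd.add (hcA.comp (f := fun q : (ℝ × ℝ) × (E ⊗[ℝ] E) => q.1)
      continuousOn_fst fun q hq => hq)) 0
  refine ⟨fun s t => J t - J s - x s ⊗ₜ[ℝ] (x t - x s), ?_, fun s u t => ?_, ?_⟩
  · exact ((hJc.comp continuousOn_snd fun q hq => ⟨hq.1.trans hq.2.1, hq.2.2⟩).sub
      (hJc.comp continuousOn_fst fun q hq => ⟨hq.1, hq.2.1.trans hq.2.2⟩)).sub hcxx
  · simp only [TensorProduct.tmul_sub, TensorProduct.sub_tmul]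
    abel
  · refine isBigO_principal.2 ⟨(1 + 1) * C / (1 - (1 + 1 ^ 2) * (1 / 2) ^ (3 / p)), ?_⟩
    rintro ⟨s, t⟩ ⟨a1, a2, a3⟩
    have h3 := rpow_one_div_pow (p := p) (hω.nonneg a1 a2 a3) 3
    have hn := hω.nonneg a1 a2 a3
    simp only [h3]
    rw [Real.norm_of_nonneg (by positivity)]
    have := hJ s t a1 a2 a3
    have e : J t - J s - x s ⊗ₜ[ℝ] (x t - x s) - Ξ s (Z.second s t) = J t - (J s + A s t) := by
      simp only [hA]
      abel
    simp only [hΞ] at e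
    rw [e]
    exact this

end Lift

/-! ### Lifting a trace to a solution -/

section Solution

variable {N n d : ℕ} {M : Set (Euc N)} {T S p : ℝ} {ω : ℝ → ℝ → ℝ}
  {Y : Euc n →ₗ[ℝ] vectorFields d M} {Z : RoughPair (Euc n)}

theorem IsRoughPath.mono {V : Type*} [NormedAddCommGroup V] [InnerProductSpace ℝ V]
    {X : RoughPair V} (hX : IsRoughPath p ω T X) (h : S ≤ T) : IsRoughPath p ω S X where
  continuousOn_trace := hX.continuousOn_trace.mono (Set.Icc_subset_Icc_right h)
  continuousOn_second := hX.continuousOn_second.mono fun _ hq => ⟨hq.1, hq.2.1, hq.2.2.trans h⟩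
  chen := fun s u t h1 h2 h3 h4 => hX.chen s u t h1 h2 h3 (h4.trans h)
  bound_trace := hX.bound_trace.imp fun _ hC s t h1 h2 h3 => hC s t h1 h2 (h3.trans h)
  bound_second := hX.bound_second.imp fun _ hC s t h1 h2 h3 => hC s t h1 h2 (h3.trans h)

theorem IsWeaklyGeometric.mono {V : Type*} [NormedAddCommGroup V] [InnerProductSpace ℝ V]
    {X : RoughPair V} (hX : IsWeaklyGeometric p ω T X) (h : S ≤ T) : IsWeaklyGeometric p ω S X :=
  ⟨hX.isRoughPath.mono h, fun s t h1 h2 h3 => hX.sym s t h1 h2 (h3.trans h)⟩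

/-- A one form which vanishes on `TM` vanishes on `Y`, and differentiating this identity along `Y`
shows that its integral along a solution vanishes to second order. -/
theorem oneForm_apply_secondCoeff_add (hM : IsEmbeddedSubmanifold d M) {m : Euc N} (hm : m ∈ M)
    {G : Euc N → Euc n →L[ℝ] Euc N} (hG : DifferentiableAt ℝ G m) {O : Set (Euc N)}
    (hO : IsOpen O) (hmO : m ∈ O) (hGY : ∀ x ∈ M, x ∈ O → G x = coeff Y x) {k : ℕ}
    {α : Euc N → Euc N →L[ℝ] Euc k} (hα : DifferentiableAt ℝ α m)
    (h0 : ∀ m ∈ M, ∀ v ∈ tangentPlane d M m, α m v = 0) (A : Euc n ⊗[ℝ] Euc n) :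
    α m (secondCoeff G m A) +
      evalTensorL (fderiv ℝ α m) (TensorProduct.mapL (G m) (G m) A) = 0 := by
  induction A using TensorProduct.induction_on with
  | zero => simp
  | add a b ha hb =>
    simp only [map_add]
    rw [add_add_add_comm, ha, hb, add_zero]
  | tmul a b =>
    rw [secondCoeff_tmul, TensorProduct.mapL_tmul, evalTensorL_tmul]
    have hd : HasFDerivAt (fun y => α y (G y b))
        ((α m).comp ((fderiv ℝ G m).flip b) + (fderiv ℝ α m).flip (G m b)) m := by
      have h2 : HasFDerivAt (fun y => G y b) ((fderiv ℝ G m).flip b) m := by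
        simpa using hG.hasFDerivAt.clm_apply (hasFDerivAt_const b m)
      exact hα.hasFDerivAt.clm_apply h2
    have hv : G m a ∈ tangentPlane d M m := by
      rw [hGY m hm hmO]
      exact coeff_apply_mem_tangentPlane Y hm a
    have := fderiv_apply_eq_zero_of_eqOn hM hm hv hd.differentiableAt hO hmO fun x hx hxO => by
      rw [hGY x hx hxO]
      exact h0 x hx _ (coeff_apply_mem_tangentPlane Y hx b)
    rw [hd.fderiv] at this
    exact this

/-- The expansion of a solution holds uniformly for all pairs of times. -/
theorem IsTracePath.isBigO_rdeStep (hM : IsEmbeddedSubmanifold d M) (hω : IsControl S ω)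
    (hp : 0 < p) (hZ : IsRoughPath p ω S Z) {x : ℝ → Euc N} (hx : IsTracePath p ω Y Z 0 S x)
    {G : Euc N → Euc n →L[ℝ] Euc N} (hG : IsTestMap G) {O : Set (Euc N)} (hO : IsOpen O)
    (hGY : ∀ x ∈ M, x ∈ O → G x = coeff Y x) (hxO : ∀ t, 0 ≤ t → t ≤ S → x t ∈ O) :
    (fun q : ℝ × ℝ => x q.2 - rdeStep G Z q.1 q.2 (x q.1)) =O[𝓟 (simplex S)]
      fun q => (ω q.1 q.2 ^ (1 / p)) ^ 3 := by
  obtain ⟨δ, hδ, C, hC, hb⟩ := hx.exists_rdeStep hM hG hO hGY hxO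
  obtain ⟨B, hB⟩ := isCompact_Icc.exists_bound_of_continuousOn hx.continuousOn
  obtain ⟨K, hK, b1, -⟩ := exists_rdeStep_bounds hω hp hG hZ
  obtain ⟨c, hc, hcb⟩ := hω.exists_rpow_le (γ := 1 / p) (by positivity)
  obtain ⟨C', hC', h⟩ := hω.exists_le_rpow_of_local (γ := 3 / p) (by positivity)
    (f := fun s t => ‖x t - rdeStep G Z s t (x s)‖) (B := B + (B + K * c)) hδ hC hb
    fun s t h1 h2 h3 => by
      have e1 := hB t ⟨h1.trans h2, h3⟩
      have e2 := hB s ⟨h1, h2.trans h3⟩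
      have e3 := (b1 s t (x s) h1 h2 h3).trans (mul_le_mul_of_nonneg_left (hcb s t h1 h2 h3) hK)
      have e4 : ‖x t - rdeStep G Z s t (x s)‖ ≤ ‖x t‖ + ‖rdeStep G Z s t (x s)‖ := norm_sub_le _ _
      have e5 : ‖rdeStep G Z s t (x s)‖ ≤ ‖x s‖ + ‖rdeStep G Z s t (x s) - x s‖ :=
        norm_le_norm_add_norm_sub' _ _
      linarith
  refine isBigO_principal.2 ⟨C', fun q hq => ?_⟩
  have hn := hω.nonneg hq.1 hq.2.1 hq.2.2
  have h3 := rpow_one_div_pow (p := p) hn 3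
  rw [Real.norm_of_nonneg (by positivity), h3]
  exact h q.1 q.2 hq.1 hq.2.1 hq.2.2

theorem isRoughPath_of_isBigO {E : Type*} [NormedAddCommGroup E] [InnerProductSpace ℝ E]
    (hω : IsControl S ω) {X : RoughPair E} (hc : ContinuousOn X.trace (Set.Icc 0 S))
    (hc' : ContinuousOn (fun q : ℝ × ℝ => X.second q.1 q.2) (simplex S))
    (hchen : ∀ s u t, 0 ≤ s → s ≤ u → u ≤ t → t ≤ S →
      X.second s t = X.second s u + X.second u t + X.incr s u ⊗ₜ[ℝ] X.incr u t)
    (h1 : (fun q : ℝ × ℝ => X.incr q.1 q.2) =O[𝓟 (simplex S)]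
      fun q => (ω q.1 q.2 ^ (1 / p)) ^ 1)
    (h2 : (fun q : ℝ × ℝ => X.second q.1 q.2) =O[𝓟 (simplex S)]
      fun q => (ω q.1 q.2 ^ (1 / p)) ^ 2) : IsRoughPath p ω S X where
  continuousOn_trace := hc
  continuousOn_second := hc'
  chen := hchen
  bound_trace := by
    obtain ⟨C, -, hC⟩ := exists_norm_le_rpow_of_isBigO (f := X.incr) hω h1
    refine ⟨C, fun s t a1 a2 a3 => ?_⟩
    have := hω.pos s t a1 a2 a3
    rw [div_le_iff₀ (by positivity)]
    exact_mod_cast hC s t a1 a2.le a3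
  bound_second := by
    obtain ⟨C, -, hC⟩ := exists_norm_le_rpow_of_isBigO (f := X.second) hω h2
    refine ⟨C, fun s t a1 a2 a3 => ?_⟩
    have := hω.pos s t a1 a2 a3
    rw [div_le_iff₀ (by positivity)]
    exact_mod_cast hC s t a1 a2.le a3

/-- Every solution of the first level of the equation is the trace of a solution. -/
theorem IsTracePath.exists_solvesOn (hM : IsEmbeddedSubmanifold d M) (hω : IsControl T ω)
    (hp : 0 < p) (hp3 : p < 3) (hZT : IsWeaklyGeometric p ω T Z) (hS : 0 ≤ S) (hST : S ≤ T)
    {x : ℝ → Euc N} (hx : IsTracePath p ω Y Z 0 S x) :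
    ∃ X : RoughPair (Euc N), X.trace = x ∧ SolvesOn p ω Y Z (x 0) S X := by
  replace hω := hω.mono_right hST
  have hZ := hZT.mono hST
  obtain ⟨G, O, hG, hO, hKO, hGY⟩ := exists_extension_of_isCompact hM Y
    (isCompact_Icc.image_of_continuousOn hx.continuousOn) (by
      rintro _ ⟨t, ht, rfl⟩
      exact hx.mem t ht.1 ht.2)
  have hxO : ∀ t, 0 ≤ t → t ≤ S → x t ∈ O := fun t h1 h2 => hKO ⟨t, ⟨h1, h2⟩, rfl⟩
  have hρ := hx.isBigO_rdeStep hM hω hp hZ.isRoughPath hG hO hGY hxO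
  set lam : ℝ × ℝ → ℝ := fun q => ω q.1 q.2 ^ (1 / p) with hlam
  have hl : lam =O[𝓟 (simplex S)] fun _ => (1 : ℝ) := isBigO_control_rpow hω hp
    (a := fun q : ℝ × ℝ => q.1) (b := fun q => q.2) fun i hi => hi
  obtain ⟨hz, hzz⟩ := isBigO_incr hω hZ.isRoughPath (D := simplex S)
    (a := fun q : ℝ × ℝ => q.1) (b := fun q => q.2) (w := lam)
    fun i hi => ⟨hi.1, hi.2.1, hi.2.2, le_rfl⟩
  have hl32 : (fun q => lam q ^ 3) =O[𝓟 (simplex S)] fun q => lam q ^ 2 :=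
    ((isBigO_refl (fun q => lam q ^ 2) _).mul hl).congr (fun q => by ring) fun q => by ring
  have hGO := hG.isBigO_one (l := 𝓟 (simplex S)) fun q : ℝ × ℝ => x q.1
  set g : ℝ × ℝ → Euc N := fun q => G (x q.1) (Z.incr q.1 q.2) with hg
  set k : ℝ × ℝ → Euc N := fun q => secondCoeff G (x q.1) (Z.second q.1 q.2) with hk
  set ρ : ℝ × ℝ → Euc N := fun q => x q.2 - rdeStep G Z q.1 q.2 (x q.1) with hρdef
  have hincr : ∀ q : ℝ × ℝ, x q.2 - x q.1 = g q + k q + ρ q := fun q => by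
    simp only [hg, hk, hρdef, rdeStep, step, stepIncr]
    abel
  have hgO : g =O[𝓟 (simplex S)] lam := by simpa using isBigO_clm_apply hGO hz
  have hkO : k =O[𝓟 (simplex S)] fun q => lam q ^ 2 := by
    simpa using isBigO_clm_apply
      (hG.secondCoeff.isBigO_one (l := 𝓟 (simplex S)) fun q : ℝ × ℝ => x q.1) hzz
  have h2 : (fun q : ℝ × ℝ => x q.2 - x q.1 - g q) =O[𝓟 (simplex S)] fun q => lam q ^ 2 :=
    (hkO.add (hρ.trans hl32)).congr_left fun q => by rw [hincr q]; abel
  have h1 : (fun q : ℝ × ℝ => x q.2 - x q.1) =O[𝓟 (simplex S)] lam :=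
    (hgO.add (h2.trans (isBigO_sq_of_isBigO_one hl))).congr_left fun q => by abel
  have h1' : (fun q : ℝ × ℝ => x q.2 - x q.1) =O[𝓟 (simplex S)] fun q => lam q ^ 1 := by
    simpa using h1
  obtain ⟨XX, hXc, hchen, hXX⟩ := exists_second hω hp hp3 hS hG hZ.isRoughPath hx.continuousOn
    h1' h2
  set Ξ : ℝ × ℝ → Euc N ⊗[ℝ] Euc N := fun q =>
    TensorProduct.mapL (G (x q.1)) (G (x q.1)) (Z.second q.1 q.2) with hΞ
  set X : RoughPair (Euc N) := ⟨x, XX⟩ with hX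
  have hΞO : Ξ =O[𝓟 (simplex S)] fun q => lam q ^ 2 := by
    exact (isBigO_clm_apply (isBigO_mapL hGO) hzz).congr_right fun q => one_mul _
  have hXXO : (fun q : ℝ × ℝ => XX q.1 q.2) =O[𝓟 (simplex S)] fun q => lam q ^ 2 :=
    (hΞO.add (hXX.trans hl32)).congr_left fun q => by simp only [hΞ]; abel
  have hrough : IsRoughPath p ω S X := isRoughPath_of_isBigO hω hx.continuousOn hXc
    (fun s u t _ _ _ _ => hchen s u t) h1' hXXO
  -- the symmetric part agrees with half the square of the increment to third order
  have hsymO : (fun q : ℝ × ℝ => symPart (X.second q.1 q.2) -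
      (1 / 2 : ℝ) • (X.incr q.1 q.2 ⊗ₜ[ℝ] X.incr q.1 q.2)) =O[𝓟 (simplex S)]
        fun q => lam q ^ 3 := by
    have a1 : (fun q : ℝ × ℝ => symPart (XX q.1 q.2 - Ξ q)) =O[𝓟 (simplex S)]
        fun q => lam q ^ 3 := IsBigO.trans (IsBigO.of_norm_le fun q => norm_symPart_le _)
          hXX.norm_left
    have a2 := (isBigO_tmul h2 h1).add ((isBigO_tmul hgO h2).congr_right
      (fun q => by ring : ∀ q, lam q * lam q ^ 2 = lam q ^ 2 * lam q))
    refine (a1.sub ((a2.congr_right fun q => by ring).const_smul_left (1 / 2 : ℝ))).congr' ?_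
      EventuallyEq.rfl
    rw [EventuallyEq, eventually_principal]
    rintro ⟨s, t⟩ ⟨b1, b2, b3⟩
    have b4 : symPart (Ξ (s, t)) = (1 / 2 : ℝ) • (g (s, t) ⊗ₜ[ℝ] g (s, t)) := by
      simp only [hΞ, hg]
      rw [symPart_mapL, hZ.sym s t b1 b2 b3, map_smul, TensorProduct.mapL_tmul]
    have b5 : symPart (XX s t) = symPart (XX s t - Ξ (s, t)) + symPart (Ξ (s, t)) := by
      rw [← symPart_add, sub_add_cancel]
    simp only [hX, RoughPair.incr, Pi.smul_apply]
    rw [b5, b4]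
    simp only [TensorProduct.tmul_sub, TensorProduct.sub_tmul, smul_sub, smul_add]
    abel
  have hWG : IsWeaklyGeometric p ω S X := ⟨hrough, fun s t b1 b2 b3 =>
    symPart_eq_of_chen hω hp hp3 hrough.chen hsymO b1 b2 b3⟩
  refine ⟨X, rfl, ⟨hWG, hx.mem, fun j α hα h0 => ?_⟩, rfl, ?_, ?_⟩
  · have hcx : ContinuousOn (fun q : ℝ × ℝ => x q.1) (simplex S) :=
      hx.continuousOn.comp continuousOn_fst fun q hq => ⟨hq.1, hq.2.1.trans hq.2.2⟩
    have hbd : ∀ {F : Type} [NormedAddCommGroup F] {f : Euc N → F}, Continuous f →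
        (fun q : ℝ × ℝ => f (x q.1)) =O[𝓟 (simplex S)] fun _ => (1 : ℝ) := by
      intro F _ f hf
      obtain ⟨B, hB⟩ := isCompact_Icc.exists_bound_of_continuousOn
        (hf.comp_continuousOn hx.continuousOn)
      exact isBigO_principal.2 ⟨B, fun q hq => by
        simpa using hB q.1 ⟨hq.1, hq.2.1.trans hq.2.2⟩⟩
    have hαO := hbd hα.continuous
    have hα'O := hbd (F := (Euc N ⊗[ℝ] Euc N) →L[ℝ] Euc j)
      (f := fun y => evalTensorL (fderiv ℝ α y))
      (evalTensorL.continuous.comp (hα.continuous_fderiv (by simp)))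
    have hαG : ∀ q ∈ simplex S, ∀ a, α (x q.1) (G (x q.1) a) = 0 := fun q hq a => by
      have hm := hx.mem q.1 hq.1 (hq.2.1.trans hq.2.2)
      rw [hGY _ hm (hxO q.1 hq.1 (hq.2.1.trans hq.2.2))]
      exact h0 _ hm _ (coeff_apply_mem_tangentPlane Y hm a)
    refine ⟨isWeaklyGeometric_zero, rfl, approxEq_of_isBigO hω ?_, approxEq_of_isBigO hω ?_⟩
    · refine (((isBigO_clm_apply hαO hρ).add (isBigO_clm_apply hα'O hXX)).neg_left).congr' ?_
        (Eventually.of_forall fun q => by simp)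
      rw [EventuallyEq, eventually_principal]
      intro q hq
      have hq' := hq.2.1.trans hq.2.2
      have c1 := oneForm_apply_secondCoeff_add hM (hx.mem q.1 hq.1 hq')
        (hG.differentiable _) hO (hxO q.1 hq.1 hq') hGY
        ((hα.differentiable (by simp)) _) h0 (Z.second q.1 q.2)
      have c2 : X.incr q.1 q.2 = g q + k q + ρ q := hincr q
      have c3 : α (x q.1) (g q) = 0 := hαG q hq _
      have c4 : evalTensor (oneFormDeriv α (X.trace q.1)) (X.second q.1 q.2) =
          evalTensorL (fderiv ℝ α (x q.1)) (XX q.1 q.2) := (evalTensorL_apply _ _).symm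
      have c5 := eq_neg_of_add_eq_zero_left c1
      rw [c2, c4]
      simp only [RoughPair.zero, RoughPair.incr, map_add, map_sub, hX, c3, hk, c5]
      abel
    · refine ((isBigO_clm_apply (isBigO_mapL hαO) hXX).neg_left).congr' ?_
        (Eventually.of_forall fun q => by simp)
      rw [EventuallyEq, eventually_principal]
      intro q hq
      have c1 : ∀ A : Euc n ⊗[ℝ] Euc n, TensorProduct.mapL (α (x q.1)) (α (x q.1))
          (TensorProduct.mapL (G (x q.1)) (G (x q.1)) A) = 0 := by
        intro A
        induction A using TensorProduct.induction_on with
        | zero => simp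
        | tmul a b => rw [TensorProduct.mapL_tmul, TensorProduct.mapL_tmul, hαG q hq]; simp
        | add a b ha hb => rw [map_add, map_add, ha, hb, add_zero]
      rw [map_sub, c1, sub_zero]
      simp only [RoughPair.zero, zero_sub, TensorProduct.mapL_apply, hX]
  · obtain ⟨δ, hδ, C, hC, hb⟩ := hx.approx
    refine ⟨δ, hδ, C + 1, by positivity, fun s t b1 b2 b3 b4 => ?_⟩
    rw [abs_sub_comm, abs_of_nonneg (sub_nonneg.2 b2)] at b4
    have := hω.nonneg b1 b2 b3
    refine (hb s t b1 b2 b3 b4).trans ?_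
    gcongr
    linarith
  · refine approxEq_of_isBigO hω (hXX.congr' ?_ EventuallyEq.rfl)
    rw [EventuallyEq, eventually_principal]
    intro q hq
    rw [hGY _ (hx.mem q.1 hq.1 (hq.2.1.trans hq.2.2)) (hxO q.1 hq.1 (hq.2.1.trans hq.2.2))]
    simp only [hX, TensorProduct.mapL_apply]

end Solution

/-! ### Uniqueness and the maximal solution -/

section Maximal

variable {N n d : ℕ} {M : Set (Euc N)} {T S S' p : ℝ} {ω : ℝ → ℝ → ℝ}
  {Y : Euc n →ₗ[ℝ] vectorFields d M} {Z : RoughPair (Euc n)} {x₀ : Euc N}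

section ApproxEq

variable {W : Type*} [NormedAddCommGroup W]

theorem ApproxEq.mono {g h : ℝ → ℝ → W} (H : ApproxEq p ω S g h) (hS : S' ≤ S) :
    ApproxEq p ω S' g h := by
  obtain ⟨δ, hδ, C, hC, hb⟩ := H
  exact ⟨δ, hδ, C, hC, fun s t h1 h2 h3 => hb s t h1 h2 (h3.trans hS)⟩

theorem ApproxEq.congr {g h g' h' : ℝ → ℝ → W} (H : ApproxEq p ω S g h)
    (hg : ∀ s t, 0 ≤ s → s ≤ t → t ≤ S → g s t = g' s t)
    (hh : ∀ s t, 0 ≤ s → s ≤ t → t ≤ S → h s t = h' s t) : ApproxEq p ω S g' h' := by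
  obtain ⟨δ, hδ, C, hC, hb⟩ := H
  refine ⟨δ, hδ, C, hC, fun s t h1 h2 h3 h4 => ?_⟩
  rw [← hg s t h1 h2 h3, ← hh s t h1 h2 h3]
  exact hb s t h1 h2 h3 h4

end ApproxEq

theorem SolvesOn.mono {X : RoughPair (Euc N)} (hX : SolvesOn p ω Y Z x₀ S X) (h : S' ≤ S) :
    SolvesOn p ω Y Z x₀ S' X where
  mem :=
    { weaklyGeometric := hX.mem.weaklyGeometric.mono h
      trace_mem := fun t h1 h2 => hX.mem.trace_mem t h1 (h2.trans h)
      integral_eq_zero := fun k α hα h0 =>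
        have H := hX.mem.integral_eq_zero k α hα h0
        ⟨H.weaklyGeometric.mono h, H.start, H.first.mono h, H.second.mono h⟩ }
  start := hX.start
  first := hX.first.mono h
  second := hX.second.mono h

theorem RoughPair.AgreeOn.incr_eq {V : Type*} [NormedAddCommGroup V] [InnerProductSpace ℝ V]
    {X X' : RoughPair V} (h : X.AgreeOn S X') {s t : ℝ} (h1 : 0 ≤ s) (h2 : s ≤ t) (h3 : t ≤ S) :
    X.incr s t = X'.incr s t := by
  rw [RoughPair.incr, RoughPair.incr, h.1 t (h1.trans h2) h3, h.1 s h1 (h2.trans h3)]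

theorem IsWeaklyGeometric.congr {V : Type*} [NormedAddCommGroup V] [InnerProductSpace ℝ V]
    {X X' : RoughPair V} (hX : IsWeaklyGeometric p ω S X) (h : X.AgreeOn S X') :
    IsWeaklyGeometric p ω S X' where
  isRoughPath :=
    { continuousOn_trace := hX.isRoughPath.continuousOn_trace.congr
        fun t ht => (h.1 t ht.1 ht.2).symm
      continuousOn_second := hX.isRoughPath.continuousOn_second.congr
        fun q hq => (h.2 q.1 q.2 hq.1 hq.2.1 hq.2.2).symm
      chen := fun s u t h1 h2 h3 h4 => by
        rw [← h.2 s t h1 (h2.trans h3) h4, ← h.2 s u h1 h2 (h3.trans h4),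
          ← h.2 u t (h1.trans h2) h3 h4, ← h.incr_eq h1 h2 (h3.trans h4),
          ← h.incr_eq (h1.trans h2) h3 h4]
        exact hX.isRoughPath.chen s u t h1 h2 h3 h4
      bound_trace := hX.isRoughPath.bound_trace.imp fun C hC s t h1 h2 h3 => by
        rw [← h.incr_eq h1 h2.le h3]
        exact hC s t h1 h2 h3
      bound_second := hX.isRoughPath.bound_second.imp fun C hC s t h1 h2 h3 => by
        rw [← h.2 s t h1 h2.le h3]
        exact hC s t h1 h2 h3 }
  sym := fun s t h1 h2 h3 => by
    rw [← h.2 s t h1 h2 h3, ← h.incr_eq h1 h2 h3]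
    exact hX.sym s t h1 h2 h3

theorem SolvesOn.congr (hS : 0 ≤ S) {X X' : RoughPair (Euc N)} (hX : SolvesOn p ω Y Z x₀ S X)
    (h : X.AgreeOn S X') : SolvesOn p ω Y Z x₀ S X' where
  mem :=
    { weaklyGeometric := hX.mem.weaklyGeometric.congr h
      trace_mem := fun t h1 h2 => h.1 t h1 h2 ▸ hX.mem.trace_mem t h1 h2
      integral_eq_zero := fun k α hα h0 =>
        have H := hX.mem.integral_eq_zero k α hα h0
        ⟨H.weaklyGeometric, H.start,
          H.first.congr (fun _ _ _ _ _ => rfl) fun s t h1 h2 h3 => by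
            rw [h.1 s h1 (h2.trans h3), h.2 s t h1 h2 h3, h.incr_eq h1 h2 h3],
          H.second.congr (fun _ _ _ _ _ => rfl) fun s t h1 h2 h3 => by
            rw [h.1 s h1 (h2.trans h3), h.2 s t h1 h2 h3]⟩ }
  start := (h.1 0 le_rfl hS).symm.trans hX.start
  first := hX.first.congr (fun _ _ h1 h2 h3 => h.incr_eq h1 h2 h3) fun s t h1 h2 h3 => by
    rw [h.1 s h1 (h2.trans h3)]
  second := hX.second.congr (fun s t h1 h2 h3 => h.2 s t h1 h2 h3) fun s t h1 h2 h3 => by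
    rw [h.1 s h1 (h2.trans h3)]

theorem SolvesOn.isTracePath {X : RoughPair (Euc N)} (hX : SolvesOn p ω Y Z x₀ S X) :
    IsTracePath p ω Y Z 0 S X.trace := by
  obtain ⟨δ, hδ, C, hC, hb⟩ := hX.first
  refine ⟨hX.mem.weaklyGeometric.isRoughPath.continuousOn_trace, hX.mem.trace_mem, δ, hδ, C, hC.le,
    fun s t h1 h2 h3 h4 => hb s t h1 h2 h3 ?_⟩
  rwa [abs_sub_comm, abs_of_nonneg (sub_nonneg.2 h2)]

theorem IsTracePath.eq_of_eq (hM : IsEmbeddedSubmanifold d M) (hω : IsControl T ω) (hp : 0 < p)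
    (hp3 : p < 3) (hZ : IsRoughPath p ω T Z) (hST : S ≤ T) {x y : ℝ → Euc N}
    (hx : IsTracePath p ω Y Z 0 S x) (hy : IsTracePath p ω Y Z 0 S y) (hxy : x 0 = y 0) {t : ℝ}
    (ht : 0 ≤ t) (htS : t ≤ S) : x t = y t := by
  obtain ⟨G, O, hG, hO, hKO, hGY⟩ := exists_extension_of_isCompact hM Y
    ((isCompact_Icc.image_of_continuousOn hx.continuousOn).union
      (isCompact_Icc.image_of_continuousOn hy.continuousOn)) (by
      rintro _ (⟨t, ht, rfl⟩ | ⟨t, ht, rfl⟩)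
      · exact hx.mem t ht.1 ht.2
      · exact hy.mem t ht.1 ht.2)
  obtain ⟨δ₁, hδ₁, C₁, hC₁, hx'⟩ := hx.exists_rdeStep hM hG hO hGY
    fun t h1 h2 => hKO (Or.inl ⟨t, ⟨h1, h2⟩, rfl⟩)
  obtain ⟨δ₂, hδ₂, C₂, hC₂, hy'⟩ := hy.exists_rdeStep hM hG hO hGY
    fun t h1 h2 => hKO (Or.inr ⟨t, ⟨h1, h2⟩, rfl⟩)
  refine rde_path_unique hω hp hp3 hG hZ hST (lt_min hδ₁ hδ₂) (hC₁.trans (le_max_left C₁ C₂))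
    hx.continuousOn hy.continuousOn (fun s t h1 h2 h3 h4 => ?_) (fun s t h1 h2 h3 h4 => ?_) hxy
    ht htS
  · have := hω.nonneg h1 h2 (h3.trans hST)
    exact (hx' s t h1 h2 h3 (h4.trans (min_le_left _ _))).trans
      (by gcongr; exact le_max_left _ _)
  · have := hω.nonneg h1 h2 (h3.trans hST)
    exact (hy' s t h1 h2 h3 (h4.trans (min_le_right _ _))).trans
      (by gcongr; exact le_max_right _ _)

/-- Two processes with the same Chen defect which agree to third order coincide: their difference
is additive. -/
theorem second_eq_of_chen {V : Type*} [NormedAddCommGroup V] [InnerProductSpace ℝ V]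
    (hω : IsControl S ω) (hp : 0 < p) (hp3 : p < 3) {X X' : RoughPair V}
    (hX : IsRoughPath p ω S X) (hX' : IsRoughPath p ω S X')
    (hincr : ∀ s t, 0 ≤ s → s ≤ t → t ≤ S → X.incr s t = X'.incr s t) {δ C : ℝ} (hδ : 0 < δ)
    (hC : 0 ≤ C) (h : ∀ s t, 0 ≤ s → s ≤ t → t ≤ S → t - s ≤ δ →
      ‖X.second s t - X'.second s t‖ ≤ C * ω s t ^ (3 / p))
    {s t : ℝ} (hs : 0 ≤ s) (hst : s ≤ t) (ht : t ≤ S) : X.second s t = X'.second s t := by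
  obtain ⟨B, hB⟩ := (isCompact_simplex S).exists_bound_of_continuousOn
    (hX.continuousOn_second.sub hX'.continuousOn_second)
  obtain ⟨C', -, hC'⟩ := hω.exists_le_rpow_of_local (γ := 3 / p) (by positivity) hδ hC h
    fun s t h1 h2 h3 => hB (s, t) ⟨h1, h2, h3⟩
  set f : ℝ → V ⊗[ℝ] V := fun t => X.second 0 t - X'.second 0 t with hf
  have hadd : ∀ s t, 0 ≤ s → s ≤ t → t ≤ S → f t - f s = X.second s t - X'.second s t := by
    intro s t h1 h2 h3
    simp only [hf]
    rw [hX.chen 0 s t le_rfl h1 h2 h3, hX'.chen 0 s t le_rfl h1 h2 h3,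
      hincr 0 s le_rfl h1 (h2.trans h3), hincr s t h1 h2 h3]
    abel
  have hcst : ∀ t, 0 ≤ t → t ≤ S → f t = f 0 := fun t h1 h2 =>
    eq_of_norm_sub_le_rpow hω (γ := 3 / p) (by rwa [one_lt_div hp]) le_rfl le_rfl (C := C')
      (fun s t a1 a2 a3 => by
        rw [hadd s t a1 a2 a3]
        exact hC' s t a1 a2 a3) h1 h2
  have h := hadd s t hs hst ht
  rw [hcst t (hs.trans hst) ht, hcst s hs (hst.trans ht), sub_self] at h
  exact sub_eq_zero.1 h.symm

theorem SolvesOn.agreeOn (hM : IsEmbeddedSubmanifold d M) (hω : IsControl T ω) (hp : 0 < p)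
    (hp3 : p < 3) (hZ : IsRoughPath p ω T Z) (hST : S ≤ T) {X X' : RoughPair (Euc N)}
    (hX : SolvesOn p ω Y Z x₀ S X) (hX' : SolvesOn p ω Y Z x₀ S X') : X.AgreeOn S X' := by
  have htr : ∀ t, 0 ≤ t → t ≤ S → X.trace t = X'.trace t := fun t h1 h2 =>
    hX.isTracePath.eq_of_eq hM hω hp hp3 hZ hST hX'.isTracePath (hX.start.trans hX'.start.symm)
      h1 h2
  refine ⟨htr, fun s t h1 h2 h3 => ?_⟩
  obtain ⟨δ₁, hδ₁, C₁, hC₁, hb₁⟩ := hX.second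
  obtain ⟨δ₂, hδ₂, C₂, hC₂, hb₂⟩ := hX'.second
  refine second_eq_of_chen (hω.mono_right hST) hp hp3 hX.mem.weaklyGeometric.isRoughPath
    hX'.mem.weaklyGeometric.isRoughPath (fun s t h1 h2 h3 => ?_) (lt_min hδ₁ hδ₂)
    (add_pos hC₁ hC₂).le (fun s t h1 h2 h3 h4 => ?_) h1 h2 h3
  · rw [RoughPair.incr, RoughPair.incr, htr t (h1.trans h2) h3, htr s h1 (h2.trans h3)]
  · rw [le_min_iff] at h4
    have habs : |s - t| = t - s := by rw [abs_sub_comm, abs_of_nonneg (sub_nonneg.2 h2)]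
    have e1 := hb₁ s t h1 h2 h3 (habs.trans_le h4.1)
    have e2 := hb₂ s t h1 h2 h3 (habs.trans_le h4.2)
    beta_reduce at e1 e2
    rw [← htr s h1 (h2.trans h3), norm_sub_rev] at e2
    rw [add_mul]
    exact (norm_sub_le_norm_sub_add_norm_sub _ _ _).trans (add_le_add e1 e2)

theorem SolvesOn.exists_extend (hM : IsEmbeddedSubmanifold d M) (hω : IsControl T ω) (hp : 0 < p)
    (hp3 : p < 3) (hZ : IsWeaklyGeometric p ω T Z) (hS : 0 ≤ S) (hSS' : S ≤ S') (hS' : S' ≤ T)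
    {X : RoughPair (Euc N)} (hX : SolvesOn p ω Y Z x₀ S X) {y : ℝ → Euc N}
    (hy : IsTracePath p ω Y Z S S' y) (hyS : y S = X.trace S) :
    ∃ X' : RoughPair (Euc N), SolvesOn p ω Y Z x₀ S' X' := by
  obtain ⟨X', -, hX'⟩ := (hX.isTracePath.glue hM hω hp hZ.isRoughPath hS hSS' hS' hy
    hyS.symm).exists_solvesOn hM hω hp hp3 hZ (hS.trans hSS') hS'
  rw [if_pos hS, hX.start] at hX'
  exact ⟨X', hX'⟩

/-- Solutions on all the intervals `[0, S]` with `S < τ` combine, by uniqueness, to a solution on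
`[0, τ)`. -/
theorem exists_solvesBefore (hM : IsEmbeddedSubmanifold d M) (hω : IsControl T ω) (hp : 0 < p)
    (hp3 : p < 3) (hZ : IsRoughPath p ω T Z) {τ : ℝ} (hτT : τ ≤ T)
    (h : ∀ S, 0 < S → S < τ → ∃ X : RoughPair (Euc N), SolvesOn p ω Y Z x₀ S X) :
    ∃ X : RoughPair (Euc N), SolvesBefore p ω Y Z x₀ τ X := by
  have : Nonempty (RoughPair (Euc N)) := ⟨RoughPair.zero _⟩
  choose! R hR using h
  -- at time `t` the value is that of the solution on `[0, (t + τ) / 2]`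
  refine ⟨⟨fun t => (R ((t + τ) / 2)).trace t, fun s t => (R ((t + τ) / 2)).second s t⟩,
    fun S hS hSτ => ?_⟩
  have hagree : ∀ t, 0 ≤ t → t ≤ S →
      (R ((S + τ) / 2)).AgreeOn ((t + τ) / 2) (R ((t + τ) / 2)) := fun t h1 h2 =>
    SolvesOn.agreeOn hM hω hp hp3 hZ (by linarith)
      ((hR ((S + τ) / 2) (by linarith) (by linarith)).mono (by linarith))
      (hR ((t + τ) / 2) (by linarith) (by linarith))
  refine ((hR ((S + τ) / 2) (by linarith) (by linarith)).mono (by linarith)).congr hS.le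
    ⟨fun t h1 h2 => (hagree t h1 h2).1 t h1 (by linarith), fun s t h1 h2 h3 =>
      (hagree t (h1.trans h2) h3).2 s t h1 h2 (by linarith)⟩

/-- The solution continues for a uniform time from a compact subset of `M`, so at the end of the
maximal interval it leaves all of these. -/
theorem exists_solvesOn_or_exists_explosion (hM : IsEmbeddedSubmanifold d M) (hω : IsControl T ω)
    (hT : 0 < T) (hp : 0 < p) (hp3 : p < 3) (Y : Euc n →ₗ[ℝ] vectorFields d M)
    (hZ : IsWeaklyGeometric p ω T Z) (hx₀ : x₀ ∈ M) :
    (∃ X : RoughPair (Euc N), SolvesOn p ω Y Z x₀ T X) ∨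
      ∃ τ, 0 < τ ∧ τ ≤ T ∧ ∃ X : RoughPair (Euc N),
        SolvesBefore p ω Y Z x₀ τ X ∧ ¬ IsCompact (traceClosure M τ X) := by
  refine or_iff_not_imp_left.2 fun hnot => ?_
  set A : Set ℝ := {S | 0 < S ∧ S ≤ T ∧ ∃ X : RoughPair (Euc N), SolvesOn p ω Y Z x₀ S X} with hA
  have hAT : BddAbove A := ⟨T, fun S hS => hS.2.1⟩
  obtain ⟨S₀, hS₀⟩ : A.Nonempty := by
    obtain ⟨δ, hδ, h⟩ := exists_uniform_local_tracePath hM hω hp hp3 Y hZ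
      (isCompact_singleton (x := x₀)) (Set.singleton_subset_iff.2 hx₀)
    have h0 : 0 < min (δ / 2) T := lt_min (half_pos hδ) hT
    obtain ⟨x, hx, hxp⟩ := h x₀ rfl 0 (min (δ / 2) T) le_rfl h0.le (min_le_right _ _)
      (by linarith [min_le_left (δ / 2) T])
    obtain ⟨X, -, hX⟩ := hxp.exists_solvesOn hM hω hp hp3 hZ h0.le (min_le_right _ _)
    exact ⟨_, h0, min_le_right _ _, X, hx ▸ hX⟩
  have hτ : 0 < sSup A := hS₀.1.trans_le (le_csSup hAT hS₀)
  have hτT : sSup A ≤ T := csSup_le ⟨S₀, hS₀⟩ fun S hS => hS.2.1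
  set τ := sSup A with hτdef
  obtain ⟨X, hX⟩ := exists_solvesBefore hM hω hp hp3 hZ.isRoughPath (Y := Y) (x₀ := x₀) hτT
    fun S _ hSτ => by
      obtain ⟨S', ⟨-, -, X, hX⟩, hlt⟩ := exists_lt_of_lt_csSup ⟨S₀, hS₀⟩ hSτ
      exact ⟨X, hX.mono hlt.le⟩
  refine ⟨τ, hτ, hτT, X, hX, fun hcomp => hnot ?_⟩
  obtain ⟨δ, hδ, h⟩ := exists_uniform_local_tracePath hM hω hp hp3 Y hZ
    (hcomp.image continuous_subtype_val) (by
      rintro _ ⟨m, -, rfl⟩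
      exact m.2)
  -- a positive time before `τ`, from which a time step shorter than `δ` leads past `τ`
  set S₁ := max (τ / 2) (τ - δ / 2) with hS₁
  have h1 : 0 < S₁ := (half_pos hτ).trans_le (le_max_left _ _)
  have h2 : S₁ < τ := max_lt (by linarith) (by linarith)
  have h3 : τ - δ / 2 ≤ S₁ := le_max_right _ _
  have hX₁ := hX S₁ h1 h2
  have hmem : X.trace S₁ ∈ Subtype.val '' traceClosure M τ X :=
    ⟨⟨X.trace S₁, hX₁.mem.trace_mem S₁ h1.le le_rfl⟩, subset_closure ⟨S₁, h1.le, h2, rfl⟩, rfl⟩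
  have h4 : S₁ ≤ min T (S₁ + 3 / 4 * δ) := le_min (h2.le.trans hτT) (by linarith)
  obtain ⟨y, hy, hyp⟩ := h _ hmem S₁ (min T (S₁ + 3 / 4 * δ)) h1.le h4 (min_le_left _ _)
    (by linarith [min_le_right T (S₁ + 3 / 4 * δ)])
  obtain ⟨X', hX'⟩ := hX₁.exists_extend hM hω hp hp3 hZ h1.le h4 (min_le_left _ _) hyp hy
  have h5 : min T (S₁ + 3 / 4 * δ) ≤ τ :=
    le_csSup hAT ⟨h1.trans_le h4, min_le_left _ _, X', hX'⟩
  rcases min_choice T (S₁ + 3 / 4 * δ) with h6 | h6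
  · rw [h6] at hX'
    exact ⟨X', hX'⟩
  · rw [h6] at h5
    linarith

end Maximal

end RoughManifold

theorem theorem4p2 {N n d : ℕ} (M : Set (Euc N)) (hM : IsEmbeddedSubmanifold d M)
    (p : ℝ) (hp : 2 ≤ p) (hp' : p < 3) (T : ℝ) (hT : 0 < T)
    (ω : ℝ → ℝ → ℝ) (hω : IsControl T ω)
    (Y : Euc n →ₗ[ℝ] vectorFields d M)
    (Z : RoughPair (Euc n)) (hZ : IsWeaklyGeometric p ω T Z)
    (x₀ : Euc N) (hx₀ : x₀ ∈ M) :
    (∀ S, 0 < S → S ≤ T → ∀ X X' : RoughPair (Euc N),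
      SolvesOn p ω Y Z x₀ S X → SolvesOn p ω Y Z x₀ S X' → X.AgreeOn S X') ∧
    ((∃ X : RoughPair (Euc N), SolvesOn p ω Y Z x₀ T X) ∨
      ∃ τ, 0 < τ ∧ τ ≤ T ∧ ∃ X : RoughPair (Euc N),
        SolvesBefore p ω Y Z x₀ τ X ∧ ¬ IsCompact (traceClosure M τ X)) := by
  have hp0 : 0 < p := by linarith
  exact ⟨fun S _ hST X X' hX hX' => hX.agreeOn hM hω hp0 hp' hZ.isRoughPath hST hX',
    exists_solvesOn_or_exists_explosion hM hω hT hp0 hp' Y hZ hx₀⟩
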